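/- Let $\mathbb{K}$ be a (not necessarily commutative) field with $|\mathbb{K}|>2$, and let $N>3$. **Definitions.** An *oval* in a projective plane is a nonempty set $O$ of points, no three collinear, such that through each point of $O$ there is a unique line of the plane meeting $O$ only in that point. A *tube* $C$ with *vertex* $v$ in a 3-dimensional projective space $\Sigma$ is the set of points distinct from $v$ on the lines joining $v$ to the points of an oval $O$, where $O$ lies in a plane of $\Sigma$ not containing $v$; these lines are the *generators* of $C$. For $x\in C$, the *tangent plane* $T_x(C)$ is the plane of $\Sigma$ through $x$ that meets $C$ exactly in the points different from $v$ of the generator through $x$. Let $X$ be a spanning point set of $\mathsf{PG}(N,\mathbb{K})$ and let $\Xi$ be a collection of 3-dimensional subspaces such that, for each $\xi\in\Xi$, the intersection $X(\xi)=X\cap\xi$ is a tube in $\xi$. Let $Y$ be the set of vertices of all these tubes. The pair $(X,\Xi)$ is a *Hjelmslevian Veronesean set* (of index 2) if * (H1) any two points $x,y$ of $X$ lie in at least one member of $\Xi$, denoted by $[x,y]$ if it is unique; * (H2) if $\xi_1\ne\xi_2$ are members of $\Xi$, then $\xi_1\cap\xi_2\subseteq X\cup Y$, and, if $\xi_1\cap\xi_2\neq\emptyset$,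 then $\xi_1\cap\xi_2\cap Y$ is contained in a subspace of codimension 1 of $\xi_1\cap\xi_2$; * (H3*) for each $x\in X$ there is a 4-dimensional subspace containing all planes $T_x(X([x,y]))$, where $y\in X\setminus\{x\}$ and $[x,y]$ is defined. A plane $\pi$ is *singular* if it contains a unique line $L$ all of whose points belong to $Y$, and all points of $\pi\setminus L$ belong to $X$; then $L$ is the *radical line* of $\pi$. **Proposition.** Let $(X,\Xi)$ be a Hjelmslevian Veronesean set in $\mathsf{PG}(N,\mathbb{K})$, and suppose that it is not the case that $N=6$, $Y=\{t\}$ is a single point and $X\cup Y$ is a cone with vertex $t$ over a quadric Veronese variety of $\mathsf{PG}(2,\mathbb{K})$ (a set projectively equivalent to $\{(x_0^2,x_1^2,x_2^2,x_0x_1,x_0x_2,x_1x_2)\}$, which requires $\mathbb{K}$ to be commutative) lying in a 5-space not through $t$. Let $T=\{X(\xi):\xi\in\Xi\}$ be the set of all tubes. Then $Y$ is the point set of a plane $\pi_Y$, every point of $X$ lies in a unique singular plane, and $(X,T)$ is a *projective Hjelmslev plane of level 2*. More exactly: let $\pi_Y^*$ be the plane dual to $\pi_Y$ (its points are the lines of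 $\pi_Y$, and its lines are the pencils of lines of $\pi_Y$ through a point of $\pi_Y$), and let $\chi:X\to\pi_Y^*$ send $x$ to the radical line of the unique singular plane through $x$. Then $\chi$ is an epimorphism of $(X,T)$ onto $\pi_Y^*$ (it is surjective on points, the image of every tube is a line of $\pi_Y^*$, and every line of $\pi_Y^*$ is the image of a tube) with the following properties. * (Hj1) Two distinct points of $X$ are always joined by at least one member of $T$; they are joined by a unique member of $T$ if and only if their images under $\chi$ are distinct. * (Hj2) Two distinct members of $T$ always intersect in at least one point; they intersect in a unique point if and only if their images under $\chi$ are distinct. * (Hj3) For every point $a$ of $\pi_Y^*$, the set $\chi^{-1}(a)$, with as lines its nonempty intersections with members of $T$, is an affine plane. * (Hj4) For every line $m$ of $\pi_Y^*$, the geometry whose points are the tubes contained in $\chi^{-1}(m)$ and whose lines are the intersections $C\cap D$ of two distinct such tubes, a tube $E$ being incident with $C\cap D$ when $C\cap D\subseteq E$, is an affine plane. -/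

import Mathlib

open Module

/-! Projective space is `ℙ K V`; its subspaces of projective dimension `d` are the submodules
of `V` of rank `d + 1`. -/

/-- The set of points of the projective subspace given by the submodule `W`. -/
def pts {K V : Type*} [DivisionRing K] [AddCommGroup V] [Module K V]
    (W : Submodule K V) : Set (Projectivization K V) :=
  {p | p.submodule ≤ W}

/-- An oval `O` of the plane `π`: a nonempty set of points of `π`, no three of which are
collinear, with a unique tangent line in `π` at each of its points. -/
structure IsOval {K V : Type*} [DivisionRing K] [AddCommGroup V] [Module K V]
    (π : Submodule K V) (O : Set (Projectivization K V)) : Prop where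
  plane : finrank K π = 3
  subset : O ⊆ pts π
  nonempty : O.Nonempty
  no_three : ∀ a ∈ O, ∀ b ∈ O, ∀ c ∈ O, a ≠ b → b ≠ c → a ≠ c →
    ∀ L : Submodule K V, finrank K L = 2 → ¬ (a ∈ pts L ∧ b ∈ pts L ∧ c ∈ pts L)
  tangent : ∀ x ∈ O, ∃! L : Submodule K V, finrank K L = 2 ∧ L ≤ π ∧ pts L ∩ O = {x}

/-- The union of the lines joining the point `v` to the points of the base `O`. -/
def coneOver {K V : Type*} [DivisionRing K] [AddCommGroup V] [Module K V]
    (v : Projectivization K V) (O : Set (Projectivization K V)) :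
    Set (Projectivization K V) :=
  {p | ∃ o ∈ O, p ∈ pts (o.submodule ⊔ v.submodule)}

/-- `C` is a tube with vertex `v` in the 3-dimensional projective space `S`. -/
def IsTube {K V : Type*} [DivisionRing K] [AddCommGroup V] [Module K V]
    (S : Submodule K V) (v : Projectivization K V) (C : Set (Projectivization K V)) : Prop :=
  finrank K S = 4 ∧ v ∈ pts S ∧
    ∃ (π : Submodule K V) (O : Set (Projectivization K V)),
      IsOval π O ∧ π ≤ S ∧ v ∉ pts π ∧ C = coneOver v O \ {v}

/-- `τ` is the tangent plane at the point `x ∈ C` to the tube `C` with vertex `v` in `S`: the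
plane of `S` through `x` which meets `C` exactly in the generator through `x`. -/
def IsTangentPlane {K V : Type*} [DivisionRing K] [AddCommGroup V] [Module K V]
    (S : Submodule K V) (v : Projectivization K V) (C : Set (Projectivization K V))
    (x : Projectivization K V) (τ : Submodule K V) : Prop :=
  τ ≤ S ∧ finrank K τ = 3 ∧ x ∈ pts τ ∧ pts τ ∩ C = pts (x.submodule ⊔ v.submodule) \ {v}

/-- The set `Y` of the vertices of the tubes `X ∩ ξ`, `ξ ∈ Ξ`. -/
def vertexSet {K V : Type*} [DivisionRing K] [AddCommGroup V] [Module K V]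
    (X : Set (Projectivization K V)) (Ξ : Set (Submodule K V)) :
    Set (Projectivization K V) :=
  {v | ∃ ξ ∈ Ξ, IsTube ξ v (X ∩ pts ξ)}

/-- Hjelmslevian Veronesean sets (of index 2) in the projective space of `V`. -/
structure IsHjelmslevianVeronesean {K V : Type*} [DivisionRing K] [AddCommGroup V] [Module K V]
    (X : Set (Projectivization K V)) (Ξ : Set (Submodule K V)) : Prop where
  /-- The projective space has finite projective dimension `N > 3`. -/
  dim : 3 + 1 < finrank K V
  spanning : ⨆ p ∈ X, p.submodule = ⊤
  /-- Every `ξ ∈ Ξ` is a 3-dimensional projective subspace meeting `X` in a tube of `ξ`. -/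
  tube : ∀ ξ ∈ Ξ, finrank K ξ = 4 ∧ ∃ v, IsTube ξ v (X ∩ pts ξ)
  H1 : ∀ x ∈ X, ∀ y ∈ X, x ≠ y → ∃ ξ ∈ Ξ, x ∈ pts ξ ∧ y ∈ pts ξ
  H2 : ∀ ξ₁ ∈ Ξ, ∀ ξ₂ ∈ Ξ, ξ₁ ≠ ξ₂ →
    pts (ξ₁ ⊓ ξ₂) ⊆ X ∪ vertexSet X Ξ ∧
    (ξ₁ ⊓ ξ₂ ≠ ⊥ → ∃ H : Submodule K V, H ≤ ξ₁ ⊓ ξ₂ ∧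
      finrank K H + 1 = finrank K (ξ₁ ⊓ ξ₂ : Submodule K V) ∧
      pts (ξ₁ ⊓ ξ₂) ∩ vertexSet X Ξ ⊆ pts H)
  /-- `ξ` ranges over the spaces `[x, y]`, that is, `ξ` is the unique member of `Ξ` through
  `x` and `y`. -/
  H3 : ∀ x ∈ X, ∃ T : Submodule K V, finrank K T = 5 ∧
    ∀ y ∈ X, y ≠ x → ∀ ξ ∈ Ξ, x ∈ pts ξ → y ∈ pts ξ →
      (∀ ξ' ∈ Ξ, x ∈ pts ξ' → y ∈ pts ξ' → ξ' = ξ) →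
      ∀ v τ, IsTube ξ v (X ∩ pts ξ) → IsTangentPlane ξ v (X ∩ pts ξ) x τ → τ ≤ T

/-- `S` is a quadric Veronese variety of the projective plane over `K` in the 5-dimensional
projective space `W`; this notion needs a commutative field. -/
def IsQuadricVeronese {K V : Type*} [DivisionRing K] [AddCommGroup V] [Module K V]
    (W : Submodule K V) (S : Set (Projectivization K V)) : Prop :=
  (∀ a b : K, a * b = b * a) ∧
  ∃ e : Fin 6 → V, LinearIndependent K e ∧ Submodule.span K (Set.range e) = W ∧
    S = {p | ∃ x : Fin 3 → K, x ≠ 0 ∧ p.submodule = Submodule.span K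
      {(x 0 * x 0) • e 0 + (x 1 * x 1) • e 1 + (x 2 * x 2) • e 2
        + (x 0 * x 1) • e 3 + (x 0 * x 2) • e 4 + (x 1 * x 2) • e 5}}

/-- The whole space has projective dimension 6, and `X ∪ Y` is a cone with vertex a point `t`
over a quadric Veronese variety in a 5-space not through `t`, with `Y = {t}`. -/
def IsVeroneseCone {K V : Type*} [DivisionRing K] [AddCommGroup V] [Module K V]
    (X Y : Set (Projectivization K V)) : Prop :=
  ∃ (t : Projectivization K V) (W : Submodule K V) (S : Set (Projectivization K V)),
    finrank K V = 7 ∧ IsQuadricVeronese W S ∧ t ∉ pts W ∧ X ∪ Y = coneOver t S ∧ Y = {t}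

/-- `π` is a singular plane with radical line `L`. -/
structure IsSingularPlane {K V : Type*} [DivisionRing K] [AddCommGroup V] [Module K V]
    (X Y : Set (Projectivization K V)) (π L : Submodule K V) : Prop where
  plane : finrank K π = 3
  line : finrank K L = 2
  le : L ≤ π
  radical : pts L ⊆ Y
  unique : ∀ L' : Submodule K V, finrank K L' = 2 → L' ≤ π → pts L' ⊆ Y → L' = L
  rest : pts π \ pts L ⊆ X

/-- The geometry with point set `P` and set of lines `𝓛` is an affine plane. -/
structure IsAffinePlane {α : Type*} (P : Set α) (𝓛 : Set (Set α)) : Prop where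
  subset : ∀ l ∈ 𝓛, l ⊆ P
  join : ∀ p ∈ P, ∀ q ∈ P, p ≠ q → ∃! l, l ∈ 𝓛 ∧ p ∈ l ∧ q ∈ l
  parallel : ∀ l ∈ 𝓛, ∀ p ∈ P, p ∉ l → ∃! m, m ∈ 𝓛 ∧ p ∈ m ∧ Disjoint m l
  triangle : ∃ p ∈ P, ∃ q ∈ P, ∃ r ∈ P, p ≠ q ∧ ¬ ∃ l ∈ 𝓛, p ∈ l ∧ q ∈ l ∧ r ∈ l

/-- `χ` is an epimorphism of the point-line geometry `(P, T)` onto the point-line geometry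
`(Q, M)`, lines being sets of points. -/
structure IsGeomEpi {P Q : Type*} (T : Set (Set P)) (M : Set (Set Q)) (χ : P → Q) : Prop where
  surj_points : Function.Surjective χ
  map_line : ∀ C ∈ T, χ '' C ∈ M
  surj_lines : ∀ m ∈ M, ∃ C ∈ T, χ '' C = m

/-- `χ` is an epimorphism of `(P, T)` onto `(Q, M)` with the properties which (when `(Q, M)` is
a projective plane) make `(P, T)` a projective Hjelmslev plane of level 2. -/
structure IsHjelmslevEpi {P Q : Type*} (T : Set (Set P)) (M : Set (Set Q)) (χ : P → Q) :
    Prop where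
  epi : IsGeomEpi T M χ
  Hj1_join : ∀ p q : P, p ≠ q → ∃ C ∈ T, p ∈ C ∧ q ∈ C
  Hj1_unique : ∀ p q : P, p ≠ q → ((∃! C, C ∈ T ∧ p ∈ C ∧ q ∈ C) ↔ χ p ≠ χ q)
  Hj2_meet : ∀ C ∈ T, ∀ D ∈ T, C ≠ D → (C ∩ D).Nonempty
  Hj2_unique : ∀ C ∈ T, ∀ D ∈ T, C ≠ D → ((∃! p, p ∈ C ∩ D) ↔ χ '' C ≠ χ '' D)
  /-- The lines are the nonempty intersections of the point set with members of `T`. -/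
  Hj3 : ∀ a : Q, IsAffinePlane (χ ⁻¹' {a}) {l | ∃ C ∈ T, l = C ∩ χ ⁻¹' {a} ∧ l.Nonempty}
  /-- The points are the members of `T` inside `χ⁻¹(m)`; the lines are the intersections
  `C ∩ D` of two of them, incident with those which contain `C ∩ D`. -/
  Hj4 : ∀ m ∈ M, IsAffinePlane {C | C ∈ T ∧ C ⊆ χ ⁻¹' m}
    {l | ∃ C D, (C ∈ T ∧ C ⊆ χ ⁻¹' m) ∧ (D ∈ T ∧ D ⊆ χ ⁻¹' m) ∧ C ≠ D ∧
      l = {E | (E ∈ T ∧ E ⊆ χ ⁻¹' m) ∧ C ∩ D ⊆ E}}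

/-- The set of tubes `X ∩ ξ`, `ξ ∈ Ξ`, as sets of points of `X`. -/
def tubes {K V : Type*} [DivisionRing K] [AddCommGroup V] [Module K V]
    (X : Set (Projectivization K V)) (Ξ : Set (Submodule K V)) : Set (Set X) :=
  {C | ∃ ξ ∈ Ξ, C = {p : X | (p : Projectivization K V) ∈ pts ξ}}

/-- The points of the plane dual to `π`: the lines of `π`. -/
def DualPoint {K V : Type*} [DivisionRing K] [AddCommGroup V] [Module K V]
    (π : Submodule K V) : Type _ :=
  {L : Submodule K V // finrank K L = 2 ∧ L ≤ π}

/-- The lines of the plane dual to `π`: the pencils of the lines of `π` through a point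
of `π`. -/
def dualLines {K V : Type*} [DivisionRing K] [AddCommGroup V] [Module K V]
    (π : Submodule K V) : Set (Set (DualPoint π)) :=
  {m | ∃ y ∈ pts π, m = {L : DualPoint π | y ∈ pts L.1}}

/-!
The argument is carried out with vectors: `vecs X` is the set of vectors representing the points
of `X`, and `IsHVSystem` restates the axioms for such sets `X` and `Y`.

For a point `x` the vertices of the singular lines through `x` form, with zero, a subspace `rad x`
(`IsHVSystem.plane`), and `sing x = ⟨x⟩ ⊕ rad x` consists of points of `X` off `rad x`. The sets
`X ∩ sing x` are classes of points; two points of different classes are on a unique tube, whose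
vertex is the only common point of their radicals. By the tangent axiom, radicals have rank at
most 2 (`finrank_rad_le`).

If some radical has rank 1, then all tubes have the same vertex `t` (`rad_eq_single`), and a
hyperplane off `t` meets them in a system of ovals that pairwise meet in one point. Such a system
has rank 6 (`IsOvalSystem.mem_sup`), and its tangent lines at a point lie in a plane
(`tangent_le_span`). In coordinates with respect to a triangle and the intersections of the tangents
at its vertices (`IsFrame`), the planes through one vertex show that a coordinate has the form
`m * (l * k)` in the affine parameters `l` and `m`, and those through another vertex that it is
`l * (m * k)`; hence the field is commutative, and the planes through the third vertex yield the
equations of the quadric Veronese surface (`IsFrame.exists_veronese`). This is the excluded cone.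

Otherwise all radicals are lines of one plane `π` (`exists_plane`). Two facts on a tube with vertex
`v` are decisive: it meets each class with radical through `v`
(`exists_mem_sing_of_vertex`, by a dimension argument), and each line of `π` through `v` is
a radical (`IsPointed.exists_rad_eq`). For the latter, modulo the span of the tube and `π`, each
class of the tube is a direction in which all tubes joining it to the other points are tangent; the
subspace of the tangents at another point is spanned by two such directions, and the tangent of a
tube whose vertex is on a line of `π` that is not a radical would have to be one of them.

So the points of `π` are the vertices, `x ↦ rad x` maps `X` onto the lines of `π`, and tubes onto
the pencils of their vertices. Singular planes being the subspaces `sing x`, the fibres are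
affine planes; tubes with vertices `v ≠ w` meet in the singular plane with radical `⟨v, w⟩`, and
tubes with the same vertex share exactly one generator. The tubes with vertex `v` form an affine
plane in which parallel generators are those in the same class.
-/

/-! ### Spans of few vectors -/

section LinearAlgebra

variable {K V : Type*} [DivisionRing K] [AddCommGroup V] [Module K V]

lemma mem_single {a x : V} : x ∈ Submodule.span K {a} ↔ ∃ c : K, x = c • a := by
  rw [Submodule.mem_span_singleton]
  exact ⟨fun ⟨c, h⟩ => ⟨c, h.symm⟩, fun ⟨c, h⟩ => ⟨c, h.symm⟩⟩

lemma mem_pair {a b x : V} : x ∈ Submodule.span K {a, b} ↔ ∃ c d : K, x = c • a + d • b := by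
  rw [Submodule.mem_span_pair]
  exact ⟨fun ⟨c, d, h⟩ => ⟨c, d, h.symm⟩, fun ⟨c, d, h⟩ => ⟨c, d, h.symm⟩⟩

lemma left_mem_pair (a b : V) : a ∈ Submodule.span K {a, b} :=
  Submodule.subset_span (by simp)

lemma right_mem_pair (a b : V) : b ∈ Submodule.span K {a, b} :=
  Submodule.subset_span (by simp)

lemma smul_mem_single (a : V) (c : K) : c • a ∈ Submodule.span K {a} :=
  Submodule.smul_mem _ _ (Submodule.mem_span_singleton_self a)

lemma pair_le {W : Submodule K V} {a b : V} (ha : a ∈ W) (hb : b ∈ W) :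
    Submodule.span K {a, b} ≤ W := by
  rw [Submodule.span_le]; rintro x (rfl | rfl) <;> assumption

lemma single_le {W : Submodule K V} {a : V} (ha : a ∈ W) :
    Submodule.span K {a} ≤ W := by
  rw [Submodule.span_le]; rintro x rfl; assumption

lemma single_le_left (a b : V) : Submodule.span K {a} ≤ Submodule.span K {a, b} :=
  single_le (left_mem_pair a b)

lemma single_le_right (a b : V) : Submodule.span K {b} ≤ Submodule.span K {a, b} :=
  single_le (right_mem_pair a b)

lemma single_comm {a b : V} (hb : b ≠ 0) (h : b ∈ Submodule.span K {a}) :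
    a ∈ Submodule.span K {b} := by
  obtain ⟨c, rfl⟩ := mem_single.1 h
  have hc : c ≠ 0 := by rintro rfl; simp at hb
  exact mem_single.2 ⟨c⁻¹, by rw [inv_smul_smul₀ hc]⟩

/-- The exchange property in a plane of vectors. -/
lemma pair_exchange {a b c : V} (h : c ∈ Submodule.span K {a, b})
    (hc : c ∉ Submodule.span K {b}) : a ∈ Submodule.span K {c, b} := by
  obtain ⟨p, q, rfl⟩ := mem_pair.1 h
  have hp : p ≠ 0 := by
    rintro rfl
    exact hc (mem_single.2 ⟨q, by simp⟩)
  refine mem_pair.2 ⟨p⁻¹, -(p⁻¹ * q), ?_⟩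
  rw [smul_add, inv_smul_smul₀ hp, smul_smul]
  match_scalars <;> noncomm_ring

lemma pair_eq_of_mem {a b c : V} (h : c ∈ Submodule.span K {a, b})
    (hc : c ∉ Submodule.span K {b}) : Submodule.span K {c, b} = Submodule.span K {a, b} :=
  le_antisymm (pair_le h (right_mem_pair a b))
    (pair_le (pair_exchange h hc) (right_mem_pair c b))

lemma pair_comm (a b : V) : Submodule.span K {a, b} = Submodule.span K {b, a} := by
  rw [Set.pair_comm]

lemma mem_triple {a b c x : V} :
    x ∈ Submodule.span K {a, b, c} ↔ ∃ p q r : K, x = p • a + q • b + r • c := by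
  rw [Submodule.mem_span_triple]
  exact ⟨fun ⟨p, q, r, h⟩ => ⟨p, q, r, h.symm⟩, fun ⟨p, q, r, h⟩ => ⟨p, q, r, h.symm⟩⟩

lemma mem_sup_single {W : Submodule K V} {a x : V} :
    x ∈ W ⊔ Submodule.span K {a} ↔ ∃ c : K, x - c • a ∈ W := by
  rw [Submodule.mem_sup]
  constructor
  · rintro ⟨w, hw, z, hz, rfl⟩
    obtain ⟨c, rfl⟩ := mem_single.1 hz
    exact ⟨c, by simpa using hw⟩
  · rintro ⟨c, hc⟩
    exact ⟨_, hc, _, smul_mem_single a c, by simp⟩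

lemma finrank_pair [Module.Finite K V] {a b : V} (ha : a ≠ 0) (hb : b ∉ Submodule.span K {a}) :
    finrank K (Submodule.span K {a, b}) = 2 := by
  rw [pair_comm, Submodule.span_insert, sup_comm, Submodule.finrank_sup_span_singleton hb,
    finrank_span_singleton ha]

lemma exists_notMem_of_finrank_lt [Module.Finite K V] {W U : Submodule K V}
    (h : finrank K W < finrank K U) : ∃ x ∈ U, x ∉ W := by
  by_contra! hc
  exact absurd (Submodule.finrank_mono (show U ≤ W from hc)) (by omega)

lemma finrank_pair_le (a b : V) : finrank K (Submodule.span K {a, b}) ≤ 2 := by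
  classical
  have := finrank_span_le_card (R := K) ({a, b} : Set V)
  refine this.trans ?_
  simpa using Finset.card_le_two (a := a) (b := b)

lemma finrank_single_le (a : V) : finrank K (Submodule.span K {a}) ≤ 1 := by
  simpa using finrank_span_le_card (R := K) ({a} : Set V)

lemma finrank_sup_single_le [Module.Finite K V] (W : Submodule K V) (a : V) :
    finrank K (W ⊔ Submodule.span K {a} : Submodule K V) ≤ finrank K W + 1 := by
  by_cases h : a ∈ W
  · rw [sup_eq_left.2 (single_le h)]; omega
  · rw [Submodule.finrank_sup_span_singleton h]

/-- Two subspaces of a common subspace meet when their dimensions are large enough. -/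
lemma exists_mem_inf [Module.Finite K V] {A B U : Submodule K V} (hA : A ≤ U) (hB : B ≤ U)
    (h : finrank K U < finrank K A + finrank K B) : ∃ x, x ∈ A ∧ x ∈ B ∧ x ≠ 0 := by
  have h1 := Submodule.finrank_sup_add_finrank_inf_eq A B
  have h2 := Submodule.finrank_mono (sup_le hA hB)
  have h3 : A ⊓ B ≠ ⊥ := by
    intro h0; rw [h0, finrank_bot] at h1; omega
  obtain ⟨x, hx, hx0⟩ := Submodule.exists_mem_ne_zero_of_ne_bot h3
  exact ⟨x, hx.1, hx.2, hx0⟩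

lemma eq_pair_of_finrank [Module.Finite K V] {W : Submodule K V} (hW : finrank K W = 2)
    {a b : V} (ha : a ∈ W)
    (hb : b ∈ W) (ha0 : a ≠ 0) (hab : b ∉ Submodule.span K {a}) :
    W = Submodule.span K {a, b} :=
  (Submodule.eq_of_le_of_finrank_eq (pair_le ha hb) (by rw [hW, finrank_pair ha0 hab])).symm

end LinearAlgebra

/-! ### Tubes in terms of vectors -/

section Tubes

variable {K V : Type*} [DivisionRing K] [AddCommGroup V] [Module K V]

/-- A set of nonzero vectors closed under nonzero scaling: the vectors representing the points of
a set of points of the projective space. -/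
structure IsConeSet (K : Type*) {V : Type*} [DivisionRing K] [AddCommGroup V] [Module K V]
    (X : Set V) : Prop where
  ne_zero : ∀ u ∈ X, u ≠ 0
  smul_mem : ∀ c : K, c ≠ 0 → ∀ u ∈ X, c • u ∈ X

/-- `τ` is the tangent plane at `a` to the tube `X ∩ ξ` with vertex `v`; the last field says
that every other plane of `ξ` through the generator of `a` contains a second generator. -/
structure IsTangentAt (X : Set V) (ξ : Submodule K V) (v a : V) (τ : Submodule K V) : Prop where
  le : τ ≤ ξ
  rank : finrank K τ = 3
  base : a ∈ τ
  vertex : v ∈ τ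
  only : ∀ u ∈ X, u ∈ τ → u ∈ Submodule.span K {a, v}
  lift : ∀ g ∈ ξ, g ∉ τ → ∃ s ∈ Submodule.span K {a, v}, g + s ∈ X

/-- `X ∩ ξ` is a tube with vertex `v`, all points being given by vectors. -/
structure IsVTube (X : Set V) (ξ : Submodule K V) (v : V) : Prop where
  rank : finrank K ξ = 4
  ne_zero : v ≠ 0
  mem : v ∈ ξ
  notMem : v ∉ X
  nonempty : ∃ a ∈ X, a ∈ ξ
  cone : ∀ a ∈ X, a ∈ ξ → ∀ c : K, a + c • v ∈ X
  arc : ∀ a ∈ X, a ∈ ξ → ∀ b ∈ X, b ∈ ξ → ∀ c ∈ X, c ∈ Submodule.span K {a, b, v} →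
    c ∈ Submodule.span K {a, v} ∨ c ∈ Submodule.span K {b, v}
  tangent : ∀ a ∈ X, a ∈ ξ → ∃ τ, IsTangentAt X ξ v a τ

variable {X : Set V} {ξ τ : Submodule K V} {v a b : V}

lemma IsVTube.notMem_single (h : IsVTube X ξ v) (hX : IsConeSet K X) (ha : a ∈ X) :
    a ∉ Submodule.span K {v} := by
  intro hm
  obtain ⟨c, rfl⟩ := mem_single.1 hm
  have hc : c ≠ 0 := by rintro rfl; exact hX.ne_zero _ ha (by simp)
  have := hX.smul_mem c⁻¹ (inv_ne_zero hc) _ ha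
  rw [inv_smul_smul₀ hc] at this
  exact h.notMem this

lemma IsVTube.vertex_notMem_single (h : IsVTube X ξ v) (hX : IsConeSet K X) (ha : a ∈ X) :
    v ∉ Submodule.span K {a} :=
  fun hm => h.notMem_single hX ha (single_comm h.ne_zero hm)

lemma IsVTube.mem_of_mem_pair (h : IsVTube X ξ v) (hX : IsConeSet K X) (ha : a ∈ X)
    (haξ : a ∈ ξ) (hb : b ∈ Submodule.span K {a, v}) (hbv : b ∉ Submodule.span K {v}) :
    b ∈ X := by
  obtain ⟨c, d, rfl⟩ := mem_pair.1 hb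
  have hc : c ≠ 0 := by
    rintro rfl; exact hbv (mem_single.2 ⟨d, by simp⟩)
  have := hX.smul_mem c hc _ (h.cone a ha haξ (c⁻¹ * d))
  rwa [smul_add, smul_smul, mul_inv_cancel_left₀ hc] at this

lemma IsVTube.pair_eq (h : IsVTube X ξ v) (hX : IsConeSet K X)
    (hb : b ∈ X) (hab : b ∈ Submodule.span K {a, v}) :
    Submodule.span K {b, v} = Submodule.span K {a, v} :=
  pair_eq_of_mem hab (h.notMem_single hX hb)

/-- A vector of the span of two generators that is in both is a multiple of the vertex. -/
lemma mem_single_of_mem_pairs (hab : a ∉ Submodule.span K {b, v}) {x : V}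
    (hxa : x ∈ Submodule.span K {a, v}) (hxb : x ∈ Submodule.span K {b, v}) :
    x ∈ Submodule.span K {v} := by
  by_contra hx
  exact hab (by
    have h1 := pair_exchange hxa hx
    exact (pair_le hxb (right_mem_pair b v)) h1)

lemma IsVTube.exists_notMem [Module.Finite K V] (h : IsVTube X ξ v) (ha : a ∈ X)
    (haξ : a ∈ ξ) : ∃ b ∈ X, b ∈ ξ ∧ b ∉ Submodule.span K {a, v} := by
  obtain ⟨τ, hτ⟩ := h.tangent a ha haξ
  obtain ⟨g, hg, hgτ⟩ := exists_notMem_of_finrank_lt (W := τ) (U := ξ) (by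
    rw [hτ.rank, h.rank]; omega)
  obtain ⟨s, hs, hgs⟩ := hτ.lift g hg hgτ
  have hav : Submodule.span K {a, v} ≤ τ := pair_le hτ.base hτ.vertex
  refine ⟨g + s, hgs, ξ.add_mem hg (hτ.le (hav hs)), fun hc => hgτ ?_⟩
  exact (τ.add_mem_iff_left (hav hs)).1 (hav hc)

lemma IsTangentAt.pair_le (hτ : IsTangentAt X ξ v a τ) : Submodule.span K {a, v} ≤ τ :=
  _root_.pair_le hτ.base hτ.vertex

/-- A vector `t` of the tangent plane off the generator. -/
lemma IsTangentAt.exists_dir [Module.Finite K V] (hτ : IsTangentAt X ξ v a τ) :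
    ∃ t ∈ τ, t ∉ Submodule.span K {a, v} :=
  exists_notMem_of_finrank_lt (by
    have := finrank_pair_le (K := K) a v
    rw [hτ.rank]; omega)

lemma IsTangentAt.eq_sup [Module.Finite K V] (hτ : IsTangentAt X ξ v a τ) (h : IsVTube X ξ v)
    (hX : IsConeSet K X) (ha : a ∈ X) {t : V} (ht : t ∈ τ) (hta : t ∉ Submodule.span K {a, v}) :
    τ = Submodule.span K {a, v} ⊔ Submodule.span K {t} := by
  refine (Submodule.eq_of_le_of_finrank_eq (sup_le hτ.pair_le (single_le ht)) ?_).symm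
  rw [Submodule.finrank_sup_span_singleton hta, hτ.rank,
    finrank_pair (hX.ne_zero _ ha) (h.vertex_notMem_single hX ha)]

lemma IsTangentAt.sup_eq [Module.Finite K V] (hτ : IsTangentAt X ξ v a τ) (h : IsVTube X ξ v)
    {g : V} (hg : g ∈ ξ) (hgτ : g ∉ τ) : ξ = τ ⊔ Submodule.span K {g} := by
  refine (Submodule.eq_of_le_of_finrank_eq (sup_le hτ.le (single_le hg)) ?_).symm
  rw [Submodule.finrank_sup_span_singleton hgτ, hτ.rank, h.rank]

lemma IsTangentAt.notMem_of_notMem (hτ : IsTangentAt X ξ v a τ) (hb : b ∈ X)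
    (hba : b ∉ Submodule.span K {a, v}) : b ∉ τ :=
  fun h => hba (hτ.only b hb h)

/-- Moving a point `b` of the tube in a direction of the tangent plane at `a` leads to a third
generator. -/
lemma IsTangentAt.exists_lift (hτ : IsTangentAt X ξ v a τ)
    (hb : b ∈ X) (hbξ : b ∈ ξ) (hba : b ∉ Submodule.span K {a, v}) {t : V} (ht : t ∈ τ)
    (hta : t ∉ Submodule.span K {a, v}) :
    ∃ s ∈ Submodule.span K {a, v}, b + t + s ∈ X ∧ b + t + s ∈ ξ ∧ b + t + s ∉ τ ∧
      b + t + s ∉ Submodule.span K {b, v} := by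
  have hbτ := hτ.notMem_of_notMem hb hba
  obtain ⟨s, hs, hc⟩ := hτ.lift (b + t) (ξ.add_mem hbξ (hτ.le ht))
    (fun hm => hbτ ((τ.add_mem_iff_left ht).1 hm))
  have hsτ := hτ.pair_le hs
  refine ⟨s, hs, hc, ξ.add_mem (ξ.add_mem hbξ (hτ.le ht)) (hτ.le hsτ), fun hm => hbτ ?_,
    fun hm => hta ?_⟩
  · rw [add_assoc] at hm
    exact (τ.add_mem_iff_left (τ.add_mem ht hsτ)).1 hm
  · rw [add_assoc] at hm
    obtain ⟨p, q, hpq⟩ := mem_pair.1 ((Submodule.add_mem_iff_right _ (left_mem_pair b v)).1 hm)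
    have hp : p = 0 := by
      by_contra hp
      apply hbτ
      have : p • b ∈ τ := by
        have h2 : p • b = t + s - q • v := by rw [hpq]; abel
        rw [h2]
        exact τ.sub_mem (τ.add_mem ht hsτ) (τ.smul_mem _ hτ.vertex)
      exact (τ.smul_mem_iff hp).1 this
    have h2 : t = q • v - s := by
      rw [hp, zero_smul, zero_add] at hpq; rw [← hpq]; abel
    rw [h2]
    exact Submodule.sub_mem _ (Submodule.smul_mem _ _ (right_mem_pair a v)) hs

/-- A tube has a third generator. -/
lemma IsVTube.exists_third [Module.Finite K V] (h : IsVTube X ξ v) (ha : a ∈ X) (haξ : a ∈ ξ)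
    (hb : b ∈ X) (hbξ : b ∈ ξ) (hba : b ∉ Submodule.span K {a, v}) :
    ∃ c ∈ X, c ∈ ξ ∧ c ∉ Submodule.span K {a, v} ∧ c ∉ Submodule.span K {b, v} := by
  obtain ⟨τ, hτ⟩ := h.tangent a ha haξ
  obtain ⟨t, ht, hta⟩ := hτ.exists_dir
  obtain ⟨s, hs, h1, h2, h3, h4⟩ := hτ.exists_lift hb hbξ hba ht hta
  exact ⟨_, h1, h2, fun hm => h3 (hτ.pair_le hm), h4⟩

/-- A tube lies in every subspace that contains three of its generators. -/
lemma IsVTube.le_of_three [Module.Finite K V] (h : IsVTube X ξ v) (hX : IsConeSet K X)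
    (ha : a ∈ X) (haξ : a ∈ ξ)
    (hb : b ∈ X) (hbξ : b ∈ ξ) (hba : b ∉ Submodule.span K {a, v}) {c : V} (hc : c ∈ X)
    (hcξ : c ∈ ξ) (hca : c ∉ Submodule.span K {a, v}) (hcb : c ∉ Submodule.span K {b, v})
    {W : Submodule K V} (hva : v ∈ W) (haW : a ∈ W) (hbW : b ∈ W) (hcW : c ∈ W) : ξ ≤ W := by
  have h1 : c ∉ Submodule.span K {a, v} ⊔ Submodule.span K {b} := by
    intro hm
    obtain ⟨p, hp⟩ := mem_sup_single.1 hm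
    obtain ⟨q, r, hq⟩ := mem_pair.1 hp
    rcases h.arc a ha haξ b hb hbξ c hc (mem_triple.2 ⟨q, p, r, by
      rw [sub_eq_iff_eq_add.1 hq]; abel⟩) with h2 | h2
    · exact hca h2
    · exact hcb h2
  have h2 : ξ = Submodule.span K {a, v} ⊔ Submodule.span K {b} ⊔ Submodule.span K {c} := by
    refine (Submodule.eq_of_le_of_finrank_eq (sup_le (sup_le (pair_le haξ h.mem)
      (single_le hbξ)) (single_le hcξ)) ?_).symm
    rw [Submodule.finrank_sup_span_singleton h1, Submodule.finrank_sup_span_singleton hba, h.rank,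
      finrank_pair (hX.ne_zero _ ha) (h.vertex_notMem_single hX ha)]
  rw [h2]
  exact sup_le (sup_le (pair_le haW hva) (single_le hbW)) (single_le hcW)

/-- If `X` contains the affine line `b + Ky` of `ξ`, then `y` lies on the generator of `b`. -/
lemma IsVTube.mem_pair_of_line (h : IsVTube X ξ v) (hX : IsConeSet K X)
    (hK : ∃ c : K, c ≠ 0 ∧ c ≠ 1) (hb : b ∈ X) (hbξ : b ∈ ξ) {y : V} (hy : y ∈ ξ)
    (hl : ∀ c : K, b + c • y ∈ X) : y ∈ Submodule.span K {b, v} := by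
  obtain ⟨c, hc0, hc1⟩ := hK
  have h1 := hl 1
  rw [one_smul] at h1
  rcases h.arc b hb hbξ _ h1 (ξ.add_mem hbξ hy) _ (hl c) (mem_triple.2 ⟨1 - c, c, 0, by
    match_scalars <;> noncomm_ring⟩) with h2 | h2
  · exact (Submodule.smul_mem_iff _ hc0).1
      ((Submodule.add_mem_iff_right _ (left_mem_pair b v)).1 h2)
  · have h3 : (c - 1) • y ∈ Submodule.span K {b + y, v} := by
      have h4 : (c - 1) • y = (b + c • y) - (b + y) := by match_scalars <;> noncomm_ring
      rw [h4]
      exact Submodule.sub_mem _ h2 (left_mem_pair _ _)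
    have h4 := (Submodule.smul_mem_iff _ (sub_ne_zero.2 hc1)).1 h3
    have h5 : b ∈ Submodule.span K {b + y, v} :=
      (Submodule.add_mem_iff_left _ h4).1 (left_mem_pair _ _)
    rw [h.pair_eq hX hb h5]
    exact h4

/-- The vertex of a tube is determined by the tube. -/
lemma IsVTube.vertex_unique [Module.Finite K V] (h : IsVTube X ξ v) (hX : IsConeSet K X)
    (hK : ∃ c : K, c ≠ 0 ∧ c ≠ 1) {y : V} (hy : IsVTube X ξ y) :
    y ∈ Submodule.span K {v} := by
  obtain ⟨a, ha, haξ⟩ := h.nonempty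
  obtain ⟨b, hb, hbξ, hab⟩ := h.exists_notMem ha haξ
  exact mem_single_of_mem_pairs hab
    (h.mem_pair_of_line hX hK hb hbξ hy.mem (hy.cone b hb hbξ))
    (h.mem_pair_of_line hX hK ha haξ hy.mem (hy.cone a ha haξ))


lemma pair_smul_right {c : K} (hc : c ≠ 0) (a v : V) :
    Submodule.span K {a, c • v} = Submodule.span K {a, v} := by
  refine le_antisymm (_root_.pair_le (left_mem_pair _ _)
    (Submodule.smul_mem _ _ (right_mem_pair _ _))) (_root_.pair_le (left_mem_pair _ _) ?_)
  exact (Submodule.smul_mem_iff _ hc).1 (right_mem_pair a (c • v))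

end Tubes

/-! ### Intersections of tubes and lines joining two points -/

section Systems

variable {K V : Type*} [DivisionRing K] [AddCommGroup V] [Module K V]

/-- Hjelmslevian Veronesean sets in terms of vectors: `X` and `Y` are the sets of vectors
representing the points of the set and the vertices of its tubes. -/
structure IsHVSystem (X Y : Set V) (Ξ : Set (Submodule K V)) : Prop where
  card : ∀ a : K, ∃ c : K, c ≠ 0 ∧ c ≠ a
  coneX : IsConeSet K X
  coneY : IsConeSet K Y
  span : Submodule.span K X = ⊤
  dim : 4 < finrank K V
  tube : ∀ ξ ∈ Ξ, ∃ v ∈ Y, IsVTube X ξ v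
  vertex : ∀ y ∈ Y, ∃ ξ ∈ Ξ, IsVTube X ξ y
  join : ∀ x ∈ X, ∀ y ∈ X, ∃ ξ ∈ Ξ, x ∈ ξ ∧ y ∈ ξ
  meet : ∀ ξ₁ ∈ Ξ, ∀ ξ₂ ∈ Ξ, ξ₁ ≠ ξ₂ → ∀ u ∈ ξ₁, u ∈ ξ₂ → u ≠ 0 → u ∈ X ∨ u ∈ Y
  meetY : ∀ ξ₁ ∈ Ξ, ∀ ξ₂ ∈ Ξ, ξ₁ ≠ ξ₂ → ξ₁ ⊓ ξ₂ ≠ ⊥ → ∃ H : Submodule K V,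
    finrank K H < finrank K (ξ₁ ⊓ ξ₂ : Submodule K V) ∧ ∀ y ∈ Y, y ∈ ξ₁ → y ∈ ξ₂ → y ∈ H
  tan : ∀ x ∈ X, ∃ T : Submodule K V, finrank K T = 5 ∧
    ∀ y ∈ X, y ∉ Submodule.span K {x} → ∀ ξ ∈ Ξ, x ∈ ξ → y ∈ ξ →
      (∀ ξ' ∈ Ξ, x ∈ ξ' → y ∈ ξ' → ξ' = ξ) →
      ∀ v τ, IsVTube X ξ v → IsTangentAt X ξ v x τ → τ ≤ T

namespace IsHVSystem

variable {X Y : Set V} {Ξ : Set (Submodule K V)}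

lemma card' (h : IsHVSystem X Y Ξ) : ∃ c : K, c ≠ 0 ∧ c ≠ 1 := h.card 1

lemma finite (h : IsHVSystem X Y Ξ) : Module.Finite K V :=
  Module.finite_of_finrank_pos (by have := h.dim; omega)

lemma vertex_mem (h : IsHVSystem X Y Ξ) {ξ : Submodule K V} (hξ : ξ ∈ Ξ) {v : V}
    (ht : IsVTube X ξ v) : v ∈ Y := by
  have := h.finite
  obtain ⟨w, hw, htw⟩ := h.tube ξ hξ
  obtain ⟨c, rfl⟩ := mem_single.1 (htw.vertex_unique h.coneX h.card' ht)
  exact h.coneY.smul_mem c (by rintro rfl; exact ht.ne_zero (by simp)) _ hw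

lemma disj (h : IsHVSystem X Y Ξ) {u : V} (hX : u ∈ X) (hY : u ∈ Y) : False := by
  obtain ⟨ξ, -, ht⟩ := h.vertex u hY
  exact ht.notMem hX

/-- Members of `Ξ` meeting outside `X` have the point of intersection as common vertex and share
a generator. -/
lemma meet_notMem (h : IsHVSystem X Y Ξ) {ξ₁ ξ₂ : Submodule K V} (h₁ : ξ₁ ∈ Ξ) (h₂ : ξ₂ ∈ Ξ)
    (hne : ξ₁ ≠ ξ₂) {v : V} (ht : IsVTube X ξ₁ v) {u : V} (hu₁ : u ∈ ξ₁) (hu₂ : u ∈ ξ₂)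
    (hu0 : u ≠ 0) (huX : u ∉ X) :
    u ∈ Submodule.span K {v} ∧ ∃ a ∈ X, a ∈ ξ₁ ∧ a ∈ ξ₂ := by
  have := h.finite
  have huY : u ∈ Y := (h.meet ξ₁ h₁ ξ₂ h₂ hne u hu₁ hu₂ hu0).resolve_left huX
  have hI : ξ₁ ⊓ ξ₂ ≠ ⊥ := fun h0 => hu0 (by
    have : u ∈ ξ₁ ⊓ ξ₂ := ⟨hu₁, hu₂⟩
    rwa [h0, Submodule.mem_bot] at this)
  obtain ⟨H, hH, hYH⟩ := h.meetY ξ₁ h₁ ξ₂ h₂ hne hI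
  have key : ∀ a ∈ ξ₁ ⊓ ξ₂, a ∉ H → a ∈ X := fun a ha haH =>
    (h.meet ξ₁ h₁ ξ₂ h₂ hne a ha.1 ha.2 (by rintro rfl; exact haH H.zero_mem)).resolve_right
      fun haY => haH (hYH a haY ha.1 ha.2)
  obtain ⟨a, ha, haH⟩ := exists_notMem_of_finrank_lt hH
  have huH := hYH u huY hu₁ hu₂
  have haX := key a ha haH
  have h3 : u ∈ Submodule.span K {a, v} := ht.mem_pair_of_line h.coneX h.card' haX ha.1 hu₁
    fun c => key _ (Submodule.add_mem _ ha (Submodule.smul_mem _ c ⟨hu₁, hu₂⟩))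
      fun hc => haH ((H.add_mem_iff_left (H.smul_mem c huH)).1 hc)
  refine ⟨?_, a, haX, ha.1, ha.2⟩
  have hua : u ∉ Submodule.span K {a} := by
    intro hm
    obtain ⟨c, rfl⟩ := mem_single.1 hm
    exact huX (h.coneX.smul_mem c (by rintro rfl; exact hu0 (by simp)) a haX)
  have hv : v ∈ Submodule.span K {u, a} := pair_exchange (by rwa [pair_comm]) hua
  have hvH := hYH v (h.vertex_mem h₁ ht) (ht.mem) (pair_le hu₂ ha.2 hv)
  by_contra huv
  exact haH (pair_le huH hvH (pair_exchange h3 huv))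

lemma mem_vertex (h : IsHVSystem X Y Ξ) {ξ : Submodule K V} (hξ : ξ ∈ Ξ) {v : V}
    (ht : IsVTube X ξ v) {y : V} (hy : y ∈ Y) (hyξ : y ∈ ξ) : y ∈ Submodule.span K {v} := by
  have := h.finite
  obtain ⟨ξ', hξ', ht'⟩ := h.vertex y hy
  by_cases he : ξ = ξ'
  · subst he; exact ht.vertex_unique h.coneX h.card' ht'
  · exact (h.meet_notMem hξ hξ' he ht hyξ ht'.mem ht'.ne_zero ht'.notMem).1

lemma tube_of_mem (h : IsHVSystem X Y Ξ) {ξ : Submodule K V} (hξ : ξ ∈ Ξ) {y : V} (hy : y ∈ Y)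
    (hyξ : y ∈ ξ) : IsVTube X ξ y := by
  obtain ⟨v, hv, ht⟩ := h.tube ξ hξ
  obtain ⟨c, rfl⟩ := mem_single.1 (h.mem_vertex hξ ht hy hyξ)
  have hc : c ≠ 0 := by rintro rfl; exact h.coneY.ne_zero _ hy (by simp)
  refine ⟨ht.rank, h.coneY.ne_zero _ hy, hyξ, fun hX => h.disj hX hy, ht.nonempty, ?_, ?_, ?_⟩
  · intro a ha haξ d
    rw [smul_smul]
    exact ht.cone a ha haξ _
  · intro a ha haξ b hb hbξ d hd hm
    rw [pair_smul_right hc, pair_smul_right hc]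
    refine ht.arc a ha haξ b hb hbξ d hd ?_
    obtain ⟨p, q, r, rfl⟩ := mem_triple.1 hm
    exact mem_triple.2 ⟨p, q, r * c, by rw [smul_smul]⟩
  · intro a ha haξ
    obtain ⟨τ, hτ⟩ := ht.tangent a ha haξ
    exact ⟨τ, hτ.le, hτ.rank, hτ.base, τ.smul_mem _ hτ.vertex,
      by rw [pair_smul_right hc]; exact hτ.only, by rw [pair_smul_right hc]; exact hτ.lift⟩

/-- Two points of `X` in two members of `Ξ` lie on a common generator. -/
lemma mem_pair_of_mem_two (h : IsHVSystem X Y Ξ) {ξ₁ ξ₂ : Submodule K V} (h₁ : ξ₁ ∈ Ξ)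
    (h₂ : ξ₂ ∈ Ξ) (hne : ξ₁ ≠ ξ₂) {v : V} (ht : IsVTube X ξ₁ v) {a b : V} (ha : a ∈ X)
    (ha₁ : a ∈ ξ₁) (ha₂ : a ∈ ξ₂) (hb₁ : b ∈ ξ₁) (hb₂ : b ∈ ξ₂) :
    b ∈ Submodule.span K {a, v} := by
  by_contra hba
  refine hba (ht.mem_pair_of_line h.coneX h.card' ha ha₁ hb₁ fun c => ?_)
  by_contra hX
  have h1 := ξ₁.add_mem ha₁ (ξ₁.smul_mem c hb₁)
  have h2 := ξ₂.add_mem ha₂ (ξ₂.smul_mem c hb₂)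
  have hc : c ≠ 0 := by rintro rfl; exact hX (by simpa using ha)
  have h0 : a + c • b ≠ 0 := by
    intro h0
    have : c • b = -a := by rw [← sub_eq_zero]; rw [← h0]; abel
    refine hba ((Submodule.smul_mem_iff _ hc).1 ?_)
    rw [this]
    exact Submodule.neg_mem _ (left_mem_pair a v)
  have h3 := (h.meet_notMem h₁ h₂ hne ht h1 h2 h0 hX).1
  exact hba ((Submodule.smul_mem_iff _ hc).1 ((Submodule.add_mem_iff_right _
    (left_mem_pair a v)).1 (single_le_right a v h3)))

lemma exists_common (h : IsHVSystem X Y Ξ) {ξ₁ ξ₂ : Submodule K V} (h₁ : ξ₁ ∈ Ξ)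
    (h₂ : ξ₂ ∈ Ξ) {v : V} (ht₁ : IsVTube X ξ₁ v) (hv : v ∈ ξ₂) :
    ∃ a ∈ X, a ∈ ξ₁ ∧ a ∈ ξ₂ := by
  by_cases he : ξ₁ = ξ₂
  · subst he
    obtain ⟨a, ha, hξ⟩ := ht₁.nonempty
    exact ⟨a, ha, hξ, hξ⟩
  · exact (h.meet_notMem h₁ h₂ he ht₁ ht₁.mem hv ht₁.ne_zero ht₁.notMem).2

/-- A line through two points of `X` and a point of `Y` consists of points of `X`, apart from
the latter. -/
lemma mem_of_singular (h : IsHVSystem X Y Ξ) {p q y u : V} (hp : p ∈ X) (hq : q ∈ X)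
    (hy : y ∈ Y) (hypq : y ∈ Submodule.span K {p, q}) (hu : u ∈ Submodule.span K {p, q})
    (huy : u ∉ Submodule.span K {y}) : u ∈ X := by
  obtain ⟨ξ, hξ, hpξ, hqξ⟩ := h.join p hp q hq
  have ht := h.tube_of_mem hξ hy (pair_le hpξ hqξ hypq)
  have hyp : y ∉ Submodule.span K {p} := ht.vertex_notMem_single h.coneX hp
  have he : Submodule.span K {y, p} = Submodule.span K {p, q} := by
    rw [pair_comm p q] at hypq ⊢
    exact pair_eq_of_mem hypq hyp
  rw [← he, pair_comm] at hu
  exact ht.mem_of_mem_pair h.coneX hp hpξ hu huy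

/-- A line with three points of `X` has a point in `Y`. -/
lemma singular_of_three (h : IsHVSystem X Y Ξ) {p q u : V} (hp : p ∈ X) (hq : q ∈ X)
    (hu : u ∈ X) (hupq : u ∈ Submodule.span K {p, q}) (hup : u ∉ Submodule.span K {p})
    (huq : u ∉ Submodule.span K {q}) : ∃ y ∈ Y, y ∈ Submodule.span K {p, q} := by
  obtain ⟨ξ, hξ, hpξ, hqξ⟩ := h.join p hp q hq
  obtain ⟨v, hv, ht⟩ := h.tube ξ hξ
  refine ⟨v, hv, ?_⟩
  obtain ⟨a, b, rfl⟩ := mem_pair.1 hupq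
  rcases ht.arc p hp hpξ q hq hqξ _ hu (mem_triple.2 ⟨a, b, 0, by simp⟩) with h1 | h1
  · have h2 : v ∈ Submodule.span K {a • p + b • q, p} := pair_exchange (by rwa [pair_comm]) hup
    exact pair_le hupq (left_mem_pair _ _) h2
  · have h2 : v ∈ Submodule.span K {a • p + b • q, q} := pair_exchange (by rwa [pair_comm]) huq
    exact pair_le hupq (right_mem_pair _ _) h2

lemma mem_of_line (h : IsHVSystem X Y Ξ) {x y : V} (hx : x ∈ X) (hy : y ∈ Y) (hxy : x + y ∈ X)
    {a : K} (ha : a ≠ 0) (b : K) : a • x + b • y ∈ X := by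
  have hyx : x ∉ Submodule.span K {y} := by
    intro hm
    obtain ⟨c, rfl⟩ := mem_single.1 hm
    exact h.disj hx (h.coneY.smul_mem c (by rintro rfl; exact h.coneX.ne_zero _ hx (by simp)) y hy)
  have hle : Submodule.span K {x, y} ≤ Submodule.span K {x, x + y} :=
    pair_le (left_mem_pair _ _)
      ((Submodule.add_mem_iff_right _ (left_mem_pair _ _)).1 (right_mem_pair _ _))
  refine h.mem_of_singular hx hxy hy (hle (right_mem_pair _ _))
    (hle (mem_pair.2 ⟨a, b, rfl⟩)) fun hm => hyx ?_
  exact (Submodule.smul_mem_iff _ ha).1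
    ((Submodule.add_mem_iff_left _ (smul_mem_single y b)).1 hm)

end IsHVSystem

end Systems

/-! ### Singular planes -/

section SingularPlanes

variable {K V : Type*} [DivisionRing K] [AddCommGroup V] [Module K V]

namespace IsHVSystem

variable {X Y : Set V} {Ξ : Set (Submodule K V)}

lemma indep (h : IsHVSystem X Y Ξ) {x y₁ y₂ : V} (hx : x ∈ X) (h₁ : y₁ ∈ Y) (h₂ : y₂ ∈ Y)
    (hx₁ : x + y₁ ∈ X) (hind : y₂ ∉ Submodule.span K {y₁}) {a b c : K}
    (h0 : a • x + b • y₁ + c • y₂ = 0) : a = 0 ∧ b = 0 ∧ c = 0 := by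
  have ha : a = 0 := by
    by_contra ha
    have h3 := h.mem_of_line hx h₁ hx₁ ha b
    have h4 : a • x + b • y₁ = (-c) • y₂ := by
      rw [← sub_eq_zero, ← h0]; match_scalars <;> noncomm_ring
    rw [h4] at h3
    exact h.disj h3 (h.coneY.smul_mem _ (by
      intro hc; rw [hc, zero_smul] at h3; exact h.coneX.ne_zero _ h3 rfl) _ h₂)
  subst ha
  have hc : c = 0 := by
    by_contra hc
    refine hind ((Submodule.smul_mem_iff _ hc).1 (mem_single.2 ⟨-b, ?_⟩))
    rw [← sub_eq_zero, ← h0]; match_scalars <;> noncomm_ring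
  subst hc
  refine ⟨rfl, ?_, rfl⟩
  by_contra hb
  simp [hb, h.coneY.ne_zero _ h₁] at h0

/-- Of two lines joining points of two singular lines `x + Ky₁`, `x + Ky₂`, with different feet
on both, at least one is singular. -/
lemma singular_or_singular (h : IsHVSystem X Y Ξ) {x y₁ y₂ : V} (hx : x ∈ X) (h₁ : y₁ ∈ Y)
    (h₂ : y₂ ∈ Y) (hx₁ : x + y₁ ∈ X) (hx₂ : x + y₂ ∈ X) (hind : y₂ ∉ Submodule.span K {y₁})
    {l l' m m' : K} (hl' : l' ≠ 0) (hm' : m' ≠ 0) (hll : l ≠ l') (hmm : m ≠ m')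
    (hl : l ≠ 0) (hm : m ≠ 0)
    (hn : ¬ ∃ y ∈ Y, y ∈ Submodule.span K {x + l • y₁, x + m • y₂}) :
    ∃ y ∈ Y, y ∈ Submodule.span K {x + l' • y₁, x + m' • y₂} := by
  by_contra hn'
  have line₁ : ∀ c : K, x + c • y₁ ∈ X := fun c => by
    simpa using h.mem_of_line hx h₁ hx₁ one_ne_zero c
  have line₂ : ∀ c : K, x + c • y₂ ∈ X := fun c => by
    simpa using h.mem_of_line hx h₂ hx₂ one_ne_zero c
  have hL : 1 - l * l'⁻¹ ≠ 0 := by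
    intro h0; rw [sub_eq_zero, eq_mul_inv_iff_mul_eq₀ hl', one_mul] at h0; exact hll h0.symm
  have hM : 1 - m * m'⁻¹ ≠ 0 := by
    intro h0; rw [sub_eq_zero, eq_mul_inv_iff_mul_eq₀ hm', one_mul] at h0; exact hmm h0.symm
  obtain ⟨a, ha⟩ : ∃ a, a = (1 - l * l'⁻¹)⁻¹ := ⟨_, rfl⟩
  obtain ⟨b, hb⟩ : ∃ b, b = -(1 - m * m'⁻¹)⁻¹ := ⟨_, rfl⟩
  have ha0 : a ≠ 0 := by rw [ha]; exact inv_ne_zero hL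
  have hb0 : b ≠ 0 := by rw [hb]; exact neg_ne_zero.2 (inv_ne_zero hM)
  have ha1 : a - a * (l * l'⁻¹) = 1 := by
    have := inv_mul_cancel₀ hL
    rwa [← ha, mul_sub, mul_one] at this
  have hb1 : b - b * (m * m'⁻¹) = -1 := by
    have := inv_mul_cancel₀ hM
    rw [mul_sub, mul_one] at this
    rw [hb, neg_mul, ← neg_sub', this]
  obtain ⟨z, hz⟩ : ∃ z, z = a • (x + l • y₁) + b • (x + m • y₂) := ⟨_, rfl⟩
  -- the point `z` common to the two lines
  have hz' : z = (a * (l * l'⁻¹)) • (x + l' • y₁) + (b * (m * m'⁻¹)) • (x + m' • y₂) := by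
    have e1 : a + b = a * (l * l'⁻¹) + b * (m * m'⁻¹) := by
      have e3 : a = 1 + a * (l * l'⁻¹) := by rw [← ha1]; noncomm_ring
      have e4 : b = -1 + b * (m * m'⁻¹) := by rw [← hb1]; noncomm_ring
      calc a + b = (1 + a * (l * l'⁻¹)) + (-1 + b * (m * m'⁻¹)) := by rw [← e3, ← e4]
        _ = _ := by abel
    have e5 : a * (l * l'⁻¹) * l' = a * l := by
      rw [mul_assoc, mul_assoc, inv_mul_cancel₀ hl', mul_one]
    have e6 : b * (m * m'⁻¹) * m' = b * m := by
      rw [mul_assoc, mul_assoc, inv_mul_cancel₀ hm', mul_one]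
    rw [hz]
    calc a • (x + l • y₁) + b • (x + m • y₂) = (a + b) • x + (a * l) • y₁ + (b * m) • y₂ := by
          match_scalars <;> noncomm_ring
      _ = _ := by rw [e1, ← e5, ← e6]; match_scalars <;> noncomm_ring
  have hz1 : z ∈ Submodule.span K {x + l • y₁, x + m • y₂} := mem_pair.2 ⟨_, _, hz⟩
  have hz2 : z ∈ Submodule.span K {x + l' • y₁, x + m' • y₂} := mem_pair.2 ⟨_, _, hz'⟩
  have hi := fun {a b c : K} => h.indep (a := a) (b := b) (c := c) hx h₁ h₂ hx₁ hind
  have hzp : z ∉ Submodule.span K {x + l • y₁} := fun hc => by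
    obtain ⟨t, ht⟩ := mem_single.1 hc
    have := (hi (a := a + b - t) (b := a * l - t * l) (c := b * m) (by
      rw [← sub_eq_zero] at ht; rw [← ht, hz]; match_scalars <;> noncomm_ring)).2.2
    exact mul_ne_zero hb0 hm this
  have hzq : z ∉ Submodule.span K {x + m • y₂} := fun hc => by
    obtain ⟨t, ht⟩ := mem_single.1 hc
    have := (hi (a := a + b - t) (b := a * l) (c := b * m - t * m) (by
      rw [← sub_eq_zero] at ht; rw [← ht, hz]; match_scalars <;> noncomm_ring)).2.1
    exact mul_ne_zero ha0 hl this
  have hz0 : z ≠ 0 := by rintro h0; rw [h0] at hzp; exact hzp (Submodule.zero_mem _)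
  obtain ⟨ξ, hξ, hp, hq⟩ := h.join _ (line₁ l) _ (line₂ m)
  obtain ⟨ξ', hξ', hp', hq'⟩ := h.join _ (line₁ l') _ (line₂ m')
  have hne : ξ ≠ ξ' := by
    rintro rfl
    obtain ⟨v, hv, ht⟩ := h.tube ξ hξ
    have k₁ : y₁ ∈ ξ := by
      have := ξ.sub_mem hp hp'
      rw [add_sub_add_left_eq_sub, ← sub_smul] at this
      exact (ξ.smul_mem_iff (sub_ne_zero.2 hll)).1 this
    have k₂ : y₂ ∈ ξ := by
      have := ξ.sub_mem hq hq'
      rw [add_sub_add_left_eq_sub, ← sub_smul] at this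
      exact (ξ.smul_mem_iff (sub_ne_zero.2 hmm)).1 this
    have e₁ := h.mem_vertex hξ ht h₁ k₁
    exact hind (single_le (single_comm (h.coneY.ne_zero _ h₁) e₁) (h.mem_vertex hξ ht h₂ k₂))
  rcases h.meet ξ hξ ξ' hξ' hne z (pair_le hp hq hz1) (pair_le hp' hq' hz2) hz0 with hzX | hzY
  · exact hn (h.singular_of_three (line₁ l) (line₂ m) hzX hz1 hzp hzq)
  · exact hn ⟨z, hzY, hz1⟩

/-- The span of two singular lines is a singular plane, if some point of the first line is
joined to all points of the second one by singular lines. -/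
lemma plane_of_good (h : IsHVSystem X Y Ξ) {x y₁ y₂ : V} (hx : x ∈ X) (h₁ : y₁ ∈ Y)
    (h₂ : y₂ ∈ Y) (hx₁ : x + y₁ ∈ X) (hx₂ : x + y₂ ∈ X) (hind : y₂ ∉ Submodule.span K {y₁})
    (hgood : ∀ m : K, m ≠ 0 → ∃ y ∈ Y, y ∈ Submodule.span K {x + y₁, x + m • y₂})
    (b c : K) : x + b • y₁ + c • y₂ ∈ X := by
  have line₁ : ∀ c : K, x + c • y₁ ∈ X := fun c => by
    simpa using h.mem_of_line hx h₁ hx₁ one_ne_zero c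
  have line₂ : ∀ c : K, x + c • y₂ ∈ X := fun c => by
    simpa using h.mem_of_line hx h₂ hx₂ one_ne_zero c
  have hi := fun {a b c : K} => h.indep (a := a) (b := b) (c := c) hx h₁ h₂ hx₁ hind
  -- off the line `⟨x + y₁, y₂⟩` every point of the plane lies in `X ∪ Y`
  have hU : ∀ a b c : K, a ≠ b → a • x + b • y₁ + c • y₂ ∈ X ∨ a • x + b • y₁ + c • y₂ ∈ Y := by
    intro a b c hab
    have hab' : a - b ≠ 0 := sub_ne_zero.2 hab
    obtain ⟨m, hm⟩ : ∃ m, m = (a - b)⁻¹ * c := ⟨_, rfl⟩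
    have hc : c = (a - b) * m := by rw [hm, mul_inv_cancel_left₀ hab']
    have hu : a • x + b • y₁ + c • y₂ ∈ Submodule.span K {x + y₁, x + m • y₂} :=
      mem_pair.2 ⟨b, a - b, by rw [hc]; match_scalars <;> noncomm_ring⟩
    obtain ⟨y, hy, hym⟩ : ∃ y ∈ Y, y ∈ Submodule.span K {x + y₁, x + m • y₂} := by
      by_cases hm0 : m = 0
      · refine ⟨y₁, h₁, mem_pair.2 ⟨1, -1, ?_⟩⟩
        rw [hm0]; match_scalars <;> noncomm_ring
      · exact hgood m hm0
    by_cases huy : a • x + b • y₁ + c • y₂ ∈ Submodule.span K {y}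
    · right
      obtain ⟨t, ht⟩ := mem_single.1 huy
      rw [ht]
      refine h.coneY.smul_mem t ?_ y hy
      rintro rfl
      rw [zero_smul] at ht
      have := hi ht
      exact hab (this.1.trans this.2.1.symm)
    · exact Or.inl (h.mem_of_singular hx₁ (line₂ m) hy hym hu huy)
  -- hence any two points of `X` in the plane are on a singular line
  have hS : ∀ a b c a' b' c' : K, a • x + b • y₁ + c • y₂ ∈ X → a' • x + b' • y₁ + c' • y₂ ∈ X →
      a' • x + b' • y₁ + c' • y₂ ∉ Submodule.span K {a • x + b • y₁ + c • y₂} →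
      ∃ y ∈ Y, y ∈ Submodule.span K
        {a • x + b • y₁ + c • y₂, a' • x + b' • y₁ + c' • y₂} := by
    intro a b c a' b' c' hp hq hpq
    by_contra hno
    have key : ∀ t : K, t ≠ 0 → (a - b) + t * (a' - b') = 0 := by
      intro t ht
      by_contra hne
      have hne' : a + t * a' ≠ b + t * b' := by
        intro he
        apply hne
        have : (a - b) + t * (a' - b') = (a + t * a') - (b + t * b') := by noncomm_ring
        rw [this, he, sub_self]
      have e : (a + t * a') • x + (b + t * b') • y₁ + (c + t * c') • y₂ =
          (a • x + b • y₁ + c • y₂) + t • (a' • x + b' • y₁ + c' • y₂) := by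
        match_scalars <;> noncomm_ring
      have hm : (a • x + b • y₁ + c • y₂) + t • (a' • x + b' • y₁ + c' • y₂) ∈
          Submodule.span K {a • x + b • y₁ + c • y₂, a' • x + b' • y₁ + c' • y₂} :=
        mem_pair.2 ⟨1, t, by rw [one_smul]⟩
      rcases hU _ _ (c + t * c') hne' with h3 | h3
      · rw [e] at h3
        refine hno (h.singular_of_three hp hq h3 hm (fun hc => hpq ?_) fun hc => hpq ?_)
        · exact (Submodule.smul_mem_iff _ ht).1 ((Submodule.add_mem_iff_right _
            (Submodule.mem_span_singleton_self _)).1 hc)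
        · exact single_comm (h.coneX.ne_zero _ hp)
            ((Submodule.add_mem_iff_left _ (smul_mem_single _ _)).1 hc)
      · rw [e] at h3
        exact hno ⟨_, h3, hm⟩
    obtain ⟨t, ht0, ht1⟩ := h.card'
    have k1 := key 1 one_ne_zero
    have k2 := key t ht0
    have k3 : (t - 1) * (a' - b') = 0 := by
      rw [← sub_eq_zero.2 (k2.trans k1.symm)]; noncomm_ring
    have k4 : a' - b' = 0 := (mul_eq_zero.1 k3).resolve_left (sub_ne_zero.2 ht1)
    have k5 : a - b = 0 := by rw [k4, one_mul, add_zero] at k1; exact k1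
    obtain rfl := sub_eq_zero.1 k4
    obtain rfl := sub_eq_zero.1 k5
    have e : ∀ a c : K, a • x + a • y₁ + c • y₂ ∈ Submodule.span K {x + y₁, y₂} := fun a c =>
      mem_pair.2 ⟨a, c, by rw [smul_add]⟩
    have f := (pair_le (e a c) (e a' c'))
    have hp2 : a • x + a • y₁ + c • y₂ ∉ Submodule.span K {y₂} := by
      intro hm
      obtain ⟨s, hs⟩ := mem_single.1 hm
      rw [hs] at hp
      exact h.disj hp (h.coneY.smul_mem s (by
        rintro rfl; exact h.coneX.ne_zero _ hp (by simp)) _ h₂)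
    have f2 : Submodule.span K {x + y₁, y₂} =
        Submodule.span K {a • x + a • y₁ + c • y₂, a' • x + a' • y₁ + c' • y₂} := by
      rw [← pair_eq_of_mem (e a c) hp2, pair_comm, pair_comm (a • x + a • y₁ + c • y₂)]
      refine (pair_eq_of_mem ?_ hpq).symm
      rw [pair_comm, pair_eq_of_mem (e a c) hp2]
      exact e a' c'
    exact hno ⟨y₂, h₂, f2 ▸ right_mem_pair _ _⟩
  obtain ⟨k, hk0, hk1⟩ := h.card'
  -- a point of `X` off the two given lines
  obtain ⟨b₀, s₀, hb₀, hs₀, h₀⟩ : ∃ b s : K, b ≠ 0 ∧ s ≠ 0 ∧ x + b • y₂ + s • y₁ ∈ X := by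
    obtain ⟨m, hm, hmX⟩ : ∃ m : K, m ≠ 0 ∧ y₁ - m • y₂ ∉ X := by
      by_contra! hc
      have c1 := hc 1 one_ne_zero
      have c2 := hc k hk0
      rw [one_smul] at c1
      have e1 : (k - 1) • y₁ = k • (y₁ - y₂) + (-1 : K) • (y₁ - k • y₂) := by
        match_scalars <;> noncomm_ring
      have e2 : (k - 1) • y₂ = (1 : K) • (y₁ - y₂) + (-1 : K) • (y₁ - k • y₂) := by
        match_scalars <;> noncomm_ring
      have hk := sub_ne_zero.2 hk1
      exact h.disj (h.mem_of_singular c1 c2 h₁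
        ((Submodule.smul_mem_iff _ hk).1 (mem_pair.2 ⟨_, _, e1⟩))
        ((Submodule.smul_mem_iff _ hk).1 (mem_pair.2 ⟨_, _, e2⟩)) hind) h₂
    refine ⟨k * m, 1 - k, mul_ne_zero hk0 hm, sub_ne_zero.2 hk1.symm, ?_⟩
    obtain ⟨y, hy, hym⟩ := hgood m hm
    have e : x + (k * m) • y₂ + (1 - k) • y₁ = (1 - k) • (x + y₁) + k • (x + m • y₂) := by
      match_scalars <;> noncomm_ring
    refine h.mem_of_singular hx₁ (line₂ m) hy hym (mem_pair.2 ⟨_, _, e⟩) fun hc => ?_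
    refine hmX (h.mem_of_singular hx₁ (line₂ m) hy hym
      (mem_pair.2 ⟨1, -1, by match_scalars <;> noncomm_ring⟩) fun hc' => ?_)
    obtain ⟨p, hp⟩ := mem_single.1 hc
    obtain ⟨q, hq⟩ := mem_single.1 hc'
    have hq0 : q ≠ 0 := by
      rintro rfl
      rw [zero_smul] at hq
      have := (hi (a := 0) (b := 1) (c := -m) (by
        rw [← hq]; match_scalars <;> noncomm_ring)).2.1
      exact one_ne_zero this
    have hyq : y = q⁻¹ • (y₁ - m • y₂) := by rw [hq, inv_smul_smul₀ hq0]
    rw [hyq] at hp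
    have := (hi (a := 1) (b := 1 - k - p * q⁻¹) (c := k * m + p * q⁻¹ * m) (by
      rw [← sub_eq_zero] at hp; rw [← hp]; match_scalars <;> noncomm_ring)).1
    exact one_ne_zero this
  have hP : ∀ t : K, x + b₀ • y₂ + t • y₁ ∈ X := by
    intro t
    have := h.mem_of_line (y := s₀ • y₁) (line₂ b₀) (h.coneY.smul_mem s₀ hs₀ _ h₁) h₀
      one_ne_zero (t * s₀⁻¹)
    rwa [one_smul, smul_smul, mul_assoc, inv_mul_cancel₀ hs₀, mul_one] at this
  suffices hQ : ∀ b t : K, x + (b * b₀) • y₂ + t • y₁ ∈ X by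
    have := hQ (c * b₀⁻¹) b
    rw [mul_assoc, inv_mul_cancel₀ hb₀, mul_one] at this
    rwa [add_right_comm]
  intro b t
  by_contra hno
  have ht : t ≠ 0 := by rintro rfl; exact hno (by simpa using line₂ (b * b₀))
  have hb : b ≠ 0 := by rintro rfl; exact hno (by simpa using line₁ t)
  have hn : x + (b * b₀) • y₂ + y₁ ∉ X := by
    intro hn
    have := h.mem_of_line (line₂ (b * b₀)) h₁ hn one_ne_zero t
    rw [one_smul] at this
    exact hno this
  -- every further point of the line joining `x + b b₀ y₂` and `x + y₁` lies on a singular line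
  -- through the point `x + b b₀ y₂ + y₁`, which is not in `X`
  have hg : ∀ a : K, a ≠ 0 → a • (x + (b * b₀) • y₂) + (x + y₁) ∈ X := by
    intro a ha
    have d : x + b₀ • y₂ + ((1 - a) + b⁻¹ * a) • y₁ ∈ X := hP _
    have ea : (1 : K) • x + (1 - a) • y₁ + (0 : K) • y₂ = x + (1 - a) • y₁ := by simp
    have ed : (1 : K) • x + ((1 - a) + b⁻¹ * a) • y₁ + b₀ • y₂ =
        x + b₀ • y₂ + ((1 - a) + b⁻¹ * a) • y₁ := by match_scalars <;> noncomm_ring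
    obtain ⟨y, hy, hym⟩ := hS 1 (1 - a) 0 1 ((1 - a) + b⁻¹ * a) b₀ (by rw [ea]; exact line₁ _)
      (by rw [ed]; exact d) (by
        intro hc
        obtain ⟨s, hs⟩ := mem_single.1 hc
        have := (hi (a := 1 - s) (b := (1 - a) + b⁻¹ * a - s * (1 - a)) (c := b₀) (by
          rw [← sub_eq_zero] at hs; rw [← hs]; match_scalars <;> noncomm_ring)).2.2
        exact hb₀ this)
    rw [ea, ed] at hym
    have en : x + (b * b₀) • y₂ + y₁ = (1 - b) • (x + (1 - a) • y₁) +
        b • (x + b₀ • y₂ + ((1 - a) + b⁻¹ * a) • y₁) := by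
      match_scalars
      · noncomm_ring
      · noncomm_ring
      · simp only [mul_one, mul_add, mul_inv_cancel_left₀ hb]; noncomm_ring
    have hnm : x + (b * b₀) • y₂ + y₁ ∈ Submodule.span K {x + (1 - a) • y₁,
        x + b₀ • y₂ + ((1 - a) + b⁻¹ * a) • y₁} := mem_pair.2 ⟨_, _, en⟩
    have eg : a • (x + (b * b₀) • y₂) + (x + y₁) =
        a • (x + (b * b₀) • y₂ + y₁) + (x + (1 - a) • y₁) := by match_scalars <;> noncomm_ring
    have hny : x + (b * b₀) • y₂ + y₁ ∈ Submodule.span K {y} := by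
      by_contra hc
      exact hn (h.mem_of_singular (line₁ _) d hy hym hnm hc)
    have hn0 : x + (b * b₀) • y₂ + y₁ ≠ 0 := by
      intro h0
      have := (hi (a := 1) (b := 1) (c := b * b₀) (by
        rw [← h0]; match_scalars <;> noncomm_ring)).1
      exact one_ne_zero this
    rw [eg]
    refine h.mem_of_singular (line₁ _) d hy hym
      (Submodule.add_mem _ (Submodule.smul_mem _ a hnm) (left_mem_pair _ _)) fun hc => ?_
    have hc2 := (Submodule.add_mem_iff_right _ (Submodule.smul_mem _ a hny)).1 hc
    obtain ⟨s, hs⟩ := mem_single.1 (single_le (single_comm hn0 hny) hc2)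
    have e1 := hi (a := 1 - s) (b := 1 - a - s) (c := - (s * (b * b₀))) (by
      rw [← sub_eq_zero] at hs; rw [← hs]; match_scalars <;> noncomm_ring)
    have e2 : s = 1 := (sub_eq_zero.1 e1.1).symm
    have e3 := e1.2.2
    rw [e2, one_mul, neg_eq_zero] at e3
    exact mul_ne_zero hb hb₀ e3
  have ec : (1 : K) • x + (0 : K) • y₁ + (b * b₀) • y₂ = x + (b * b₀) • y₂ := by simp
  have ee : (1 : K) • x + (1 : K) • y₁ + (0 : K) • y₂ = x + y₁ := by simp
  obtain ⟨y, hy, hym⟩ := hS 1 0 (b * b₀) 1 1 0 (by rw [ec]; exact line₂ _)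
    (by rw [ee]; exact hx₁) (by
      intro hc
      obtain ⟨s, hs⟩ := mem_single.1 hc
      have := (hi (a := 1 - s) (b := 1) (c := -(s * (b * b₀))) (by
        rw [← sub_eq_zero] at hs; rw [← hs]; match_scalars <;> noncomm_ring)).2.1
      exact one_ne_zero this)
  rw [ec, ee] at hym
  obtain ⟨p, q, rfl⟩ := mem_pair.1 hym
  have hq : q ≠ 0 := by
    rintro rfl
    rw [zero_smul, add_zero] at hy
    exact h.disj (h.coneX.smul_mem p (by
      rintro rfl; exact h.coneY.ne_zero _ hy (by simp)) _ (line₂ (b * b₀))) hy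
  have hp : p ≠ 0 := by
    rintro rfl
    rw [zero_smul, zero_add] at hy
    exact h.disj (h.coneX.smul_mem q hq _ hx₁) hy
  have := h.coneX.smul_mem q hq _ (hg (q⁻¹ * p) (mul_ne_zero (inv_ne_zero hq) hp))
  rw [smul_add, smul_smul, mul_inv_cancel_left₀ hq] at this
  exact h.disj this hy

/-- Two singular lines through a point of `X` span a singular plane. -/
lemma plane (h : IsHVSystem X Y Ξ) {x y₁ y₂ : V} (hx : x ∈ X) (h₁ : y₁ ∈ Y)
    (h₂ : y₂ ∈ Y) (hx₁ : x + y₁ ∈ X) (hx₂ : x + y₂ ∈ X) (hind : y₂ ∉ Submodule.span K {y₁})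
    (b c : K) : x + b • y₁ + c • y₂ ∈ X := by
  have hind' : y₁ ∉ Submodule.span K {y₂} := fun hc =>
    hind (single_comm (h.coneY.ne_zero _ h₁) hc)
  have line₁ : ∀ c : K, x + c • y₁ ∈ X := fun c => by
    simpa using h.mem_of_line hx h₁ hx₁ one_ne_zero c
  have line₂ : ∀ c : K, x + c • y₂ ∈ X := fun c => by
    simpa using h.mem_of_line hx h₂ hx₂ one_ne_zero c
  by_cases hA : ∃ l : K, l ≠ 0 ∧ ∀ m : K, m ≠ 0 →
      ∃ y ∈ Y, y ∈ Submodule.span K {x + l • y₁, x + m • y₂}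
  · obtain ⟨l, hl, hg⟩ := hA
    have := h.plane_of_good hx (h.coneY.smul_mem l hl _ h₁) h₂ (line₁ l) hx₂
      (by rw [← mul_one l, ← smul_smul]; intro hc
          exact hind (single_le (by rw [one_smul]; exact smul_mem_single y₁ l) hc)) hg (b * l⁻¹) c
    rwa [smul_smul, mul_assoc, inv_mul_cancel₀ hl, mul_one] at this
  by_cases hB : ∃ m : K, m ≠ 0 ∧ ∀ l : K, l ≠ 0 →
      ∃ y ∈ Y, y ∈ Submodule.span K {x + l • y₁, x + m • y₂}
  · obtain ⟨m, hm, hg⟩ := hB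
    have := h.plane_of_good hx (h.coneY.smul_mem m hm _ h₂) h₁ (line₂ m) hx₁
      (fun hc => hind' (single_le (smul_mem_single y₂ m) hc))
      (fun l hl => by rw [pair_comm]; exact hg l hl) (c * m⁻¹) b
    rw [smul_smul, mul_assoc, inv_mul_cancel₀ hm, mul_one] at this
    rwa [add_right_comm]
  -- otherwise every row and every column contains a secant, against `singular_or_singular`
  exfalso
  push Not at hA hB
  obtain ⟨k, hk0, hk1⟩ := h.card'
  have key : ∀ l m l' m' : K, l ≠ 0 → m ≠ 0 → l' ≠ 0 → m' ≠ 0 →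
      (∀ y ∈ Y, y ∉ Submodule.span K {x + l • y₁, x + m • y₂}) →
      (∀ y ∈ Y, y ∉ Submodule.span K {x + l' • y₁, x + m' • y₂}) → l = l' ∨ m = m' := by
    intro l m l' m' hl hm hl' hm' hn hn'
    by_contra! hc
    obtain ⟨y, hy, hym⟩ := h.singular_or_singular hx h₁ h₂ hx₁ hx₂ hind hl' hm' hc.1 hc.2 hl hm
      (by push Not; exact hn)
    exact hn' y hy hym
  obtain ⟨m₁, hm₁, n₁⟩ := hA 1 one_ne_zero
  obtain ⟨m₂, hm₂, n₂⟩ := hA k hk0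
  obtain rfl := (key _ _ _ _ one_ne_zero hm₁ hk0 hm₂ n₁ n₂).resolve_left hk1.symm
  obtain ⟨m, hm0, hm⟩ := h.card m₁
  obtain ⟨l, hl, n₃⟩ := hB m hm0
  have e1 := (key _ _ _ _ hl hm0 one_ne_zero hm₁ n₃ n₁).resolve_right hm
  have e2 := (key _ _ _ _ hl hm0 hk0 hm₁ n₃ n₂).resolve_right hm
  exact hk1 (e2.symm.trans e1)

/-- The point at infinity of an affine line of points of `X` belongs to `Y`. -/
lemma mem_of_affine_line (h : IsHVSystem X Y Ξ) {x w : V} (hw : w ≠ 0)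
    (hl : ∀ c : K, x + c • w ∈ X) : w ∈ Y := by
  obtain ⟨k, hk0, hk1⟩ := h.card'
  have hx : x ∈ X := by simpa using hl 0
  have hxw : x + w ∈ X := by simpa using hl 1
  have hwx : w ∉ Submodule.span K {x} := by
    intro hc
    obtain ⟨c, rfl⟩ := mem_single.1 hc
    have hc0 : c ≠ 0 := by rintro rfl; exact hw (by simp)
    have := h.coneX.ne_zero _ (hl (-c⁻¹))
    rw [smul_smul, neg_mul, inv_mul_cancel₀ hc0] at this
    exact this (by simp)
  obtain ⟨y, hy, hym⟩ := h.singular_of_three hx hxw (hl k)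
    (mem_pair.2 ⟨1 - k, k, by match_scalars <;> noncomm_ring⟩)
    (fun hc => hwx ((Submodule.smul_mem_iff _ hk0).1 ((Submodule.add_mem_iff_right _
      (Submodule.mem_span_singleton_self _)).1 hc)))
    (fun hc => by
      have h1 : (k - 1) • w ∈ Submodule.span K {x + w} := by
        have : (k - 1) • w = (x + k • w) - (x + w) := by match_scalars <;> noncomm_ring
        rw [this]; exact Submodule.sub_mem _ hc (Submodule.mem_span_singleton_self _)
      have h2 := (Submodule.smul_mem_iff _ (sub_ne_zero.2 hk1)).1 h1
      have h3 := (Submodule.add_mem_iff_left _ h2).1 (Submodule.mem_span_singleton_self (x + w))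
      exact hwx (single_le (single_comm (h.coneX.ne_zero _ hx) h3) h2))
  obtain ⟨a, b, rfl⟩ := mem_pair.1 hym
  have e : a • x + b • (x + w) = (a + b) • x + b • w := by match_scalars <;> noncomm_ring
  rw [e] at hy
  by_cases hab : a + b = 0
  · rw [hab, zero_smul, zero_add] at hy
    have hb : b ≠ 0 := by rintro rfl; exact h.coneY.ne_zero _ hy (by simp)
    have := h.coneY.smul_mem b⁻¹ (inv_ne_zero hb) _ hy
    rwa [inv_smul_smul₀ hb] at this
  · exfalso
    refine h.disj ?_ hy
    have := h.coneX.smul_mem _ hab _ (hl ((a + b)⁻¹ * b))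
    rwa [smul_add, smul_smul, mul_inv_cancel_left₀ hab] at this

/-- The radical of `x`: the subspace of the vertices of the singular lines through `x`. -/
def rad (X Y : Set V) (x : V) : Submodule K V :=
  Submodule.span K {y | y ∈ Y ∧ x + y ∈ X}

/-- The singular subspace of `x`: the union of the singular lines through `x`. -/
def sing (X Y : Set V) (x : V) : Submodule K V :=
  Submodule.span K {x} ⊔ rad X Y x

lemma mem_rad (h : IsHVSystem X Y Ξ) {x y : V} (hx : x ∈ X) :
    y ∈ rad (K := K) X Y x ↔ y = 0 ∨ (y ∈ Y ∧ x + y ∈ X) := by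
  constructor
  · intro hy
    refine Submodule.span_induction (fun y hy => Or.inr hy) (Or.inl rfl) ?_ ?_ hy
    · rintro a b - - (rfl | ⟨ha, hxa⟩) (rfl | ⟨hb, hxb⟩)
      · simp
      · simpa using Or.inr ⟨hb, hxb⟩
      · simpa using Or.inr ⟨ha, hxa⟩
      · by_cases hab : a + b = 0
        · exact Or.inl hab
        right
        suffices hl : ∀ c : K, x + c • (a + b) ∈ X from
          ⟨h.mem_of_affine_line hab hl, by simpa using hl 1⟩
        intro c
        by_cases hi : b ∈ Submodule.span K {a}
        · obtain ⟨d, rfl⟩ := mem_single.1 hi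
          have := h.mem_of_line hx ha hxa one_ne_zero (c + c * d)
          convert this using 1
          match_scalars <;> noncomm_ring
        · rw [smul_add, ← add_assoc]
          exact h.plane hx ha hb hxa hxb hi c c
    · rintro c y - (rfl | ⟨hy, hxy⟩)
      · simp
      · by_cases hc : c = 0
        · left; simp [hc]
        · right
          refine ⟨h.coneY.smul_mem c hc y hy, ?_⟩
          simpa using h.mem_of_line hx hy hxy one_ne_zero c
  · rintro (rfl | hy)
    · exact Submodule.zero_mem _
    · exact Submodule.subset_span hy

end IsHVSystem

end SingularPlanes

/-! ### Classes of collinear points -/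

section Classes

variable {K V : Type*} [DivisionRing K] [AddCommGroup V] [Module K V]

namespace IsHVSystem

variable {X Y : Set V} {Ξ : Set (Submodule K V)}

lemma mem_Y_of_rad (h : IsHVSystem X Y Ξ) {x y : V} (hx : x ∈ X)
    (hy : y ∈ rad (K := K) X Y x) (h0 : y ≠ 0) : y ∈ Y :=
  (((h.mem_rad hx).1 hy).resolve_left h0).1

lemma mem_rad_of_add (h : IsHVSystem X Y Ξ) {x y : V} (hx : x ∈ X) (hy : y ∈ Y)
    (hxy : x + y ∈ X) : y ∈ rad (K := K) X Y x :=
  (h.mem_rad hx).2 (Or.inr ⟨hy, hxy⟩)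

lemma add_rad_mem (h : IsHVSystem X Y Ξ) {x r : V} (hx : x ∈ X)
    (hr : r ∈ rad (K := K) X Y x) : x + r ∈ X := by
  rcases (h.mem_rad hx).1 hr with rfl | hr
  · simpa using hx
  · exact hr.2

lemma smul_add_rad_mem (h : IsHVSystem X Y Ξ) {x r : V} (hx : x ∈ X)
    (hr : r ∈ rad (K := K) X Y x) {a : K} (ha : a ≠ 0) : a • x + r ∈ X := by
  have := h.coneX.smul_mem a ha _ (h.add_rad_mem hx (Submodule.smul_mem _ a⁻¹ hr))
  rwa [smul_add, smul_inv_smul₀ ha] at this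

lemma mem_sing {x w : V} :
    w ∈ sing (K := K) X Y x ↔ ∃ a : K, ∃ r ∈ rad (K := K) X Y x, w = a • x + r := by
  rw [sing, Submodule.mem_sup]
  constructor
  · rintro ⟨y, hy, r, hr, rfl⟩
    obtain ⟨a, rfl⟩ := mem_single.1 hy
    exact ⟨a, r, hr, rfl⟩
  · rintro ⟨a, r, hr, rfl⟩
    exact ⟨_, smul_mem_single x a, r, hr, rfl⟩

lemma self_mem_sing (x : V) : x ∈ sing (K := K) X Y x :=
  Submodule.mem_sup_left (Submodule.mem_span_singleton_self x)

lemma rad_le_sing (x : V) : rad (K := K) X Y x ≤ sing X Y x := le_sup_right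

lemma self_notMem_rad (h : IsHVSystem X Y Ξ) {x : V} (hx : x ∈ X) :
    x ∉ rad (K := K) X Y x :=
  fun hm => h.disj hx (h.mem_Y_of_rad hx hm (h.coneX.ne_zero _ hx))

lemma mem_rad_of_mem_sing (h : IsHVSystem X Y Ξ) {x y : V} (hx : x ∈ X) (hy : y ∈ Y)
    (hs : y ∈ sing (K := K) X Y x) : y ∈ rad (K := K) X Y x := by
  obtain ⟨a, r, hr, rfl⟩ := mem_sing.1 hs
  by_cases ha : a = 0
  · simpa [ha] using hr
  · exact (h.disj (h.smul_add_rad_mem hx hr ha) hy).elim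

lemma exists_of_mem_sing (h : IsHVSystem X Y Ξ) {x w : V} (hx : x ∈ X) (hw : w ∈ X)
    (hs : w ∈ sing (K := K) X Y x) : ∃ a : K, a ≠ 0 ∧ ∃ r ∈ rad (K := K) X Y x, w = a • x + r := by
  obtain ⟨a, r, hr, rfl⟩ := mem_sing.1 hs
  refine ⟨a, ?_, r, hr, rfl⟩
  rintro rfl
  rw [zero_smul, zero_add] at hw
  exact h.disj hw (h.mem_Y_of_rad hx hr (h.coneX.ne_zero _ hw))

lemma rad_smul_add_le (h : IsHVSystem X Y Ξ) {x r : V} (hx : x ∈ X)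
    (hr : r ∈ rad (K := K) X Y x) {a : K} (ha : a ≠ 0) :
    rad (K := K) X Y x ≤ rad X Y (a • x + r) := by
  intro y hy
  by_cases hy0 : y = 0
  · rw [hy0]; exact Submodule.zero_mem _
  refine h.mem_rad_of_add (h.smul_add_rad_mem hx hr ha) (h.mem_Y_of_rad hx hy hy0) ?_
  rw [add_assoc]
  exact h.smul_add_rad_mem hx (Submodule.add_mem _ hr hy) ha

lemma rad_eq (h : IsHVSystem X Y Ξ) {x w : V} (hx : x ∈ X) (hw : w ∈ X)
    (hs : w ∈ sing (K := K) X Y x) : rad (K := K) X Y w = rad X Y x := by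
  obtain ⟨a, ha, r, hr, rfl⟩ := h.exists_of_mem_sing hx hw hs
  have h1 := h.rad_smul_add_le hx hr ha
  refine le_antisymm ?_ h1
  have h2 := h.rad_smul_add_le (r := -(a⁻¹ • r)) hw
    (Submodule.neg_mem _ (Submodule.smul_mem _ _ (h1 hr))) (inv_ne_zero ha)
  rwa [smul_add, inv_smul_smul₀ ha, add_neg_cancel_right] at h2

lemma mem_sing_symm (h : IsHVSystem X Y Ξ) {x w : V} (hx : x ∈ X) (hw : w ∈ X)
    (hs : w ∈ sing (K := K) X Y x) : x ∈ sing (K := K) X Y w := by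
  have h0 := h.rad_eq hx hw hs
  obtain ⟨a, ha, r, hr, rfl⟩ := h.exists_of_mem_sing hx hw hs
  refine mem_sing.2 ⟨a⁻¹, -(a⁻¹ • r), ?_, ?_⟩
  · rw [h0]; exact Submodule.neg_mem _ (Submodule.smul_mem _ _ hr)
  · rw [smul_add, inv_smul_smul₀ ha, add_neg_cancel_right]

lemma sing_eq (h : IsHVSystem X Y Ξ) {x w : V} (hx : x ∈ X) (hw : w ∈ X)
    (hs : w ∈ sing (K := K) X Y x) : sing (K := K) X Y w = sing X Y x := by
  have h0 := h.rad_eq hx hw hs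
  have h1 := h.mem_sing_symm hx hw hs
  apply le_antisymm
  · exact sup_le (single_le hs) (h0.le.trans (rad_le_sing x))
  · exact sup_le (single_le h1) (h0.ge.trans (rad_le_sing w))

/-- A line joining two points of different classes has no point in `Y`. -/
lemma notMem_secant (h : IsHVSystem X Y Ξ) {x w y : V} (hx : x ∈ X) (hw : w ∈ X)
    (hs : w ∉ sing (K := K) X Y x) (hy : y ∈ Y) : y ∉ Submodule.span K {x, w} := by
  intro hm
  obtain ⟨a, b, rfl⟩ := mem_pair.1 hm
  have hb : b ≠ 0 := by
    rintro rfl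
    rw [zero_smul, add_zero] at hy
    exact h.disj (h.coneX.smul_mem a (by
      rintro rfl; exact h.coneY.ne_zero _ hy (by simp)) _ hx) hy
  have ha : a ≠ 0 := by
    rintro rfl
    rw [zero_smul, zero_add] at hy
    exact h.disj (h.coneX.smul_mem b hb _ hw) hy
  have h1 : (-a⁻¹) • (a • x + b • w) ∈ rad (K := K) X Y x := by
    refine h.mem_rad_of_add hx
      (h.coneY.smul_mem _ (neg_ne_zero.2 (inv_ne_zero ha)) _ hy) ?_
    have e : x + (-a⁻¹) • (a • x + b • w) = (-(a⁻¹ * b)) • w := by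
      rw [smul_add, smul_smul, smul_smul, neg_mul, neg_mul, inv_mul_cancel₀ ha]
      match_scalars <;> noncomm_ring
    rw [e]
    exact h.coneX.smul_mem _ (neg_ne_zero.2 (mul_ne_zero (inv_ne_zero ha) hb)) _ hw
  have h2 : a • x + b • w ∈ sing (K := K) X Y x :=
    rad_le_sing x ((Submodule.smul_mem_iff _ (neg_ne_zero.2 (inv_ne_zero ha))).1 h1)
  exact hs ((Submodule.smul_mem_iff _ hb).1 ((Submodule.add_mem_iff_right _
    (Submodule.smul_mem _ _ (self_mem_sing x))).1 h2))

lemma mem_or_of_secant (h : IsHVSystem X Y Ξ) {x w u : V} (hx : x ∈ X) (hw : w ∈ X)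
    (hs : w ∉ sing (K := K) X Y x) (hu : u ∈ X) (hm : u ∈ Submodule.span K {x, w}) :
    u ∈ Submodule.span K {x} ∨ u ∈ Submodule.span K {w} := by
  by_contra! hc
  obtain ⟨y, hy, hym⟩ := h.singular_of_three hx hw hu hm hc.1 hc.2
  exact h.notMem_secant hx hw hs hy hym

lemma vertex_mem_rad (h : IsHVSystem X Y Ξ) {ξ : Submodule K V} (hξ : ξ ∈ Ξ) {v : V}
    (ht : IsVTube X ξ v) {a : V} (ha : a ∈ X) (haξ : a ∈ ξ) : v ∈ rad (K := K) X Y a :=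
  h.mem_rad_of_add ha (h.vertex_mem hξ ht) (by simpa using ht.cone a ha haξ 1)

lemma pair_le_sing (h : IsHVSystem X Y Ξ) {ξ : Submodule K V} (hξ : ξ ∈ Ξ) {v : V}
    (ht : IsVTube X ξ v) {a : V} (ha : a ∈ X) (haξ : a ∈ ξ) :
    Submodule.span K {a, v} ≤ sing (K := K) X Y a :=
  pair_le (self_mem_sing a) (rad_le_sing a (h.vertex_mem_rad hξ ht ha haξ))

lemma rad_inf_tube (h : IsHVSystem X Y Ξ) {ξ : Submodule K V} (hξ : ξ ∈ Ξ) {v : V}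
    (ht : IsVTube X ξ v) {a r : V} (ha : a ∈ X) (hr : r ∈ rad (K := K) X Y a) (hrξ : r ∈ ξ) :
    r ∈ Submodule.span K {v} := by
  by_cases h0 : r = 0
  · rw [h0]; exact Submodule.zero_mem _
  · exact h.mem_vertex hξ ht (h.mem_Y_of_rad ha hr h0) hrξ

/-- A tube meets the singular subspace of each of its points in a generator. -/
lemma mem_pair_of_sing (h : IsHVSystem X Y Ξ) {ξ : Submodule K V} (hξ : ξ ∈ Ξ) {v : V}
    (ht : IsVTube X ξ v) {a b : V} (ha : a ∈ X) (haξ : a ∈ ξ) (hbξ : b ∈ ξ)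
    (hs : b ∈ sing (K := K) X Y a) : b ∈ Submodule.span K {a, v} := by
  obtain ⟨c, r, hr, rfl⟩ := mem_sing.1 hs
  have hrξ := (ξ.add_mem_iff_right (ξ.smul_mem c haξ)).1 hbξ
  exact Submodule.add_mem _ (Submodule.smul_mem _ c (left_mem_pair a v))
    (single_le_right a v (h.rad_inf_tube hξ ht ha hr hrξ))

lemma notMem_sing_of_notMem_pair (h : IsHVSystem X Y Ξ) {ξ : Submodule K V} (hξ : ξ ∈ Ξ) {v : V}
    (ht : IsVTube X ξ v) {a b : V} (ha : a ∈ X) (haξ : a ∈ ξ) (hbξ : b ∈ ξ)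
    (hb : b ∉ Submodule.span K {a, v}) : b ∉ sing (K := K) X Y a :=
  fun hs => hb (h.mem_pair_of_sing hξ ht ha haξ hbξ hs)

lemma tube_unique (h : IsHVSystem X Y Ξ) {x w : V} (hx : x ∈ X)
    (hs : w ∉ sing (K := K) X Y x) {ξ₁ ξ₂ : Submodule K V} (h₁ : ξ₁ ∈ Ξ) (h₂ : ξ₂ ∈ Ξ)
    (hx₁ : x ∈ ξ₁) (hx₂ : x ∈ ξ₂) (hw₁ : w ∈ ξ₁) (hw₂ : w ∈ ξ₂) : ξ₁ = ξ₂ := by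
  by_contra hne
  obtain ⟨v, hv, ht⟩ := h.tube ξ₁ h₁
  exact hs (h.pair_le_sing h₁ ht hx hx₁ (h.mem_pair_of_mem_two h₁ h₂ hne ht hx hx₁ hx₂ hw₁ hw₂))

/-- If the difference of two points of different classes is in a member of `Ξ`, then both
points are. -/
lemma mem_of_sub_mem (h : IsHVSystem X Y Ξ) {p q : V} (hp : p ∈ X) (hq : q ∈ X)
    (hs : q ∉ sing (K := K) X Y p) {ξ : Submodule K V} (hξ : ξ ∈ Ξ) (hm : p - q ∈ ξ) :
    p ∈ ξ ∧ q ∈ ξ := by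
  obtain ⟨ξ', hξ', hpξ, hqξ⟩ := h.join p hp q hq
  have hpq : p - q ∈ Submodule.span K {p, q} :=
    Submodule.sub_mem _ (left_mem_pair p q) (right_mem_pair p q)
  by_cases he : ξ = ξ'
  · rw [he]; exact ⟨hpξ, hqξ⟩
  exfalso
  have h0 : p - q ≠ 0 := by
    intro h0
    rw [sub_eq_zero] at h0
    exact hs (h0 ▸ self_mem_sing p)
  rcases h.meet ξ hξ ξ' hξ' he _ hm (ξ'.sub_mem hpξ hqξ) h0 with hX | hY
  · rcases h.mem_or_of_secant hp hq hs hX hpq with h1 | h1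
    · exact hs (single_le (self_mem_sing p) ((Submodule.sub_mem_iff_right _
        (Submodule.mem_span_singleton_self p)).1 h1))
    · have h2 := (Submodule.sub_mem_iff_left _ (Submodule.mem_span_singleton_self q)).1 h1
      exact hs (single_le (self_mem_sing p) (single_comm (h.coneX.ne_zero _ hp) h2))
  · exact h.notMem_secant hp hq hs hY hpq

/-- The radicals of the points of different classes only share the vertex of their tube. -/
lemma mem_vertex_of_rads (h : IsHVSystem X Y Ξ) {x w y : V} (hx : x ∈ X) (hw : w ∈ X)
    (hs : w ∉ sing (K := K) X Y x) {ξ : Submodule K V} (hξ : ξ ∈ Ξ) {v : V}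
    (ht : IsVTube X ξ v) (hxξ : x ∈ ξ) (hwξ : w ∈ ξ) (hyx : y ∈ rad (K := K) X Y x)
    (hyw : y ∈ rad (K := K) X Y w) : y ∈ Submodule.span K {v} := by
  have hxy := h.add_rad_mem hx hyx
  have hxs : x + y ∈ sing (K := K) X Y x :=
    Submodule.add_mem _ (self_mem_sing x) (rad_le_sing x hyx)
  have h1 := (h.mem_of_sub_mem hxy (h.add_rad_mem hw hyw) (by
    rw [h.sing_eq hx hxy hxs]
    intro hc
    exact hs ((Submodule.add_mem_iff_left _ (rad_le_sing x hyx)).1 hc)) hξ (by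
      rw [add_sub_add_right_eq_sub]; exact ξ.sub_mem hxξ hwξ)).1
  exact h.rad_inf_tube hξ ht hx hyx ((ξ.add_mem_iff_right hxξ).1 h1)

lemma exists_tube_of_rad (h : IsHVSystem X Y Ξ) {x r : V} (hx : x ∈ X)
    (hr : r ∈ rad (K := K) X Y x) (h0 : r ≠ 0) :
    ∃ ξ ∈ Ξ, IsVTube X ξ r ∧ x ∈ ξ ∧ ∃ z ∈ X, z ∈ ξ ∧ z ∉ sing (K := K) X Y x := by
  have := h.finite
  obtain ⟨ξ, hξ, hxξ, hrξ⟩ := h.join x hx _ (h.add_rad_mem hx hr)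
  have ht := h.tube_of_mem hξ (h.mem_Y_of_rad hx hr h0) ((ξ.add_mem_iff_right hxξ).1 hrξ)
  obtain ⟨z, hz, hzξ, hzx⟩ := ht.exists_notMem hx hxξ
  exact ⟨ξ, hξ, ht, hxξ, z, hz, hzξ, h.notMem_sing_of_notMem_pair hξ ht hx hxξ hzξ hzx⟩

lemma exists_join (h : IsHVSystem X Y Ξ) {x w : V} (hx : x ∈ X) (hw : w ∈ X) :
    ∃ ξ ∈ Ξ, x ∈ ξ ∧ w ∈ ξ ∧ ∃ v ∈ Y, IsVTube X ξ v ∧ v ∈ rad (K := K) X Y x ∧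
      v ∈ rad (K := K) X Y w := by
  obtain ⟨ξ, hξ, hxξ, hwξ⟩ := h.join x hx w hw
  obtain ⟨v, hv, ht⟩ := h.tube ξ hξ
  exact ⟨ξ, hξ, hxξ, hwξ, v, hv, ht, h.vertex_mem_rad hξ ht hx hxξ, h.vertex_mem_rad hξ ht hw hwξ⟩

/-- The tube joining two points of different classes, with a prescribed common vector of the
radicals as vertex. -/
lemma exists_join_of_rads (h : IsHVSystem X Y Ξ) {x w v : V} (hx : x ∈ X) (hw : w ∈ X)
    (hs : w ∉ sing (K := K) X Y x) (hvx : v ∈ rad (K := K) X Y x)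
    (hvw : v ∈ rad (K := K) X Y w) (h0 : v ≠ 0) :
    ∃ ξ ∈ Ξ, x ∈ ξ ∧ w ∈ ξ ∧ IsVTube X ξ v := by
  obtain ⟨ξ, hξ, hxξ, hwξ, v', hv', ht, -, -⟩ := h.exists_join hx hw
  have h1 := h.mem_vertex_of_rads hx hw hs hξ ht hxξ hwξ hvx hvw
  exact ⟨ξ, hξ, hxξ, hwξ, h.tube_of_mem hξ (h.mem_Y_of_rad hx hvx h0)
    (single_le ht.mem h1)⟩

/-- All tangent planes at a point of `X` lie in one subspace of dimension 5. -/
lemma exists_tan (h : IsHVSystem X Y Ξ) {x : V} (hx : x ∈ X) :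
    ∃ T : Submodule K V, finrank K T = 5 ∧ ∀ ξ ∈ Ξ, x ∈ ξ → ∀ v τ, IsVTube X ξ v →
      IsTangentAt X ξ v x τ → τ ≤ T := by
  have := h.finite
  obtain ⟨T, hT, hT'⟩ := h.tan x hx
  refine ⟨T, hT, fun ξ hξ hxξ v τ ht hτ => ?_⟩
  obtain ⟨y, hy, hyξ, hyx⟩ := ht.exists_notMem hx hxξ
  have hs := h.notMem_sing_of_notMem_pair hξ ht hx hxξ hyξ hyx
  exact hT' y hy (fun hc => hyx (single_le_left x v hc)) ξ hξ hxξ hyξ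
    (fun ξ' hξ' hx' hy' => h.tube_unique hx hs hξ' hξ hx' hxξ hy' hyξ) v τ ht hτ

/-- Points that agree modulo the singular subspace of a point `z` of another class are on a
singular line with vertex in the radical of `z`. -/
lemma sub_mem_rad (h : IsHVSystem X Y Ξ) {z p q : V} (hz : z ∈ X) (hp : p ∈ X) (hq : q ∈ X)
    (hs : p ∉ sing (K := K) X Y z) (hm : p - q ∈ sing (K := K) X Y z) :
    p - q ∈ rad (K := K) X Y z ∧ p - q ∈ rad (K := K) X Y p := by
  by_cases h0 : p - q = 0
  · rw [h0]; exact ⟨Submodule.zero_mem _, Submodule.zero_mem _⟩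
  have hpq : p - q ∈ Submodule.span K {p, q} :=
    Submodule.sub_mem _ (left_mem_pair p q) (right_mem_pair p q)
  obtain ⟨a, r, hr, he⟩ := mem_sing.1 hm
  have hY : p - q ∈ Y := by
    by_contra hY
    have ha : a ≠ 0 := by
      rintro rfl
      rw [zero_smul, zero_add] at he
      exact hY (he ▸ h.mem_Y_of_rad hz hr (he ▸ h0))
    have hX : p - q ∈ X := he ▸ h.smul_add_rad_mem hz hr ha
    have hsz := h.sing_eq hz hX hm
    have h1 : p ∉ sing (K := K) X Y (p - q) := by rwa [hsz]
    -- the difference would be a third point of the line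
    have hqs : q ∉ sing (K := K) X Y p := by
      intro hc
      exact h1 (h.mem_sing_symm hp hX (Submodule.sub_mem _ (self_mem_sing p) hc))
    rcases h.mem_or_of_secant hp hq hqs hX hpq with h2 | h2
    · exact h1 (h.mem_sing_symm hp hX (single_le (self_mem_sing p) h2))
    · have h3 := (Submodule.sub_mem_iff_left _ (Submodule.mem_span_singleton_self q)).1 h2
      exact hqs (h.mem_sing_symm hq hp (single_le (self_mem_sing q) h3))
  refine ⟨h.mem_rad_of_mem_sing hz hY hm, ?_⟩
  have h3 : -(p - q) ∈ rad (K := K) X Y p := by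
    refine h.mem_rad_of_add hp ?_ (by simpa using hq)
    rw [← neg_one_smul K]
    exact h.coneY.smul_mem _ (neg_ne_zero.2 one_ne_zero) _ hY
  simpa using Submodule.neg_mem _ h3

end IsHVSystem

end Classes

/-! ### Radicals are lines of a plane -/

section RadicalPlane

variable {K V : Type*} [DivisionRing K] [AddCommGroup V] [Module K V]

namespace IsHVSystem

variable {X Y : Set V} {Ξ : Set (Submodule K V)}

lemma nonempty (h : IsHVSystem X Y Ξ) : ∃ x, x ∈ X := by
  by_contra! hc
  have h1 : X = ∅ := Set.eq_empty_of_forall_notMem hc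
  have h2 := h.span
  have h3 := h.dim
  rw [h1, Submodule.span_empty] at h2
  rw [← finrank_top K V, ← h2, finrank_bot] at h3
  omega

lemma exists_rad (h : IsHVSystem X Y Ξ) {x : V} (hx : x ∈ X) :
    ∃ v ∈ rad (K := K) X Y x, v ≠ 0 := by
  obtain ⟨ξ, hξ, hxξ, -, v, hv, -, hvx, -⟩ := h.exists_join hx hx
  exact ⟨v, hvx, h.coneY.ne_zero _ hv⟩

/-- If one point lies on one singular line only, then all tubes have the same vertex. -/
lemma rad_eq_single (h : IsHVSystem X Y Ξ) {x₀ : V} (hx₀ : x₀ ∈ X)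
    (h1 : finrank K (rad (K := K) X Y x₀) ≤ 1) :
    ∃ t ∈ Y, ∀ x ∈ X, rad (K := K) X Y x = Submodule.span K {t} := by
  have := h.finite
  obtain ⟨t, ht, ht0⟩ := h.exists_rad hx₀
  refine ⟨t, h.mem_Y_of_rad hx₀ ht ht0, ?_⟩
  have h0 : rad (K := K) X Y x₀ = Submodule.span K {t} :=
    (Submodule.eq_of_le_of_finrank_le (single_le ht) (by rwa [finrank_span_singleton ht0])).symm
  have key : ∀ x ∈ X, t ∈ rad (K := K) X Y x := by
    intro x hx
    obtain ⟨ξ, hξ, hxξ, -, v, hv, -, hvx, hvx₀⟩ := h.exists_join hx hx₀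
    rw [h0] at hvx₀
    exact single_le hvx (single_comm (h.coneY.ne_zero _ hv) hvx₀)
  intro x hx
  refine le_antisymm (fun r hr => ?_) (single_le (key x hx))
  by_cases hr0 : r = 0
  · rw [hr0]; exact Submodule.zero_mem _
  obtain ⟨ξ, hξ, hξr, hxξ, z, hz, hzξ, hzx⟩ := h.exists_tube_of_rad hx hr hr0
  exact single_comm ht0 (h.mem_vertex_of_rads hx hz hzx hξ hξr hxξ hzξ (key x hx) (key z hz))

lemma finrank_sing (h : IsHVSystem X Y Ξ) {x : V} (hx : x ∈ X) :
    finrank K (sing (K := K) X Y x) = finrank K (rad (K := K) X Y x) + 1 := by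
  have := h.finite
  rw [sing, sup_comm, Submodule.finrank_sup_span_singleton (h.self_notMem_rad hx)]

lemma exists_ne (h : IsHVSystem X Y Ξ) {x v : V}
    (h2 : 2 ≤ finrank K (rad (K := K) X Y x)) :
    ∃ r ∈ rad (K := K) X Y x, r ∉ Submodule.span K {v} := by
  have := h.finite
  exact exists_notMem_of_finrank_lt (by have := finrank_single_le (K := K) v; omega)

lemma dir_notMem_sing (h : IsHVSystem X Y Ξ) {ξ τ : Submodule K V} {v x t : V} (hξ : ξ ∈ Ξ)
    (ht : IsVTube X ξ v) (hx : x ∈ X) (hxξ : x ∈ ξ) (hτ : IsTangentAt X ξ v x τ) (htτ : t ∈ τ)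
    (htx : t ∉ Submodule.span K {x, v}) : t ∉ sing (K := K) X Y x :=
  fun hc => htx (h.mem_pair_of_sing hξ ht hx hxξ (hτ.le htτ) hc)

lemma sing_le_tan (h : IsHVSystem X Y Ξ) {x : V} (hx : x ∈ X) {T : Submodule K V}
    (hT : ∀ ξ ∈ Ξ, x ∈ ξ → ∀ v τ, IsVTube X ξ v → IsTangentAt X ξ v x τ → τ ≤ T) :
    sing (K := K) X Y x ≤ T := by
  have hx' : ∀ r ∈ rad (K := K) X Y x, r ≠ 0 → x ∈ T ∧ r ∈ T := by
    intro r hr hr0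
    obtain ⟨ξ, hξ, ht, hxξ, -⟩ := h.exists_tube_of_rad hx hr hr0
    obtain ⟨τ, hτ⟩ := ht.tangent x hx hxξ
    have := hT ξ hξ hxξ r τ ht hτ
    exact ⟨this hτ.base, this hτ.vertex⟩
  obtain ⟨v, hv, hv0⟩ := h.exists_rad hx
  refine sup_le (single_le (hx' v hv hv0).1) fun r hr => ?_
  by_cases hr0 : r = 0
  · rw [hr0]; exact T.zero_mem
  · exact (hx' r hr hr0).2

/-- The tangent plane is the same along a generator. -/
lemma _root_.IsTangentAt.add_smul {ξ τ : Submodule K V} {v x : V} (hτ : IsTangentAt X ξ v x τ) :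
    IsTangentAt X ξ v (x + v) τ := by
  have e : Submodule.span K {x + v, v} = Submodule.span K {x, v} := by
    refine le_antisymm (pair_le (Submodule.add_mem _ (left_mem_pair _ _) (right_mem_pair _ _))
      (right_mem_pair _ _)) (pair_le ?_ (right_mem_pair _ _))
    exact (Submodule.add_mem_iff_left _ (right_mem_pair _ _)).1 (left_mem_pair (x + v) v)
  exact ⟨hτ.le, hτ.rank, τ.add_mem hτ.base hτ.vertex, hτ.vertex, by rw [e]; exact hτ.only,
    by rw [e]; exact hτ.lift⟩

/-- Singular subspaces are at most planes: a solid `Σ` would be a hyperplane of all subspaces of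
tangents at its points, which would therefore coincide; then tubes joining a further point to two
points of `Σ` would agree modulo `Σ`. -/
lemma finrank_rad_le (h : IsHVSystem X Y Ξ) {z : V} (hz : z ∈ X) :
    finrank K (rad (K := K) X Y z) ≤ 2 := by
  have := h.finite
  by_contra! h3
  obtain ⟨v, hv, hv0⟩ := h.exists_rad hz
  obtain ⟨ξ, hξ, ht, hzξ, -⟩ := h.exists_tube_of_rad hz hv hv0
  obtain ⟨τ, hτ⟩ := ht.tangent z hz hzξ
  obtain ⟨t, htτ, htz⟩ := hτ.exists_dir
  have hts := h.dir_notMem_sing hξ ht hz hzξ hτ htτ htz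
  have hz' := h.add_rad_mem hz hv
  have hzs : z + v ∈ sing (K := K) X Y z :=
    Submodule.add_mem _ (self_mem_sing z) (rad_le_sing z hv)
  have hse := h.sing_eq hz hz' hzs
  have hre := h.rad_eq hz hz' hzs
  obtain ⟨T, hT5, hT⟩ := h.exists_tan hz
  obtain ⟨T', hT5', hT'⟩ := h.exists_tan hz'
  -- `sing z` has rank at least 4, so a proper extension of rank 5 is given by one further vector
  have key : ∀ (S : Submodule K V) (s : V), finrank K S = 5 → sing (K := K) X Y z ≤ S → s ∈ S →
      s ∉ sing (K := K) X Y z → S = sing (K := K) X Y z ⊔ Submodule.span K {s} := by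
    intro S s hS hle hs hsz
    refine (Submodule.eq_of_le_of_finrank_le (sup_le hle (single_le hs)) ?_).symm
    rw [Submodule.finrank_sup_span_singleton hsz, h.finrank_sing hz, hS]
    omega
  have e1 := key T t hT5 (h.sing_le_tan hz hT) (hT ξ hξ hzξ v τ ht hτ htτ) hts
  -- `t` is tangent also at `z + v`, since tangent planes are constant along generators
  have e2 := key T' t hT5' (hse ▸ h.sing_le_tan hz' hT')
    (hT' ξ hξ (ξ.add_mem hzξ ht.mem) v τ ht hτ.add_smul htτ) hts
  obtain ⟨v₂, hv₂, hv₂v⟩ := h.exists_ne (v := v) (by omega : 2 ≤ finrank K (rad (K := K) X Y z))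
  have hv₂0 : v₂ ≠ 0 := by rintro rfl; exact hv₂v (Submodule.zero_mem _)
  obtain ⟨ξ₂, hξ₂, ht₂, hzξ₂, p, hp, hpξ₂, hpz⟩ := h.exists_tube_of_rad hz hv₂ hv₂0
  obtain ⟨τ₂, hτ₂⟩ := ht₂.tangent z hz hzξ₂
  obtain ⟨t₂, htτ₂, htz₂⟩ := hτ₂.exists_dir
  have hpz₂ : p ∉ Submodule.span K {z, v₂} := fun hc => hpz (h.pair_le_sing hξ₂ ht₂ hz hzξ₂ hc)
  obtain ⟨s₂, hs₂, hg, hgξ, hgτ, hgp⟩ := hτ₂.exists_lift hp hpξ₂ hpz₂ htτ₂ htz₂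
  obtain ⟨ξ₃, hξ₃, hzξ₃, hpξ₃, ht₃⟩ := h.exists_join_of_rads hz' hp (hse ▸ hpz) (hre ▸ hv₂)
    (h.vertex_mem_rad hξ₂ ht₂ hp hpξ₂) hv₂0
  obtain ⟨τ₃, hτ₃⟩ := ht₃.tangent _ hz' hzξ₃
  obtain ⟨t₃, htτ₃, htz₃⟩ := hτ₃.exists_dir
  have hts₃ : t₃ ∉ sing (K := K) X Y z := hse ▸ h.dir_notMem_sing hξ₃ ht₃ hz' hzξ₃ hτ₃ htτ₃ htz₃
  have hts₂ := h.dir_notMem_sing hξ₂ ht₂ hz hzξ₂ hτ₂ htτ₂ htz₂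
  have e3 := key T t₂ hT5 (h.sing_le_tan hz hT) (hT ξ₂ hξ₂ hzξ₂ v₂ τ₂ ht₂ hτ₂ htτ₂) hts₂
  have ht₃T : t₃ ∈ T := by
    rw [e1, ← e2]; exact hT' ξ₃ hξ₃ hzξ₃ v₂ τ₃ ht₃ hτ₃ htτ₃
  rw [e3] at ht₃T
  obtain ⟨c, hc⟩ := mem_sup_single.1 ht₃T
  have hc0 : c ≠ 0 := by rintro rfl; exact hts₃ (by simpa using hc)
  have hpz₃ : p ∉ Submodule.span K {z + v, v₂} := fun hm =>
    hpz (hse ▸ h.pair_le_sing hξ₃ ht₃ hz' hzξ₃ hm)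
  obtain ⟨s₃, hs₃, hg', hgξ', -, -⟩ := hτ₃.exists_lift hp hpξ₃ hpz₃
    (τ₃.smul_mem c⁻¹ htτ₃) (fun hm => htz₃ ((Submodule.smul_mem_iff _ (inv_ne_zero hc0)).1 hm))
  have hgz : p + t₂ + s₂ ∉ sing (K := K) X Y z :=
    h.notMem_sing_of_notMem_pair hξ₂ ht₂ hz hzξ₂ hgξ fun hm => hgτ (hτ₂.pair_le hm)
  -- the two lifts agree modulo the singular subspace
  have hd : (p + t₂ + s₂) - (p + c⁻¹ • t₃ + s₃) ∈ sing (K := K) X Y z := by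
    have e : (p + t₂ + s₂) - (p + c⁻¹ • t₃ + s₃) =
        s₂ - s₃ - c⁻¹ • (t₃ - c • t₂) := by
      rw [smul_sub, inv_smul_smul₀ hc0]; abel
    rw [e]
    refine Submodule.sub_mem _ (Submodule.sub_mem _ (h.pair_le_sing hξ₂ ht₂ hz hzξ₂ hs₂) ?_)
      (Submodule.smul_mem _ _ hc)
    exact hse ▸ h.pair_le_sing hξ₃ ht₃ hz' hzξ₃ hs₃
  obtain ⟨hd1, hd2⟩ := h.sub_mem_rad hz hg hg' hgz hd
  have hd3 := h.mem_vertex_of_rads hz hg hgz hξ₂ ht₂ hzξ₂ hgξ hd1 hd2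
  have hg'ξ₂ : p + c⁻¹ • t₃ + s₃ ∈ ξ₂ :=
    (ξ₂.sub_mem_iff_right hgξ).1 (single_le ht₂.mem hd3)
  have hps : p + c⁻¹ • t₃ + s₃ ∉ sing (K := K) X Y p := fun hm => by
    have h1 := h.mem_pair_of_sing hξ₂ ht₂ hp hpξ₂ hg'ξ₂ hm
    exact hgp ((Submodule.sub_mem_iff_left _ h1).1 (single_le_right p v₂ hd3))
  -- the tubes coincide, hence contain both `z` and `z + v`, although their vertex is `v₂`
  have he := h.tube_unique hp hps hξ₂ hξ₃ hpξ₂ hpξ₃ hg'ξ₂ hgξ'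
  have h5 : z + v ∈ ξ₂ := he ▸ hzξ₃
  have h6 := h.rad_inf_tube hξ₂ ht₂ hz hv ((ξ₂.add_mem_iff_right hzξ₂).1 h5)
  exact hv₂v (single_comm hv0 h6)

/-- The system has no point on only one singular line. -/
def Thick (X Y : Set V) : Prop := ∀ x ∈ X, 2 ≤ finrank K (rad (K := K) X Y x)

lemma finrank_rad (h : IsHVSystem X Y Ξ) (h2 : Thick (K := K) X Y) {x : V} (hx : x ∈ X) :
    finrank K (rad (K := K) X Y x) = 2 :=
  le_antisymm (h.finrank_rad_le hx) (h2 x hx)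

lemma rad_eq_pair (h : IsHVSystem X Y Ξ) (h2 : Thick (K := K) X Y) {x a b : V} (hx : x ∈ X)
    (ha : a ∈ rad (K := K) X Y x) (hb : b ∈ rad (K := K) X Y x) (ha0 : a ≠ 0)
    (hab : b ∉ Submodule.span K {a}) : rad (K := K) X Y x = Submodule.span K {a, b} := by
  have := h.finite
  exact eq_pair_of_finrank (h.finrank_rad h2 hx) ha hb ha0 hab

/-- Points whose radicals share two points are in the same class. -/
lemma mem_sing_of_rads (h : IsHVSystem X Y Ξ) {x w a b : V} (hx : x ∈ X)
    (hw : w ∈ X) (hax : a ∈ rad (K := K) X Y x) (hbx : b ∈ rad (K := K) X Y x)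
    (haw : a ∈ rad (K := K) X Y w) (hbw : b ∈ rad (K := K) X Y w) (ha0 : a ≠ 0)
    (hab : b ∉ Submodule.span K {a}) : w ∈ sing (K := K) X Y x := by
  by_contra hs
  obtain ⟨ξ, hξ, hxξ, hwξ, ht⟩ := h.exists_join_of_rads hx hw hs hax haw ha0
  exact hab (h.mem_vertex_of_rads hx hw hs hξ ht hxξ hwξ hbx hbw)

/-- All radicals are contained in one plane. -/
lemma exists_plane (h : IsHVSystem X Y Ξ) (h2 : Thick (K := K) X Y) :
    ∃ π : Submodule K V, finrank K π = 3 ∧ ∀ x ∈ X, rad (K := K) X Y x ≤ π := by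
  have := h.finite
  obtain ⟨z, hz⟩ := h.nonempty
  obtain ⟨v₁, hv₁, hv₁0⟩ := h.exists_rad hz
  obtain ⟨v₂, hv₂, hv₂₁⟩ := h.exists_ne (v := v₁) (h2 z hz)
  have hv₂0 : v₂ ≠ 0 := by rintro rfl; exact hv₂₁ (Submodule.zero_mem _)
  obtain ⟨ξ₁, hξ₁, ht₁, hzξ₁, p₁, hp₁, hpξ₁, hpz₁⟩ := h.exists_tube_of_rad hz hv₁ hv₁0
  obtain ⟨ξ₂, hξ₂, ht₂, hzξ₂, p₂, hp₂, hpξ₂, hpz₂⟩ := h.exists_tube_of_rad hz hv₂ hv₂0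
  obtain ⟨-, -, -, -, v₃, hv₃, -, h31, h32⟩ := h.exists_join hp₁ hp₂
  have hv₁p := h.vertex_mem_rad hξ₁ ht₁ hp₁ hpξ₁
  have hv₂p := h.vertex_mem_rad hξ₂ ht₂ hp₂ hpξ₂
  have hv₃0 := h.coneY.ne_zero _ hv₃
  have i1 : ∀ y ∈ rad (K := K) X Y z, y ∈ rad (K := K) X Y p₁ → y ∈ Submodule.span K {v₁} :=
    fun y hy hy' => h.mem_vertex_of_rads hz hp₁ hpz₁ hξ₁ ht₁ hzξ₁ hpξ₁ hy hy'
  have i2 : ∀ y ∈ rad (K := K) X Y z, y ∈ rad (K := K) X Y p₂ → y ∈ Submodule.span K {v₂} :=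
    fun y hy hy' => h.mem_vertex_of_rads hz hp₂ hpz₂ hξ₂ ht₂ hzξ₂ hpξ₂ hy hy'
  have hv12 : ∀ y, y ∈ Submodule.span K {v₁} → y ∈ Submodule.span K {v₂} → y = 0 := by
    intro y h1 h3
    by_contra hy
    exact hv₂₁ (single_le h1 (single_comm hy h3))
  have hv₃z : v₃ ∉ rad (K := K) X Y z := fun hm => hv₃0 (hv12 _ (i1 _ hm h31) (i2 _ hm h32))
  have e1 : rad (K := K) X Y p₁ = Submodule.span K {v₁, v₃} :=
    h.rad_eq_pair h2 hp₁ hv₁p h31 hv₁0 fun hc => hv₃z (single_le hv₁ hc)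
  have e2 : rad (K := K) X Y p₂ = Submodule.span K {v₂, v₃} :=
    h.rad_eq_pair h2 hp₂ hv₂p h32 hv₂0 fun hc => hv₃z (single_le hv₂ hc)
  refine ⟨rad (K := K) X Y z ⊔ Submodule.span K {v₃}, ?_, fun w hw => ?_⟩
  · rw [Submodule.finrank_sup_span_singleton hv₃z, h.finrank_rad h2 hz]
  have l0 : rad (K := K) X Y z ≤ rad (K := K) X Y z ⊔ Submodule.span K {v₃} := le_sup_left
  have lv : v₃ ∈ rad (K := K) X Y z ⊔ Submodule.span K {v₃} :=
    Submodule.mem_sup_right (Submodule.mem_span_singleton_self _)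
  have l1 : rad (K := K) X Y p₁ ≤ rad (K := K) X Y z ⊔ Submodule.span K {v₃} :=
    e1 ▸ pair_le (l0 hv₁) lv
  have l2 : rad (K := K) X Y p₂ ≤ rad (K := K) X Y z ⊔ Submodule.span K {v₃} :=
    e2 ▸ pair_le (l0 hv₂) lv
  obtain ⟨-, -, -, -, y₀, hy₀, -, a0, b0⟩ := h.exists_join hw hz
  obtain ⟨-, -, -, -, y₁, hy₁, -, a1, b1⟩ := h.exists_join hw hp₁
  obtain ⟨-, -, -, -, y₂, hy₂, -, a2, b2⟩ := h.exists_join hw hp₂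
  have hy₀0 := h.coneY.ne_zero _ hy₀
  by_cases c1 : y₁ ∈ Submodule.span K {y₀}
  · by_cases c2 : y₂ ∈ Submodule.span K {y₀}
    · exfalso
      refine hy₀0 (hv12 _ (i1 _ b0 ?_) (i2 _ b0 ?_))
      · exact single_le b1 (single_comm (h.coneY.ne_zero _ hy₁) c1)
      · exact single_le b2 (single_comm (h.coneY.ne_zero _ hy₂) c2)
    · rw [h.rad_eq_pair h2 hw a0 a2 hy₀0 c2]
      exact pair_le (l0 b0) (l2 b2)
  · rw [h.rad_eq_pair h2 hw a0 a1 hy₀0 c1]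
    exact pair_le (l0 b0) (l1 b1)

variable {π : Submodule K V}

/-- The radicals of two points of different classes span the plane of the radicals. -/
lemma rad_sup_rad (h : IsHVSystem X Y Ξ) (h2 : Thick (K := K) X Y) (hπ : finrank K π = 3)
    (hle : ∀ x ∈ X, rad (K := K) X Y x ≤ π) {x w : V} (hx : x ∈ X) (hw : w ∈ X)
    (hs : w ∉ sing (K := K) X Y x) : π = rad (K := K) X Y x ⊔ rad (K := K) X Y w := by
  have := h.finite
  obtain ⟨ξ, hξ, hxξ, hwξ, v, hv, ht, hvx, hvw⟩ := h.exists_join hx hw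
  obtain ⟨r, hr, hrv⟩ := h.exists_ne (v := v) (h2 w hw)
  have hrx : r ∉ rad (K := K) X Y x := fun hm =>
    hrv (h.mem_vertex_of_rads hx hw hs hξ ht hxξ hwξ hm hr)
  refine (Submodule.eq_of_le_of_finrank_le (sup_le (hle x hx) (hle w hw)) ?_).symm
  have h3 : rad (K := K) X Y x ⊔ Submodule.span K {r} ≤
      rad (K := K) X Y x ⊔ rad (K := K) X Y w := sup_le_sup_left (single_le hr) _
  have h4 := Submodule.finrank_mono h3
  rw [Submodule.finrank_sup_span_singleton hrx, h.finrank_rad h2 hx] at h4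
  omega

lemma exists_notMem_rad (h : IsHVSystem X Y Ξ) (h2 : Thick (K := K) X Y) {v : V} (hv : v ≠ 0) :
    ∃ x ∈ X, v ∉ rad (K := K) X Y x := by
  obtain ⟨x, hx⟩ := h.nonempty
  by_cases hm : v ∈ rad (K := K) X Y x
  · obtain ⟨r, hr, hrv⟩ := h.exists_ne (v := v) (h2 x hx)
    have hr0 : r ≠ 0 := by rintro rfl; exact hrv (Submodule.zero_mem _)
    obtain ⟨ξ, hξ, ht, hxξ, z, hz, hzξ, hzx⟩ := h.exists_tube_of_rad hx hr hr0
    exact ⟨z, hz, fun hc => hrv (single_comm hv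
      (h.mem_vertex_of_rads hx hz hzx hξ ht hxξ hzξ hm hc))⟩
  · exact ⟨x, hx, hm⟩

/-- A radical meets every line of the plane of the radicals. -/
lemma exists_rad_mem (h : IsHVSystem X Y Ξ) (h2 : Thick (K := K) X Y) (hπ : finrank K π = 3)
    (hle : ∀ x ∈ X, rad (K := K) X Y x ≤ π) {x : V} (hx : x ∈ X) {M : Submodule K V}
    (hM : M ≤ π) (hM2 : 2 ≤ finrank K M) : ∃ y ∈ rad (K := K) X Y x, y ∈ M ∧ y ≠ 0 := by
  have := h.finite
  exact exists_mem_inf (hle x hx) hM (by rw [h.finrank_rad h2 hx]; omega)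

lemma plane_inf_tube (h : IsHVSystem X Y Ξ) (h2 : Thick (K := K) X Y) (hπ : finrank K π = 3)
    (hle : ∀ x ∈ X, rad (K := K) X Y x ≤ π) {ξ : Submodule K V} (hξ : ξ ∈ Ξ) {v : V}
    (ht : IsVTube X ξ v) {u : V} (hu : u ∈ π) (huξ : u ∈ ξ) : u ∈ Submodule.span K {v} := by
  have := h.finite
  by_contra huv
  obtain ⟨a, ha, haξ⟩ := ht.nonempty
  have hvπ := hle a ha (h.vertex_mem_rad hξ ht ha haξ)
  obtain ⟨x, hx, hvx⟩ := h.exists_notMem_rad h2 ht.ne_zero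
  obtain ⟨y, hy, hyM, hy0⟩ := h.exists_rad_mem h2 hπ hle hx (pair_le hvπ hu)
    (finrank_pair ht.ne_zero huv).ge
  have h1 := h.mem_vertex hξ ht (h.mem_Y_of_rad hx hy hy0) (pair_le ht.mem huξ hyM)
  exact hvx (single_le hy (single_comm hy0 h1))

lemma finrank_tube_sup_plane (h : IsHVSystem X Y Ξ) (h2 : Thick (K := K) X Y)
    (hπ : finrank K π = 3) (hle : ∀ x ∈ X, rad (K := K) X Y x ≤ π) {ξ : Submodule K V}
    (hξ : ξ ∈ Ξ) : finrank K (ξ ⊔ π : Submodule K V) = 6 := by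
  have := h.finite
  obtain ⟨v, hv, ht⟩ := h.tube ξ hξ
  obtain ⟨a, ha, haξ⟩ := ht.nonempty
  have e : ξ ⊓ π = Submodule.span K {v} :=
    le_antisymm (fun u hu => h.plane_inf_tube h2 hπ hle hξ ht hu.2 hu.1)
      (single_le ⟨ht.mem, hle a ha (h.vertex_mem_rad hξ ht ha haξ)⟩)
  have := Submodule.finrank_sup_add_finrank_inf_eq ξ π
  rw [e, finrank_span_singleton ht.ne_zero, ht.rank, hπ] at this
  omega

/-- A tube with vertex `v` meets every class whose radical contains `v`. Otherwise, joining a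
point `p` of the class to two points of the tube gives tubes that span with it a subspace of
dimension 7 containing all tubes with vertex `v`, and in this space the class of `p` and another
class would meet modulo the tube. -/
lemma exists_mem_sing_of_vertex (h : IsHVSystem X Y Ξ) (h2 : Thick (K := K) X Y)
    {ξ : Submodule K V} (hξ : ξ ∈ Ξ) {v : V} (ht : IsVTube X ξ v) {p : V} (hp : p ∈ X)
    (hvp : v ∈ rad (K := K) X Y p) : ∃ q ∈ X, q ∈ ξ ∧ q ∈ sing (K := K) X Y p := by
  have := h.finite
  obtain ⟨π, hπ, hle⟩ := h.exists_plane h2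
  by_contra! hno
  have hno' : ∀ q ∈ X, q ∈ sing (K := K) X Y p → q ∉ ξ := fun q hq hs hc => hno q hq hc hs
  obtain ⟨q₁, hq₁, hq₁ξ⟩ := ht.nonempty
  obtain ⟨q₂, hq₂, hq₂ξ, hq₁₂⟩ := ht.exists_notMem hq₁ hq₁ξ
  have hpξ : p ∉ ξ := hno' p hp (self_mem_sing p)
  have hv₁ := h.vertex_mem_rad hξ ht hq₁ hq₁ξ
  have hv₂ := h.vertex_mem_rad hξ ht hq₂ hq₂ξ
  obtain ⟨D₁, hD₁, hpD₁, hqD₁, tD₁⟩ :=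
    h.exists_join_of_rads hp hq₁ (hno q₁ hq₁ hq₁ξ) hvp hv₁ ht.ne_zero
  obtain ⟨D₂, hD₂, hpD₂, hqD₂, tD₂⟩ :=
    h.exists_join_of_rads hp hq₂ (hno q₂ hq₂ hq₂ξ) hvp hv₂ ht.ne_zero
  have hξD₁ : ξ ≠ D₁ := fun hc => hpξ (hc ▸ hpD₁)
  have hξD₂ : ξ ≠ D₂ := fun hc => hpξ (hc ▸ hpD₂)
  have hD₁₂ : D₁ ≠ D₂ := by
    rintro rfl
    exact hq₁₂ (h.mem_pair_of_mem_two hξ hD₁ hξD₁ ht hq₁ hq₁ξ hqD₁ hq₂ξ hqD₂)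
  have hpq₁ : p ∉ Submodule.span K {q₁, v} := fun hc => hpξ (pair_le hq₁ξ ht.mem hc)
  have hpq₂ : p ∉ Submodule.span K {q₂, v} := fun hc => hpξ (pair_le hq₂ξ ht.mem hc)
  obtain ⟨τ₁, hτ₁⟩ := tD₁.tangent q₁ hq₁ hqD₁
  obtain ⟨t₁, htτ₁, ht₁⟩ := hτ₁.exists_dir
  obtain ⟨τ₂, hτ₂⟩ := tD₂.tangent q₂ hq₂ hqD₂
  obtain ⟨t₂, htτ₂, ht₂⟩ := hτ₂.exists_dir
  -- `U` is the span of `ξ`, `D₁` and `D₂`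
  obtain ⟨U, hU⟩ : ∃ U, U = ξ ⊔ Submodule.span K {p} ⊔ Submodule.span K {t₁} ⊔
    Submodule.span K {t₂} := ⟨_, rfl⟩
  have hU7 : finrank K U ≤ 7 := by
    have a1 := finrank_sup_single_le ξ p
    have a2 := finrank_sup_single_le (ξ ⊔ Submodule.span K {p}) t₁
    have a3 := finrank_sup_single_le (ξ ⊔ Submodule.span K {p} ⊔ Submodule.span K {t₁}) t₂
    rw [hU]
    have := ht.rank
    omega
  have hξU : ξ ≤ U := by rw [hU]; exact le_sup_of_le_left (le_sup_of_le_left le_sup_left)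
  have hpU : p ∈ U := by
    rw [hU]
    exact Submodule.mem_sup_left (Submodule.mem_sup_left
      (Submodule.mem_sup_right (Submodule.mem_span_singleton_self p)))
  have ht₁U : t₁ ∈ U := by
    rw [hU]
    exact Submodule.mem_sup_left (Submodule.mem_sup_right (Submodule.mem_span_singleton_self _))
  have ht₂U : t₂ ∈ U := by
    rw [hU]
    exact Submodule.mem_sup_right (Submodule.mem_span_singleton_self _)
  have hD₁U : D₁ ≤ U := by
    rw [hτ₁.sup_eq tD₁ hpD₁ (hτ₁.notMem_of_notMem hp hpq₁),
      hτ₁.eq_sup tD₁ h.coneX hq₁ htτ₁ ht₁]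
    exact sup_le (sup_le (pair_le (hξU hq₁ξ) (hξU ht.mem)) (single_le ht₁U)) (single_le hpU)
  have hD₂U : D₂ ≤ U := by
    rw [hτ₂.sup_eq tD₂ hpD₂ (hτ₂.notMem_of_notMem hp hpq₂),
      hτ₂.eq_sup tD₂ h.coneX hq₂ htτ₂ ht₂]
    exact sup_le (sup_le (pair_le (hξU hq₂ξ) (hξU ht.mem)) (single_le ht₂U)) (single_le hpU)
  obtain ⟨r, hr, hrv⟩ := h.exists_ne (v := v) (h2 p hp)
  obtain ⟨s₀, hs₀, hs₀v⟩ := h.exists_ne (v := v) (h2 q₁ hq₁)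
  have hp' := h.add_rad_mem hp hr
  have hp's : p + r ∈ sing (K := K) X Y p :=
    Submodule.add_mem _ (self_mem_sing p) (rad_le_sing p hr)
  have hp'e := h.sing_eq hp hp' hp's
  have hp'r := h.rad_eq hp hp' hp's
  -- a tube `E` with vertex `v` through `p + r` and a point `q₁ + s`, but not through `q₂`
  obtain ⟨s, hs, hsv, E, hE, hpE, hqE, tE, hq₂E⟩ : ∃ s ∈ rad (K := K) X Y q₁,
      s ∉ Submodule.span K {v} ∧ ∃ E ∈ Ξ, p + r ∈ E ∧ q₁ + s ∈ E ∧ IsVTube X E v ∧ q₂ ∉ E := by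
    have hex : ∀ s ∈ rad (K := K) X Y q₁, ∃ E ∈ Ξ, p + r ∈ E ∧ q₁ + s ∈ E ∧ IsVTube X E v := by
      intro s hs
      have hq' := h.add_rad_mem hq₁ hs
      have hq's : q₁ + s ∈ sing (K := K) X Y q₁ :=
        Submodule.add_mem _ (self_mem_sing q₁) (rad_le_sing q₁ hs)
      refine h.exists_join_of_rads hp' hq' ?_ (hp'r ▸ hvp)
        ((h.rad_eq hq₁ hq' hq's).symm ▸ hv₁) ht.ne_zero
      intro hc
      refine hno q₁ hq₁ hq₁ξ ?_
      rw [hp'e] at hc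
      have := h.mem_sing_symm hq₁ hq' hq's
      rwa [h.sing_eq hp hq' hc] at this
    obtain ⟨c, hc0, hc1⟩ := h.card'
    obtain ⟨E, hE, a1, a2, a3⟩ := hex s₀ hs₀
    by_cases hqE : q₂ ∈ E
    · obtain ⟨F, hF, b1, b2, b3⟩ := hex (c • s₀) (Submodule.smul_mem _ c hs₀)
      refine ⟨c • s₀, Submodule.smul_mem _ c hs₀,
        fun hc => hs₀v ((Submodule.smul_mem_iff _ hc0).1 hc), F, hF, b1, b2, b3, fun hqF => ?_⟩
      obtain rfl := h.tube_unique hp' (hp'e ▸ hno q₂ hq₂ hq₂ξ) hE hF a1 b1 hqE hqF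
      have h1 := E.sub_mem b2 a2
      have e : q₁ + c • s₀ - (q₁ + s₀) = (c - 1) • s₀ := by match_scalars <;> noncomm_ring
      rw [e] at h1
      exact hs₀v (h.rad_inf_tube hE a3 hq₁ hs₀ ((E.smul_mem_iff (sub_ne_zero.2 hc1)).1 h1))
    · exact ⟨s₀, hs₀, hs₀v, E, hE, a1, a2, a3, hqE⟩
  obtain ⟨e₀, he₀, he₀E, he₀ξ⟩ := h.exists_common hE hξ tE ht.mem
  obtain ⟨e₁, he₁, he₁E, he₁D⟩ := h.exists_common hE hD₁ tE tD₁.mem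
  obtain ⟨e₂, he₂, he₂E, he₂D⟩ := h.exists_common hE hD₂ tE tD₂.mem
  have back : ∀ {a b : V}, a ∈ X → a ∈ Submodule.span K {b, v} → a ∈ E → b ∈ E := by
    intro a b ha hab haE
    have h1 := left_mem_pair (K := K) b v
    rw [← ht.pair_eq h.coneX ha hab] at h1
    exact pair_le haE tE.mem h1
  have n1 : e₁ ∉ Submodule.span K {e₀, v} := by
    intro hc
    have h1 := h.mem_pair_of_mem_two hξ hD₁ hξD₁ ht hq₁ hq₁ξ hqD₁
      (pair_le he₀ξ ht.mem hc) he₁D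
    have h3 := back he₁ h1 he₁E
    exact hsv (h.rad_inf_tube hE tE hq₁ hs ((E.add_mem_iff_right h3).1 hqE))
  have n2 : e₂ ∉ Submodule.span K {e₁, v} := by
    intro hc
    have h1 := h.mem_pair_of_mem_two hD₁ hD₂ hD₁₂ tD₁ hp hpD₁ hpD₂
      (pair_le he₁D tD₁.mem hc) he₂D
    have h3 := back he₂ h1 he₂E
    exact hrv (h.rad_inf_tube hE tE hp hr ((E.add_mem_iff_right h3).1 hpE))
  have n3 : e₂ ∉ Submodule.span K {e₀, v} := by
    intro hc
    have h1 := h.mem_pair_of_mem_two hξ hD₂ hξD₂ ht hq₂ hq₂ξ hqD₂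
      (pair_le he₀ξ ht.mem hc) he₂D
    exact hq₂E (back he₂ h1 he₂E)
  have hEU : E ≤ U := tE.le_of_three h.coneX he₀ he₀E he₁ he₁E n1 he₂ he₂E n3 n2
    (hξU ht.mem) (hξU he₀ξ) (hD₁U he₁D) (hD₂U he₂D)
  have hrU : r ∈ U := (U.add_mem_iff_right hpU).1 (hEU hpE)
  have hsU : s ∈ U := (U.add_mem_iff_right (hξU hq₁ξ)).1 (hEU hqE)
  have hπe := h.rad_sup_rad h2 hπ hle hp hq₁ (hno q₁ hq₁ hq₁ξ)
  have hπU : π ≤ U := by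
    rw [hπe, h.rad_eq_pair h2 hp hvp hr ht.ne_zero hrv,
      h.rad_eq_pair h2 hq₁ hv₁ hs ht.ne_zero hsv]
    exact sup_le (pair_le (hξU ht.mem) hrU) (pair_le (hξU ht.mem) hsU)
  -- no point of another class is congruent to a multiple of `p` modulo `ξ ⊔ π`
  have hmain : ∀ q ∈ X, q ∉ sing (K := K) X Y p → ∀ c : K, c ≠ 0 → q - c • p ∉ ξ ⊔ π := by
    intro q hq hqp c hc hm
    obtain ⟨x, hx, y, hy, hxy⟩ := Submodule.mem_sup.1 hm
    rw [h.rad_sup_rad h2 hπ hle hp hq hqp] at hy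
    obtain ⟨r₁, hr₁, r₂, hr₂, rfl⟩ := Submodule.mem_sup.1 hy
    have m1 := h.smul_add_rad_mem hp hr₁ hc
    have m1s : c • p + r₁ ∈ sing (K := K) X Y p := mem_sing.2 ⟨c, r₁, hr₁, rfl⟩
    have m2 := h.add_rad_mem hq (Submodule.neg_mem _ hr₂)
    have e : (c • p + r₁) - (q + -r₂) = -x := by
      rw [eq_sub_of_add_eq hxy]; abel
    refine hno' _ m1 m1s (h.mem_of_sub_mem m1 m2 ?_ hξ (by rw [e]; exact ξ.neg_mem hx)).1
    rw [h.sing_eq hp m1 m1s]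
    intro hc
    refine hqp (h.sing_eq hp m2 hc ▸ h.mem_sing_symm hq m2 ?_)
    exact Submodule.add_mem _ (self_mem_sing q) (rad_le_sing q (Submodule.neg_mem _ hr₂))
  have hpZ : p ∉ ξ ⊔ π := by
    intro hc
    refine hmain q₁ hq₁ (hno q₁ hq₁ hq₁ξ) 1 one_ne_zero ?_
    rw [one_smul]
    exact Submodule.sub_mem _ (Submodule.mem_sup_left hq₁ξ) hc
  have hUZ : U = ξ ⊔ π ⊔ Submodule.span K {p} := by
    refine (Submodule.eq_of_le_of_finrank_le (sup_le (sup_le hξU hπU) (single_le hpU)) ?_).symm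
    rw [Submodule.finrank_sup_span_singleton hpZ, h.finrank_tube_sup_plane h2 hπ hle hξ]
    exact hU7
  -- a point of `D₁` outside `ξ ⊔ π`
  obtain ⟨c, hc0, hcZ⟩ : ∃ c : K, c ≠ 0 ∧ p + c • t₁ ∉ ξ ⊔ π := by
    obtain ⟨k, hk0, hk1⟩ := h.card'
    by_cases h1 : p + t₁ ∈ ξ ⊔ π
    · refine ⟨k, hk0, fun h3 => hpZ ?_⟩
      have h4 : (k - 1) • t₁ ∈ ξ ⊔ π := by
        have e : (k - 1) • t₁ = (p + k • t₁) - (p + t₁) := by match_scalars <;> noncomm_ring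
        rw [e]; exact Submodule.sub_mem _ h3 h1
      exact (Submodule.add_mem_iff_left _
        ((Submodule.smul_mem_iff _ (sub_ne_zero.2 hk1)).1 h4)).1 h1
    · exact ⟨1, one_ne_zero, by rwa [one_smul]⟩
  obtain ⟨w, hw, hg, hgD, -, hgp⟩ := hτ₁.exists_lift hp hpD₁ hpq₁ (τ₁.smul_mem c htτ₁)
    (fun hm => ht₁ ((Submodule.smul_mem_iff _ hc0).1 hm))
  have hgs := h.notMem_sing_of_notMem_pair hD₁ tD₁ hp hpD₁ hgD hgp
  have hgU := hD₁U hgD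
  rw [hUZ] at hgU
  obtain ⟨d, hd⟩ := mem_sup_single.1 hgU
  have hwZ : w ∈ ξ ⊔ π := Submodule.mem_sup_left (pair_le hq₁ξ ht.mem hw)
  refine hmain _ hg hgs d ?_ hd
  rintro rfl
  rw [zero_smul, sub_zero] at hd
  exact hcZ ((Submodule.add_mem_iff_left _ hwZ).1 hd)

end IsHVSystem

end RadicalPlane

/-! ### Every line of the plane of the radicals is a radical -/

section AllLines

variable {K V : Type*} [DivisionRing K] [AddCommGroup V] [Module K V]

namespace IsHVSystem

variable {X Y : Set V} {Ξ : Set (Submodule K V)} {π ξ : Submodule K V} {v : V}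

/-- A tube `ξ` with vertex `v` in a thick system, with the plane `π` of the radicals. -/
structure IsPointed (X Y : Set V) (Ξ : Set (Submodule K V)) (π ξ : Submodule K V) (v : V) :
    Prop where
  sys : IsHVSystem X Y Ξ
  thick : Thick (K := K) X Y
  rank : finrank K π = 3
  le : ∀ x ∈ X, rad (K := K) X Y x ≤ π
  mem : ξ ∈ Ξ
  tube : IsVTube X ξ v

namespace IsPointed

lemma vertex_mem (h : IsPointed X Y Ξ π ξ v) : v ∈ π := by
  obtain ⟨a, ha, haξ⟩ := h.tube.nonempty
  exact h.le a ha (h.sys.vertex_mem_rad h.mem h.tube ha haξ)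

lemma plane_eq (h : IsPointed X Y Ξ π ξ v) {p : V} (hp : p ∈ X)
    (hv : v ∉ rad (K := K) X Y p) : π = rad (K := K) X Y p ⊔ Submodule.span K {v} := by
  have := h.sys.finite
  refine (Submodule.eq_of_le_of_finrank_eq (sup_le (h.le p hp) (single_le h.vertex_mem)) ?_).symm
  rw [Submodule.finrank_sup_span_singleton hv, h.sys.finrank_rad h.thick hp, h.rank]

/-- Modulo the radical of `p`, the subspace `ξ ⊔ π` is the tube `ξ`. -/
lemma exists_sub_mem (h : IsPointed X Y Ξ π ξ v) {p u : V} (hp : p ∈ X)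
    (hv : v ∉ rad (K := K) X Y p) (hu : u ∈ ξ ⊔ π) : ∃ r ∈ rad (K := K) X Y p, u - r ∈ ξ := by
  obtain ⟨x, hx, y, hy, rfl⟩ := Submodule.mem_sup.1 hu
  rw [h.plane_eq hp hv] at hy
  obtain ⟨r, hr, w, hw, rfl⟩ := Submodule.mem_sup.1 hy
  refine ⟨r, hr, ?_⟩
  have e : x + (r + w) - r = x + w := by abel
  rw [e]
  exact ξ.add_mem hx (single_le h.tube.mem hw)

lemma class_notMem (h : IsPointed X Y Ξ π ξ v) {p r : V} (hp : p ∈ X)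
    (hv : v ∉ rad (K := K) X Y p) (hr : r ∈ rad (K := K) X Y p) : p - r ∉ ξ := by
  intro hm
  have hr' := Submodule.neg_mem _ hr
  have h1 := h.sys.add_rad_mem hp hr'
  have h2 : p + -r ∈ sing (K := K) X Y p :=
    Submodule.add_mem _ (self_mem_sing p) (rad_le_sing p hr')
  have h3 := h.sys.vertex_mem_rad h.mem h.tube h1 (by rwa [← sub_eq_add_neg])
  rw [h.sys.rad_eq hp h1 h2] at h3
  exact hv h3

lemma notMem (h : IsPointed X Y Ξ π ξ v) {p : V} (hp : p ∈ X)
    (hv : v ∉ rad (K := K) X Y p) : p ∉ ξ ⊔ π := by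
  intro hm
  obtain ⟨r, hr, hx⟩ := h.exists_sub_mem hp hv hm
  exact h.class_notMem hp hv hr hx

/-- Points with radicals off `v` that agree modulo `ξ ⊔ π` belong to the same class. -/
lemma mem_sing_of_sub_mem (h : IsPointed X Y Ξ π ξ v) {p q : V} (hp : p ∈ X)
    (hv : v ∉ rad (K := K) X Y p) (hq : q ∈ X) (hm : p - q ∈ ξ ⊔ π) :
    q ∈ sing (K := K) X Y p := by
  obtain ⟨r, hr, hx⟩ := h.exists_sub_mem hp hv hm
  have hr' := Submodule.neg_mem _ hr
  have h1 := h.sys.add_rad_mem hp hr'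
  have h2 : p + -r ∈ sing (K := K) X Y p :=
    Submodule.add_mem _ (self_mem_sing p) (rad_le_sing p hr')
  rw [← h.sys.sing_eq hp h1 h2]
  by_contra hs
  have e : p + -r - q = p - q - r := by abel
  have h3 := (h.sys.mem_of_sub_mem h1 hq hs h.mem (by rw [e]; exact hx)).1
  rw [← sub_eq_add_neg] at h3
  exact h.class_notMem hp hv hr h3

lemma rad_off (h : IsPointed X Y Ξ π ξ v) {x p w g : V} (hx : x ∈ X) (hxξ : x ∈ ξ)
    (hv : v ∉ rad (K := K) X Y p) (hwp : w ∈ rad (K := K) X Y p)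
    (hwx : w ∈ rad (K := K) X Y x) (hw0 : w ≠ 0) (hg : g ∈ X)
    (hwg : w ∈ rad (K := K) X Y g) (hgx : g ∉ sing (K := K) X Y x) :
    v ∉ rad (K := K) X Y g := by
  intro hvg
  refine hgx (h.sys.mem_sing_of_rads hx hg hwx (h.sys.vertex_mem_rad h.mem h.tube hx hxξ) hwg
    hvg hw0 fun hc => hv (single_le hwp hc))

lemma notMem_sing (h : IsPointed X Y Ξ π ξ v) {x p : V} (hx : x ∈ X) (hxξ : x ∈ ξ)
    (hp : p ∈ X) (hv : v ∉ rad (K := K) X Y p) : p ∉ sing (K := K) X Y x := fun hc =>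
  hv ((h.sys.rad_eq hx hp hc).symm ▸ h.sys.vertex_mem_rad h.mem h.tube hx hxξ)

/-- For a point `x` of the tube `ξ`, the tangent planes at `x` of the tubes that join `x` to points
`p` with radical off `v` all have the same direction `t` modulo `ξ ⊔ π`: modulo `ξ ⊔ π`, the
subspace of the tangents at `x` is a point. -/
lemma exists_direction (h : IsPointed X Y Ξ π ξ v) {x : V} (hx : x ∈ X) (hxξ : x ∈ ξ) :
    ∃ t ∉ ξ ⊔ π, ∀ p ∈ X, v ∉ rad (K := K) X Y p → ∀ D ∈ Ξ, x ∈ D → p ∈ D →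
      D ≤ ξ ⊔ π ⊔ Submodule.span K {p} ⊔ Submodule.span K {t} ∧
      ∀ c : K, ∃ g ∈ X, g ∈ D ∧ v ∉ rad (K := K) X Y g ∧ g - (p + c • t) ∈ ξ ⊔ π := by
  have := h.sys.finite
  have hξZ : ξ ≤ ξ ⊔ π := le_sup_left
  have hvx := h.sys.vertex_mem_rad h.mem h.tube hx hxξ
  have hxZ : sing (K := K) X Y x ≤ ξ ⊔ π :=
    sup_le (single_le (hξZ hxξ)) ((h.le x hx).trans le_sup_right)
  have key : ∀ p ∈ X, v ∉ rad (K := K) X Y p → ∀ D ∈ Ξ, x ∈ D → p ∈ D →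
      ∃ w τ t, IsVTube X D w ∧ IsTangentAt X D w x τ ∧ t ∈ τ ∧ t ∉ ξ ⊔ π ∧
        p ∉ Submodule.span K {x, w} := by
    intro p hp hv D hD hxD hpD
    obtain ⟨w, hw, tD⟩ := h.sys.tube D hD
    obtain ⟨τ, hτ⟩ := tD.tangent x hx hxD
    obtain ⟨t, ht, htx⟩ := hτ.exists_dir
    have hpx := h.notMem_sing hx hxξ hp hv
    have hpxw : p ∉ Submodule.span K {x, w} := fun hc => hpx (h.sys.pair_le_sing hD tD hx hxD hc)
    obtain ⟨s, hs, hg, hgD, hgτ, hgp⟩ := hτ.exists_lift hp hpD hpxw ht htx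
    have hgx := h.sys.notMem_sing_of_notMem_pair hD tD hx hxD hgD fun hm => hgτ (hτ.pair_le hm)
    have hvg := h.rad_off hx hxξ hv (h.sys.vertex_mem_rad hD tD hp hpD)
      (h.sys.vertex_mem_rad hD tD hx hxD) tD.ne_zero hg (h.sys.vertex_mem_rad hD tD hg hgD) hgx
    refine ⟨w, τ, t, tD, hτ, ht, fun hc => ?_, hpxw⟩
    have h1 : p - (p + t + s) ∈ ξ ⊔ π := by
      have e : p - (p + t + s) = -(t + s) := by abel
      rw [e]
      exact Submodule.neg_mem _ (Submodule.add_mem _ hc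
        (hxZ (h.sys.pair_le_sing hD tD hx hxD hs)))
    exact hgp (h.sys.mem_pair_of_sing hD tD hp hpD hgD (h.mem_sing_of_sub_mem hp hv hg h1))
  obtain ⟨T, hT5, hT⟩ := h.sys.exists_tan hx
  obtain ⟨τξ, hτξ⟩ := h.tube.tangent x hx hxξ
  obtain ⟨tξ, htξ, htξx⟩ := hτξ.exists_dir
  have hTz : ∀ t ∈ T, t ∉ ξ ⊔ π → T ≤ ξ ⊔ π ⊔ Submodule.span K {t} := by
    intro t htT htZ
    have h1 : sing (K := K) X Y x ⊔ Submodule.span K {tξ} ≤ ξ ⊔ π :=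
      sup_le hxZ (single_le (hξZ (hτξ.le htξ)))
    have h2 : T = sing (K := K) X Y x ⊔ Submodule.span K {tξ} ⊔ Submodule.span K {t} := by
      refine (Submodule.eq_of_le_of_finrank_le (sup_le (sup_le (h.sys.sing_le_tan hx hT)
        (single_le (hT ξ h.mem hxξ v τξ h.tube hτξ htξ))) (single_le htT)) ?_).symm
      rw [Submodule.finrank_sup_span_singleton fun hc => htZ (h1 hc),
        Submodule.finrank_sup_span_singleton (h.sys.dir_notMem_sing h.mem h.tube hx hxξ hτξ htξ
          htξx), h.sys.finrank_sing hx, h.sys.finrank_rad h.thick hx, hT5]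
    rw [h2]
    exact sup_le_sup_right h1 _
  obtain ⟨p₀, hp₀, hv₀⟩ := h.sys.exists_notMem_rad h.thick h.tube.ne_zero
  obtain ⟨D₀, hD₀, hxD₀, hpD₀⟩ := h.sys.join x hx p₀ hp₀
  obtain ⟨w₀, τ₀, t₀, tD₀, hτ₀, ht₀, ht₀Z, -⟩ := key p₀ hp₀ hv₀ D₀ hD₀ hxD₀ hpD₀
  have hT₀ := hTz t₀ (hT D₀ hD₀ hxD₀ w₀ τ₀ tD₀ hτ₀ ht₀) ht₀Z
  refine ⟨t₀, ht₀Z, fun p hp hv D hD hxD hpD => ?_⟩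
  obtain ⟨w, τ, t, tD, hτ, ht, htZ, hpx⟩ := key p hp hv D hD hxD hpD
  have hτT := hT D hD hxD w τ tD hτ
  constructor
  · rw [hτ.sup_eq tD hpD (hτ.notMem_of_notMem hp hpx)]
    refine sup_le (hτT.trans (hT₀.trans ?_)) ?_
    · exact sup_le_sup_right le_sup_left _
    · exact le_sup_of_le_left le_sup_right
  · intro c
    obtain ⟨d, hd⟩ := mem_sup_single.1 (hT₀ (hτT ht))
    have hd0 : d ≠ 0 := by rintro rfl; exact htZ (by simpa using hd)
    have hgc : p + (c * d⁻¹) • t ∉ τ := fun hc =>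
      hτ.notMem_of_notMem hp hpx ((τ.add_mem_iff_left (τ.smul_mem _ ht)).1 hc)
    obtain ⟨s, hs, hg⟩ := hτ.lift _ (D.add_mem hpD (D.smul_mem _ (hτ.le ht))) hgc
    have hsD := hτ.le (hτ.pair_le hs)
    have hgD := D.add_mem (D.add_mem hpD (D.smul_mem (c * d⁻¹) (hτ.le ht))) hsD
    refine ⟨_, hg, hgD, ?_, ?_⟩
    · refine h.rad_off hx hxξ hv (h.sys.vertex_mem_rad hD tD hp hpD)
        (h.sys.vertex_mem_rad hD tD hx hxD) tD.ne_zero hg (h.sys.vertex_mem_rad hD tD hg hgD) ?_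
      refine h.sys.notMem_sing_of_notMem_pair hD tD hx hxD hgD fun hm => hgc ?_
      exact (τ.add_mem_iff_left (hτ.pair_le hs)).1 (hτ.pair_le hm)
    · have e : p + (c * d⁻¹) • t + s - (p + c • t₀) = (c * d⁻¹) • (t - d • t₀) + s := by
        rw [smul_sub, smul_smul, mul_assoc, inv_mul_cancel₀ hd0, mul_one]; abel
      rw [e]
      exact Submodule.add_mem _ (Submodule.smul_mem _ _ hd)
        (hxZ (h.sys.pair_le_sing hD tD hx hxD hs))

/-- `t` is the direction at `x`, in the sense of `exists_direction`. -/
structure IsDirection (X Y : Set V) (Ξ : Set (Submodule K V)) (π ξ : Submodule K V) (v x t : V) :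
    Prop where
  base : x ∈ X
  mem : x ∈ ξ
  off : t ∉ ξ ⊔ π
  le : ∀ p ∈ X, v ∉ rad (K := K) X Y p → ∀ D ∈ Ξ, x ∈ D → p ∈ D →
    D ≤ ξ ⊔ π ⊔ Submodule.span K {p} ⊔ Submodule.span K {t}
  lift : ∀ p ∈ X, v ∉ rad (K := K) X Y p → ∀ D ∈ Ξ, x ∈ D → p ∈ D →
    ∀ c : K, ∃ g ∈ X, g ∈ D ∧ v ∉ rad (K := K) X Y g ∧ g - (p + c • t) ∈ ξ ⊔ π

lemma exists_isDirection (h : IsPointed X Y Ξ π ξ v) {x : V} (hx : x ∈ X) (hxξ : x ∈ ξ) :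
    ∃ t, IsDirection X Y Ξ π ξ v x t := by
  obtain ⟨t, ht, h'⟩ := h.exists_direction hx hxξ
  exact ⟨t, hx, hxξ, ht, fun p hp hv D hD hxD hpD => (h' p hp hv D hD hxD hpD).1,
    fun p hp hv D hD hxD hpD => (h' p hp hv D hD hxD hpD).2⟩

lemma IsDirection.notMem {x t : V} (ht : IsDirection X Y Ξ π ξ v x t)
    (h : IsPointed X Y Ξ π ξ v) {p : V} (hp : p ∈ X) (hv : v ∉ rad (K := K) X Y p) :
    p ∉ ξ ⊔ π ⊔ Submodule.span K {t} := by
  intro hm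
  obtain ⟨c, hc⟩ := mem_sup_single.1 hm
  obtain ⟨D, hD, hxD, hpD⟩ := h.sys.join x ht.base p hp
  obtain ⟨g, hg, -, hvg, hgc⟩ := ht.lift p hp hv D hD hxD hpD (-c)
  refine h.notMem hg hvg ?_
  have e : g = (g - (p + (-c) • t)) + (p - c • t) := by rw [neg_smul]; abel
  rw [e]
  exact Submodule.add_mem _ hgc hc

lemma IsDirection.dir_notMem {x t : V} (ht : IsDirection X Y Ξ π ξ v x t)
    (h : IsPointed X Y Ξ π ξ v) {p : V} (hp : p ∈ X) (hv : v ∉ rad (K := K) X Y p) :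
    t ∉ ξ ⊔ π ⊔ Submodule.span K {p} := by
  intro hm
  obtain ⟨c, hc⟩ := mem_sup_single.1 hm
  by_cases hc0 : c = 0
  · subst hc0; exact ht.off (by simpa using hc)
  · refine ht.notMem h hp hv (mem_sup_single.2 ⟨c⁻¹, ?_⟩)
    have e : p - c⁻¹ • t = (-c⁻¹) • (t - c • p) := by
      rw [smul_sub, smul_smul, neg_mul, inv_mul_cancel₀ hc0, neg_smul, neg_smul, one_smul]; abel
    rw [e]
    exact Submodule.smul_mem _ _ hc

variable {x₁ x₂ t₁ t₂ : V}

/-- The lines joining a point to the points of two generators of `ξ` are different modulo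
`ξ ⊔ π`. -/
lemma directions_distinct (h : IsPointed X Y Ξ π ξ v) (d₁ : IsDirection X Y Ξ π ξ v x₁ t₁)
    (d₂ : IsDirection X Y Ξ π ξ v x₂ t₂) (hx : x₂ ∉ sing (K := K) X Y x₁) {p : V} (hp : p ∈ X)
    (hv : v ∉ rad (K := K) X Y p) {k l m : K} (hl : l ≠ 0) (hk : k ≠ 0)
    (hm : k • (p + l • t₁) - (p + m • t₂) ∈ ξ ⊔ π) : False := by
  obtain ⟨D₁, hD₁, hx₁D, hpD₁, w₁, hw₁, tD₁, hwx₁, hwp₁⟩ := h.sys.exists_join d₁.base hp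
  obtain ⟨D₂, hD₂, hx₂D, hpD₂, w₂, hw₂, tD₂, hwx₂, hwp₂⟩ := h.sys.exists_join d₂.base hp
  obtain ⟨g₁, hg₁, hgD₁, hvg₁, hgc₁⟩ := d₁.lift p hp hv D₁ hD₁ hx₁D hpD₁ l
  obtain ⟨g₂, hg₂, hgD₂, hvg₂, hgc₂⟩ := d₂.lift p hp hv D₂ hD₂ hx₂D hpD₂ m
  have hkg := h.sys.coneX.smul_mem k hk g₁ hg₁
  have hkr : rad (K := K) X Y (k • g₁) = rad X Y g₁ :=
    h.sys.rad_eq hg₁ hkg (Submodule.smul_mem _ k (self_mem_sing g₁))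
  have h1 : g₂ ∈ sing (K := K) X Y (k • g₁) := by
    refine h.mem_sing_of_sub_mem hkg (hkr ▸ hvg₁) hg₂ ?_
    have e : k • g₁ - g₂ = k • (g₁ - (p + l • t₁)) + (k • (p + l • t₁) - (p + m • t₂)) -
        (g₂ - (p + m • t₂)) := by rw [smul_sub]; abel
    rw [e]
    exact Submodule.sub_mem _ (Submodule.add_mem _ (Submodule.smul_mem _ _ hgc₁) hm) hgc₂
  have h2 : w₂ ∈ rad (K := K) X Y g₁ := by
    rw [← hkr, ← h.sys.rad_eq hkg hg₂ h1]
    exact h.sys.vertex_mem_rad hD₂ tD₂ hg₂ hgD₂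
  have h3 : w₂ ∉ Submodule.span K {w₁} := by
    intro hc
    have h4 := single_comm tD₂.ne_zero hc
    have h5 := h.sys.mem_vertex_of_rads d₁.base d₂.base hx h.mem h.tube d₁.mem d₂.mem hwx₁
      (single_le hwx₂ h4)
    exact hv (single_le hwp₁ (single_comm tD₁.ne_zero h5))
  have h6 := h.sys.mem_sing_of_rads hp hg₁ hwp₁ hwp₂ (h.sys.vertex_mem_rad hD₁ tD₁ hg₁ hgD₁) h2
    tD₁.ne_zero h3
  obtain ⟨a, r, hr, hgr⟩ := mem_sing.1 h6
  have hrZ : r ∈ ξ ⊔ π := Submodule.mem_sup_right (h.le p hp hr)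
  refine d₁.dir_notMem h hp hv ((Submodule.smul_mem_iff _ hl).1 (mem_sup_single.2 ⟨a - 1, ?_⟩))
  have e : l • t₁ - (a - 1) • p = r - (g₁ - (p + l • t₁)) := by
    rw [hgr, sub_smul, one_smul]; abel
  rw [e]
  exact Submodule.sub_mem _ hrZ hgc₁

lemma directions_indep (h : IsPointed X Y Ξ π ξ v) (d₁ : IsDirection X Y Ξ π ξ v x₁ t₁)
    (d₂ : IsDirection X Y Ξ π ξ v x₂ t₂) (hx : x₂ ∉ sing (K := K) X Y x₁) {p : V} (hp : p ∈ X)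
    (hv : v ∉ rad (K := K) X Y p) :
    t₂ ∉ ξ ⊔ π ⊔ Submodule.span K {p} ⊔ Submodule.span K {t₁} := by
  intro hm
  obtain ⟨c, hc⟩ := mem_sup_single.1 hm
  obtain ⟨a, ha⟩ := mem_sup_single.1 hc
  have hc0 : c ≠ 0 := by
    rintro rfl
    exact d₂.dir_notMem h hp hv (by simpa using hc)
  obtain ⟨m, hm0, hma⟩ := h.sys.card (-a⁻¹)
  have hk : 1 + m * a ≠ 0 := by
    intro h0
    have ha0 : a ≠ 0 := by rintro rfl; simp at h0
    apply hma
    rw [eq_neg_iff_add_eq_zero]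
    have : (1 + m * a) * a⁻¹ = 0 := by rw [h0, zero_mul]
    rw [add_mul, mul_assoc, mul_inv_cancel₀ ha0, mul_one, one_mul] at this
    rwa [add_comm]
  have hl : (1 + m * a)⁻¹ * (m * c) ≠ 0 :=
    mul_ne_zero (inv_ne_zero hk) (mul_ne_zero hm0 hc0)
  refine h.directions_distinct d₁ d₂ hx hp hv (m := m) hl hk ?_
  have e : (1 + m * a) • (p + ((1 + m * a)⁻¹ * (m * c)) • t₁) - (p + m • t₂) =
      (-m) • (t₂ - c • t₁ - a • p) := by
    rw [smul_add, smul_smul, mul_inv_cancel_left₀ hk]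
    match_scalars <;> noncomm_ring
  rw [e]
  exact Submodule.smul_mem _ _ ha

/-- The tangent plane at `p` of the tube joining `p` to `x` determines the direction at `x`. -/
lemma exists_tangent_dir (h : IsPointed X Y Ξ π ξ v) {x t : V} (d : IsDirection X Y Ξ π ξ v x t)
    {p : V} (hp : p ∈ X) (hv : v ∉ rad (K := K) X Y p) {D : Submodule K V} (hD : D ∈ Ξ)
    (hxD : x ∈ D) (hpD : p ∈ D) {w : V} (tD : IsVTube X D w) {τ : Submodule K V}
    (hτ : IsTangentAt X D w p τ) :
    ∃ t' ∈ τ, ∃ a c : K, c ≠ 0 ∧ t' - c • t - a • p ∈ ξ ⊔ π := by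
  have := h.sys.finite
  obtain ⟨t', ht', ht'Z⟩ : ∃ t' ∈ τ, t' ∉ ξ ⊔ π ⊔ Submodule.span K {p} := by
    by_contra! hc
    have hxp : x ∉ Submodule.span K {p, w} := by
      intro hm
      have h1 := h.sys.pair_le_sing hD tD hp hpD hm
      exact h.notMem_sing d.base d.mem hp hv (h.sys.mem_sing_symm hp d.base h1)
    have hDZ : D ≤ ξ ⊔ π ⊔ Submodule.span K {p} := by
      rw [hτ.sup_eq tD hxD (hτ.notMem_of_notMem d.base hxp)]
      exact sup_le hc (single_le (Submodule.mem_sup_left (Submodule.mem_sup_left d.mem)))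
    obtain ⟨g, hg, hgD, -, hgc⟩ := d.lift p hp hv D hD hxD hpD 1
    refine d.dir_notMem h hp hv ?_
    have e : t = g - (g - (p + (1 : K) • t)) - p := by rw [one_smul]; abel
    rw [e]
    exact Submodule.sub_mem _ (Submodule.sub_mem _ (hDZ hgD) (Submodule.mem_sup_left hgc))
      (Submodule.mem_sup_right (Submodule.mem_span_singleton_self p))
  obtain ⟨c, hc⟩ := mem_sup_single.1 (d.le p hp hv D hD hxD hpD (hτ.le ht'))
  obtain ⟨a, ha⟩ := mem_sup_single.1 hc
  refine ⟨t', ht', a, c, ?_, ha⟩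
  rintro rfl
  exact ht'Z (by simpa using hc)

/-- The subspace of the tangents at a point `p` with radical off `v`, modulo `ξ ⊔ π`. -/
lemma exists_tangents (h : IsPointed X Y Ξ π ξ v) (d₁ : IsDirection X Y Ξ π ξ v x₁ t₁)
    (d₂ : IsDirection X Y Ξ π ξ v x₂ t₂) (hx : x₂ ∉ sing (K := K) X Y x₁) {p : V} (hp : p ∈ X)
    (hv : v ∉ rad (K := K) X Y p) :
    ∃ T : Submodule K V, (∀ D ∈ Ξ, p ∈ D → ∀ w τ, IsVTube X D w → IsTangentAt X D w p τ →
        τ ≤ T) ∧ sing (K := K) X Y p ≤ T ∧ (∀ u ∈ T, u ∈ ξ ⊔ π → u ∈ rad (K := K) X Y p) ∧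
      T ≤ ξ ⊔ π ⊔ Submodule.span K {p} ⊔ Submodule.span K {t₁} ⊔ Submodule.span K {t₂} := by
  have := h.sys.finite
  obtain ⟨T, hT5, hT⟩ := h.sys.exists_tan hp
  have hsT := h.sys.sing_le_tan hp hT
  have hdir : ∀ x t, IsDirection X Y Ξ π ξ v x t → t ∈ T ⊔ (ξ ⊔ π) := by
    intro x t d
    obtain ⟨D, hD, hxD, hpD, w, hw, tD, hwx, hwp⟩ := h.sys.exists_join d.base hp
    obtain ⟨τ, hτ⟩ := tD.tangent p hp hpD
    obtain ⟨t', ht', a, c, hc, hZ⟩ := h.exists_tangent_dir d hp hv hD hxD hpD tD hτ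
    refine (Submodule.smul_mem_iff _ hc).1 ?_
    have e : c • t = t' - a • p - (t' - c • t - a • p) := by abel
    rw [e]
    exact Submodule.sub_mem _ (Submodule.mem_sup_left (T.sub_mem (hT D hD hpD w τ tD hτ ht')
      (T.smul_mem a (hsT (self_mem_sing p))))) (Submodule.mem_sup_right hZ)
  have hBT : ξ ⊔ π ⊔ Submodule.span K {p} ⊔ Submodule.span K {t₁} ⊔ Submodule.span K {t₂} ≤
      T ⊔ (ξ ⊔ π) :=
    sup_le (sup_le (sup_le le_sup_right
      (single_le (Submodule.mem_sup_left (hsT (self_mem_sing p)))))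
      (single_le (hdir _ _ d₁))) (single_le (hdir _ _ d₂))
  have hB9 : finrank K (ξ ⊔ π ⊔ Submodule.span K {p} ⊔ Submodule.span K {t₁} ⊔
      Submodule.span K {t₂} : Submodule K V) = 9 := by
    rw [Submodule.finrank_sup_span_singleton (h.directions_indep d₁ d₂ hx hp hv),
      Submodule.finrank_sup_span_singleton (d₁.dir_notMem h hp hv),
      Submodule.finrank_sup_span_singleton (h.notMem hp hv),
      h.sys.finrank_tube_sup_plane h.thick h.rank h.le h.mem]
  have hle : rad (K := K) X Y p ≤ T ⊓ (ξ ⊔ π) :=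
    le_inf ((rad_le_sing p).trans hsT) ((h.le p hp).trans le_sup_right)
  have e1 := Submodule.finrank_sup_add_finrank_inf_eq T (ξ ⊔ π)
  have e2 := Submodule.finrank_mono hle
  have e3 := Submodule.finrank_mono hBT
  rw [hT5, h.sys.finrank_tube_sup_plane h.thick h.rank h.le h.mem] at e1
  rw [h.sys.finrank_rad h.thick hp] at e2
  rw [hB9] at e3
  refine ⟨T, hT, hsT, ?_, ?_⟩
  · intro u hu hu'
    have e4 : rad (K := K) X Y p = T ⊓ (ξ ⊔ π) :=
      Submodule.eq_of_le_of_finrank_le hle (by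
        rw [h.sys.finrank_rad h.thick hp]; omega)
    rw [e4]; exact ⟨hu, hu'⟩
  · have e5 := Submodule.eq_of_le_of_finrank_le hBT (by rw [hB9]; omega)
    rw [e5]; exact le_sup_left

/-- If `f` agrees with `p + l` modulo `ξ ⊔ π`, where `l` is a combination of two directions, then
the tube joining `p` and `f` meets a class of `ξ`: it would otherwise agree with the plane
`⟨p, t₁, t₂⟩` modulo `ξ ⊔ π` and share two classes with a tube joining `p` to `ξ`. -/
lemma exists_class_of_mem (h : IsPointed X Y Ξ π ξ v) (d₁ : IsDirection X Y Ξ π ξ v x₁ t₁)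
    (d₂ : IsDirection X Y Ξ π ξ v x₂ t₂) (hx : x₂ ∉ sing (K := K) X Y x₁) {p f : V} (hp : p ∈ X)
    (hv : v ∉ rad (K := K) X Y p) (hf : f ∈ X) {a b : K}
    (hfp : f - (p + a • t₁ + b • t₂) ∈ ξ ⊔ π) (hfs : f ∉ sing (K := K) X Y p) :
    ∃ u ≠ 0, u ∈ rad (K := K) X Y p ∧ u ∈ rad (K := K) X Y f ∧
      ∃ x ∈ X, v ∈ rad (K := K) X Y x ∧ u ∈ rad (K := K) X Y x := by
  have := h.sys.finite
  obtain ⟨D, hD, hpD, hfD, u, hu, tD, hup, huf⟩ := h.sys.exists_join hp hf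
  refine ⟨u, tD.ne_zero, hup, huf, ?_⟩
  by_contra! hmiss
  have hoff : ∀ g ∈ X, g ∈ D → v ∉ rad (K := K) X Y g := fun g hg hgD hc =>
    hmiss g hg hc (h.sys.vertex_mem_rad hD tD hg hgD)
  obtain ⟨T, hT, hsT, hTZ, hTB⟩ := h.exists_tangents d₁ d₂ hx hp hv
  obtain ⟨τ, hτ⟩ := tD.tangent p hp hpD
  have hτT := hT D hD hpD u τ tD hτ
  have huZ : u ∈ ξ ⊔ π := Submodule.mem_sup_right (h.le p hp hup)
  have hfτ : f ∉ τ := fun hc => hfs (h.sys.pair_le_sing hD tD hp hpD (hτ.only f hf hc))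
  -- a point of `D` congruent to a multiple of `p` is on the generator of `p`
  have hDp : ∀ g ∈ X, g ∈ D → ∀ c : K, g - c • p ∈ ξ ⊔ π → g ∈ Submodule.span K {p, u} := by
    intro g hg hgD c hc
    have hc0 : c ≠ 0 := by
      rintro rfl
      exact h.notMem hg (hoff g hg hgD) (by simpa using hc)
    have hcp := h.sys.coneX.smul_mem c hc0 p hp
    have h1 := h.mem_sing_of_sub_mem hg (hoff g hg hgD) hcp hc
    have h2 := h.sys.mem_sing_symm hg hp ((Submodule.smul_mem_iff _ hc0).1 h1)
    exact h.sys.mem_pair_of_sing hD tD hp hpD hgD h2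
  have hDZ : ∀ d ∈ D, d ∈ ξ ⊔ π → d ∈ Submodule.span K {u} := by
    intro d hd hdZ
    by_cases hdτ : d ∈ τ
    · exact h.sys.rad_inf_tube hD tD hp (hTZ d (hτT hdτ) hdZ) hd
    · exfalso
      obtain ⟨s, hs, hg⟩ := hτ.lift d hd hdτ
      obtain ⟨α, β, rfl⟩ := mem_pair.1 hs
      have h1 := hDp _ hg (D.add_mem hd (hτ.le (hτ.pair_le hs))) α (by
        have e : d + (α • p + β • u) - α • p = d + β • u := by abel
        rw [e]
        exact Submodule.add_mem _ hdZ (Submodule.smul_mem _ β huZ))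
      exact hdτ (hτ.pair_le ((Submodule.add_mem_iff_left _ hs).1 h1))
  have hDB : D ⊔ (ξ ⊔ π) = ξ ⊔ π ⊔ Submodule.span K {p} ⊔ Submodule.span K {t₁} ⊔
      Submodule.span K {t₂} := by
    refine Submodule.eq_of_le_of_finrank_le (sup_le ?_ (le_sup_of_le_left
      (le_sup_of_le_left le_sup_left))) ?_
    · rw [hτ.sup_eq tD hfD hfτ]
      refine sup_le (hτT.trans hTB) (single_le ?_)
      refine mem_sup_single.2 ⟨b, mem_sup_single.2 ⟨a, mem_sup_single.2 ⟨1, ?_⟩⟩⟩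
      have e : f - b • t₂ - a • t₁ - (1 : K) • p = f - (p + a • t₁ + b • t₂) := by
        rw [one_smul]; abel
      rw [e]; exact hfp
    · have e1 := Submodule.finrank_sup_add_finrank_inf_eq D (ξ ⊔ π)
      have e2 : finrank K (D ⊓ (ξ ⊔ π) : Submodule K V) ≤ 1 :=
        (Submodule.finrank_mono (show D ⊓ (ξ ⊔ π) ≤ Submodule.span K {u} from
          fun d hd => hDZ d hd.1 hd.2)).trans (finrank_single_le u)
      rw [tD.rank, h.sys.finrank_tube_sup_plane h.thick h.rank h.le h.mem] at e1
      rw [Submodule.finrank_sup_span_singleton (h.directions_indep d₁ d₂ hx hp hv),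
        Submodule.finrank_sup_span_singleton (d₁.dir_notMem h hp hv),
        Submodule.finrank_sup_span_singleton (h.notMem hp hv),
        h.sys.finrank_tube_sup_plane h.thick h.rank h.le h.mem]
      omega
  have hdD : ∀ t ∈ D ⊔ (ξ ⊔ π), ∃ d ∈ D, t - d ∈ ξ ⊔ π := by
    intro t ht
    obtain ⟨d, hd, z, hz, rfl⟩ := Submodule.mem_sup.1 ht
    exact ⟨d, hd, by simpa using hz⟩
  -- a vector of `D` congruent to a direction is tangent at `p`
  have hdir : ∀ x t d, IsDirection X Y Ξ π ξ v x t → d ∈ D → t - d ∈ ξ ⊔ π → d ∈ τ := by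
    intro x t d hd hdD htd
    by_contra hdτ
    obtain ⟨s, hs, hg⟩ := hτ.lift d hdD hdτ
    have hgD := D.add_mem hdD (hτ.le (hτ.pair_le hs))
    have hgp : d + s ∉ Submodule.span K {p, u} := fun hc =>
      hdτ (hτ.pair_le ((Submodule.add_mem_iff_left _ hs).1 hc))
    have hvg := hoff _ hg hgD
    obtain ⟨α, β, rfl⟩ := mem_pair.1 hs
    have hα : α ≠ 0 := by
      rintro rfl
      refine hd.notMem h hg hvg (mem_sup_single.2 ⟨1, ?_⟩)
      have e : d + ((0 : K) • p + β • u) - (1 : K) • t = β • u - (t - d) := by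
        rw [zero_smul, one_smul]; abel
      rw [e]
      exact Submodule.sub_mem _ (Submodule.smul_mem _ β huZ) htd
    obtain ⟨E, hE, hxE, hpE, w, hw, tE, hwx, hwp⟩ := h.sys.exists_join hd.base hp
    obtain ⟨g', hg', hgE', hvg', hgc'⟩ := hd.lift p hp hv E hE hxE hpE α⁻¹
    have hag := h.sys.coneX.smul_mem α hα g' hg'
    have h1 : α • g' ∈ sing (K := K) X Y (d + (α • p + β • u)) := by
      refine h.mem_sing_of_sub_mem hg hvg hag ?_
      have e : d + (α • p + β • u) - α • g' =
          β • u - (t - d) - α • (g' - (p + α⁻¹ • t)) := by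
        rw [smul_sub, smul_add, smul_inv_smul₀ hα]; abel
      rw [e]
      exact Submodule.sub_mem _ (Submodule.sub_mem _ (Submodule.smul_mem _ β huZ) htd)
        (Submodule.smul_mem _ _ hgc')
    have h2 := (Submodule.smul_mem_iff _ hα).1 h1
    have hwg : w ∈ rad (K := K) X Y (d + (α • p + β • u)) := by
      rw [← h.sys.rad_eq hg hg' h2]
      exact h.sys.vertex_mem_rad hE tE hg' hgE'
    refine hgp (h.sys.mem_pair_of_sing hD tD hp hpD hgD (h.sys.mem_sing_of_rads hp hg hup hwp
      (h.sys.vertex_mem_rad hD tD hg hgD) hwg tD.ne_zero fun hc => ?_))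
    exact hmiss x hd.base (h.sys.vertex_mem_rad h.mem h.tube hd.base hd.mem)
      (single_le hwx (single_comm tE.ne_zero hc))
  obtain ⟨e₁, he₁, hz₁⟩ := hdD t₁ (hDB ▸ Submodule.mem_sup_left
    (Submodule.mem_sup_right (Submodule.mem_span_singleton_self _)))
  obtain ⟨e₂, he₂, hz₂⟩ := hdD t₂ (hDB ▸
    Submodule.mem_sup_right (Submodule.mem_span_singleton_self _))
  have k₁ := hdir x₁ t₁ e₁ d₁ he₁ hz₁
  have k₂ := hdir x₂ t₂ e₂ d₂ he₂ hz₂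
  have k₃ : p + a • e₁ + b • e₂ ∈ τ :=
    τ.add_mem (τ.add_mem hτ.base (τ.smul_mem a k₁)) (τ.smul_mem b k₂)
  have k₄ := hDZ (f - (p + a • e₁ + b • e₂)) (D.sub_mem hfD (hτ.le k₃)) (by
    have e : f - (p + a • e₁ + b • e₂) =
        f - (p + a • t₁ + b • t₂) + a • (t₁ - e₁) + b • (t₂ - e₂) := by
      rw [smul_sub, smul_sub]; abel
    rw [e]
    exact Submodule.add_mem _ (Submodule.add_mem _ hfp (Submodule.smul_mem _ _ hz₁))
      (Submodule.smul_mem _ _ hz₂))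
  exact hfτ ((Submodule.sub_mem_iff_left _ k₃).1 (single_le hτ.vertex k₄))

/-- Every line of the plane `π` through the vertex of a tube is the radical of a point. -/
lemma exists_rad_eq (h : IsPointed X Y Ξ π ξ v) {M : Submodule K V} (hM : M ≤ π)
    (hM2 : finrank K M = 2) (hvM : v ∈ M) : ∃ x ∈ X, rad (K := K) X Y x = M := by
  have := h.sys.finite
  by_contra! hno
  obtain ⟨x₁, hx₁, hx₁ξ⟩ := h.tube.nonempty
  obtain ⟨x₂, hx₂, hx₂ξ, hx₁₂⟩ := h.tube.exists_notMem hx₁ hx₁ξ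
  have hx := h.sys.notMem_sing_of_notMem_pair h.mem h.tube hx₁ hx₁ξ hx₂ξ hx₁₂
  obtain ⟨t₁, d₁⟩ := h.exists_isDirection hx₁ hx₁ξ
  obtain ⟨t₂, d₂⟩ := h.exists_isDirection hx₂ hx₂ξ
  obtain ⟨p, hp, hv⟩ := h.sys.exists_notMem_rad h.thick h.tube.ne_zero
  -- `w` is the intersection of `M` with `rad p`; the tube `D` below through `p` has this vertex
  obtain ⟨w, hwp, hwM, hw0⟩ := h.sys.exists_rad_mem h.thick h.rank h.le hp hM hM2.ge
  have hwv : w ∉ Submodule.span K {v} := fun hc => hv (single_le hwp (single_comm hw0 hc))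
  have hMe := eq_pair_of_finrank hM2 hvM hwM h.tube.ne_zero hwv
  have hmiss : ∀ x ∈ X, v ∈ rad (K := K) X Y x → w ∉ rad (K := K) X Y x := fun x hx h1 h2 =>
    hno x hx ((h.sys.rad_eq_pair h.thick hx h1 h2 h.tube.ne_zero hwv).trans hMe.symm)
  obtain ⟨T, hT, hsT, hTZ, hTB⟩ := h.exists_tangents d₁ d₂ hx hp hv
  obtain ⟨D, hD, tD, hpD, -⟩ := h.sys.exists_tube_of_rad hp hwp hw0
  obtain ⟨τ, hτ⟩ := tD.tangent p hp hpD
  obtain ⟨t, ht, htp⟩ := hτ.exists_dir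
  have hτT := hT D hD hpD w τ tD hτ
  obtain ⟨b, hb⟩ := mem_sup_single.1 (hTB (hτT ht))
  obtain ⟨a, ha⟩ := mem_sup_single.1 hb
  obtain ⟨c, hc⟩ := mem_sup_single.1 ha
  -- `s` is a tangent vector at `p` congruent to `a t₁ + b t₂`
  obtain ⟨s, hs⟩ : ∃ s, s = t - c • p := ⟨_, rfl⟩
  have hsτ : s ∈ τ := hs ▸ τ.sub_mem ht (τ.smul_mem c hτ.base)
  have hsp : s ∉ Submodule.span K {p, w} := by
    rw [hs]
    intro hm
    exact htp ((Submodule.sub_mem_iff_left _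
      (Submodule.smul_mem _ c (left_mem_pair p w))).1 hm)
  have hsZ : s - (a • t₁ + b • t₂) ∈ ξ ⊔ π := by
    have e : s - (a • t₁ + b • t₂) = t - b • t₂ - a • t₁ - c • p := by rw [hs]; abel
    rw [e]; exact hc
  have hsr : s ∉ ξ ⊔ π := fun hm => hsp (single_le_right p w
    (h.sys.rad_inf_tube hD tD hp (hTZ s (hτT hsτ) hm) (hτ.le hsτ)))
  -- a point `f` congruent to `p + s`
  obtain ⟨f, hf, hfZ⟩ : ∃ f ∈ X, f - (p + a • t₁ + b • t₂) ∈ ξ ⊔ π := by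
    obtain ⟨E, hE, hxE, hpE⟩ := h.sys.join x₁ hx₁ p hp
    obtain ⟨g, hg, -, hvg, hgc⟩ := d₁.lift p hp hv E hE hxE hpE a
    obtain ⟨F, hF, hxF, hgF⟩ := h.sys.join x₂ hx₂ g hg
    obtain ⟨f, hf, -, -, hfc⟩ := d₂.lift g hg hvg F hF hxF hgF b
    refine ⟨f, hf, ?_⟩
    have e : f - (p + a • t₁ + b • t₂) = f - (g + b • t₂) + (g - (p + a • t₁)) := by abel
    rw [e]
    exact Submodule.add_mem _ hfc hgc
  have hfs : f ∉ sing (K := K) X Y p := by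
    intro hm
    obtain ⟨k, r, hr, rfl⟩ := mem_sing.1 hm
    have h1 : s - (k - 1) • p ∈ ξ ⊔ π := by
      have e : s - (k - 1) • p = s - (a • t₁ + b • t₂) - (k • p + r - (p + a • t₁ + b • t₂)) +
          r := by rw [sub_smul, one_smul]; abel
      rw [e]
      exact Submodule.add_mem _ (Submodule.sub_mem _ hsZ hfZ)
        (Submodule.mem_sup_right (h.le p hp hr))
    have h2 := h.sys.rad_inf_tube hD tD hp (hTZ _ (T.sub_mem (hτT hsτ)
      (T.smul_mem (k - 1) (hτT hτ.base))) h1)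
      (D.sub_mem (hτ.le hsτ) (D.smul_mem (k - 1) hpD))
    exact hsp ((Submodule.sub_mem_iff_left _ (Submodule.smul_mem _ _ (left_mem_pair p w))).1
      (single_le_right p w h2))
  -- `p` and `f` are joined by a tube with vertex `u`, where `v` and `u` are in a common radical
  obtain ⟨u, hu0, hup, huf, x, hxX, hvx, hux⟩ := h.exists_class_of_mem d₁ d₂ hx hp hv hf hfZ hfs
  obtain ⟨x₃, hx₃, hx₃ξ, hx₃s⟩ := h.sys.exists_mem_sing_of_vertex h.thick h.mem h.tube hxX hvx
  rw [← h.sys.rad_eq hxX hx₃ hx₃s] at hux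
  obtain ⟨t₃, d₃⟩ := h.exists_isDirection hx₃ hx₃ξ
  obtain ⟨D₃, hD₃, hx₃D, hpD₃, tD₃⟩ := h.sys.exists_join_of_rads hx₃ hp
    (h.notMem_sing hx₃ hx₃ξ hp hv) hux hup hu0
  obtain ⟨f', hf', hf'D, hf's⟩ := h.sys.exists_mem_sing_of_vertex h.thick hD₃ tD₃ hf huf
  obtain ⟨k, hk0, r, hr, hf'e⟩ := h.sys.exists_of_mem_sing hf hf' hf's
  have hrZ : r ∈ ξ ⊔ π := Submodule.mem_sup_right (h.le f hf hr)
  obtain ⟨γ, hγ⟩ := mem_sup_single.1 (d₃.le p hp hv D₃ hD₃ hx₃D hpD₃ hf'D)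
  obtain ⟨β, hβ⟩ := mem_sup_single.1 hγ
  obtain ⟨τ₃, hτ₃⟩ := tD₃.tangent p hp hpD₃
  have hτ₃T := hT D₃ hD₃ hpD₃ u τ₃ tD₃ hτ₃
  obtain ⟨t', ht', a', c', hc', hZ'⟩ := h.exists_tangent_dir d₃ hp hv hD₃ hx₃D hpD₃ tD₃ hτ₃
  -- `s` is congruent to a combination of `p` and the tangent vector `t'` of the second tube
  obtain ⟨ρ, hρ⟩ : ∃ ρ, ρ = k⁻¹ * γ * c'⁻¹ := ⟨_, rfl⟩
  have hsum : s - (ρ • t' + (k⁻¹ * β - 1 - ρ * a') • p) ∈ rad (K := K) X Y p := by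
    refine hTZ _ (T.sub_mem (hτT hsτ) (T.add_mem (T.smul_mem _ (hτ₃T ht'))
      (T.smul_mem _ (hτT hτ.base)))) ?_
    have e1 : ρ * c' = k⁻¹ * γ := by rw [hρ, mul_assoc, inv_mul_cancel₀ hc', mul_one]
    have e2 : k⁻¹ • f' = f + k⁻¹ • r := by rw [hf'e, smul_add, inv_smul_smul₀ hk0]
    have e : s - (ρ • t' + (k⁻¹ * β - 1 - ρ * a') • p) =
        (s - (a • t₁ + b • t₂)) - (f - (p + a • t₁ + b • t₂)) - k⁻¹ • r +
          k⁻¹ • (f' - γ • t₃ - β • p) - ρ • (t' - c' • t₃ - a' • p) := by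
      have e3 : ρ • (c' • t₃) = k⁻¹ • (γ • t₃) := by rw [smul_smul, smul_smul, e1]
      have e4 : k⁻¹ • (f' - γ • t₃ - β • p) =
          f + k⁻¹ • r - ρ • (c' • t₃) - k⁻¹ • (β • p) := by
        rw [smul_sub, smul_sub, e2, e3]
      rw [e4]
      simp only [sub_smul, smul_sub, mul_smul, one_smul]
      abel
    rw [e]
    exact Submodule.sub_mem _ (Submodule.add_mem _ (Submodule.sub_mem _
      (Submodule.sub_mem _ hsZ hfZ) (Submodule.smul_mem _ _ hrZ)) (Submodule.smul_mem _ _ hβ))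
      (Submodule.smul_mem _ _ hZ')
  have hwu : w ∉ Submodule.span K {u} := fun hc =>
    hmiss x₃ hx₃ (h.sys.vertex_mem_rad h.mem h.tube hx₃ hx₃ξ) (single_le hux hc)
  -- both tangent planes lie in a solid, so that the tubes share a second point
  have hW : finrank K (sing (K := K) X Y p ⊔ Submodule.span K {t'} : Submodule K V) ≤ 4 := by
    have h1 := finrank_sup_single_le (sing (K := K) X Y p) t'
    rw [h.sys.finrank_sing hp, h.sys.finrank_rad h.thick hp] at h1
    exact h1
  have hsW : s ∈ sing (K := K) X Y p ⊔ Submodule.span K {t'} := by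
    refine mem_sup_single.2 ⟨ρ, ?_⟩
    have e : s - ρ • t' = s - (ρ • t' + (k⁻¹ * β - 1 - ρ * a') • p) +
        (k⁻¹ * β - 1 - ρ * a') • p := by abel
    rw [e]
    exact Submodule.add_mem _ (rad_le_sing p hsum) (Submodule.smul_mem _ _ (self_mem_sing p))
  have hτW : τ ≤ sing (K := K) X Y p ⊔ Submodule.span K {t'} := by
    rw [hτ.eq_sup tD h.sys.coneX hp hsτ hsp]
    exact sup_le ((h.sys.pair_le_sing hD tD hp hpD).trans le_sup_left) (single_le hsW)
  have ht'p : t' ∉ Submodule.span K {p, u} := by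
    intro hm
    obtain ⟨α, β', rfl⟩ := mem_pair.1 hm
    refine d₃.dir_notMem h hp hv ((Submodule.smul_mem_iff _ hc').1
      (mem_sup_single.2 ⟨α - a', ?_⟩))
    have e : c' • t₃ - (α - a') • p = β' • u - (α • p + β' • u - c' • t₃ - a' • p) := by
      rw [sub_smul]; abel
    rw [e]
    exact Submodule.sub_mem _ (Submodule.smul_mem _ _ (Submodule.mem_sup_right (h.le p hp hup)))
      hZ'
  have hτ₃W : τ₃ ≤ sing (K := K) X Y p ⊔ Submodule.span K {t'} := by
    rw [hτ₃.eq_sup tD₃ h.sys.coneX hp ht' ht'p]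
    exact sup_le ((h.sys.pair_le_sing hD₃ tD₃ hp hpD₃).trans le_sup_left) le_sup_right
  obtain ⟨y, hyτ, hyp⟩ : ∃ y ∈ τ ⊓ τ₃, y ∉ Submodule.span K {p} := by
    refine exists_notMem_of_finrank_lt ?_
    have h1 := Submodule.finrank_sup_add_finrank_inf_eq τ τ₃
    have h2 := Submodule.finrank_mono (sup_le hτW hτ₃W)
    have h3 := finrank_single_le (K := K) p
    rw [hτ.rank, hτ₃.rank] at h1
    omega
  have hDD₃ : D ≠ D₃ := by
    rintro rfl
    exact hwu (tD₃.vertex_unique h.sys.coneX h.sys.card' tD)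
  have hyD := hτ.le hyτ.1
  have hyD₃ := hτ₃.le hyτ.2
  -- the second common point is on the generators through `p` of both tubes, so that `w` and `u`
  -- would agree
  obtain ⟨α₁, β₁, hy₁⟩ := mem_pair.1
    (h.sys.mem_pair_of_mem_two hD hD₃ hDD₃ tD hp hpD hpD₃ hyD hyD₃)
  obtain ⟨α₂, β₂, hy₂⟩ := mem_pair.1
    (h.sys.mem_pair_of_mem_two hD₃ hD hDD₃.symm tD₃ hp hpD₃ hpD hyD₃ hyD)
  have hβ₁ : β₁ ≠ 0 := by
    rintro rfl
    exact hyp (mem_single.2 ⟨α₁, by simpa using hy₁⟩)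
  have hα : α₁ = α₂ := by
    by_contra hne
    refine h.sys.self_notMem_rad hp ((Submodule.smul_mem_iff _ (sub_ne_zero.2 hne)).1 ?_)
    have e : (α₁ - α₂) • p = β₂ • u - β₁ • w := by
      rw [sub_smul, sub_eq_sub_iff_add_eq_add, ← hy₁, hy₂, add_comm]
    rw [e]
    exact Submodule.sub_mem _ (Submodule.smul_mem _ _ hup) (Submodule.smul_mem _ _ hwp)
  rw [hα] at hy₁
  have h3 : β₁ • w = β₂ • u := add_left_cancel (hy₁.symm.trans hy₂)
  exact hwu ((Submodule.smul_mem_iff _ hβ₁).1 (mem_single.2 ⟨_, h3⟩))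

end IsPointed

end IsHVSystem

end AllLines

/-! ### Ovals pairwise meeting in a point -/

section OvalSystems

variable {K V : Type*} [DivisionRing K] [AddCommGroup V] [Module K V]

/-- `τ` is the tangent line at `a` to the oval `X ∩ ξ` of the plane `ξ`; the last field says that
every other line of `ξ` through `a` contains a second point of the oval. -/
structure IsOvalTangent (X : Set V) (ξ : Submodule K V) (a : V) (τ : Submodule K V) : Prop where
  le : τ ≤ ξ
  rank : finrank K τ = 2
  base : a ∈ τ
  only : ∀ u ∈ X, u ∈ τ → u ∈ Submodule.span K {a}
  lift : ∀ g ∈ ξ, g ∉ τ → ∃ s : K, g + s • a ∈ X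

/-- A set `X` of points and a set `Θ` of planes meeting `X` in ovals, such that two points lie in
exactly one of the planes, and two planes share exactly one point, which is in `X`. -/
structure IsOvalSystem (X : Set V) (Θ : Set (Submodule K V)) : Prop where
  card : ∀ a : K, ∃ c : K, c ≠ 0 ∧ c ≠ a
  cone : IsConeSet K X
  rank : ∀ ξ ∈ Θ, finrank K ξ = 3
  nonempty : ∀ ξ ∈ Θ, ∃ a ∈ X, a ∈ ξ
  arc : ∀ a ∈ X, ∀ b ∈ X, ∀ c ∈ X, c ∈ Submodule.span K {a, b} →
    c ∈ Submodule.span K {a} ∨ c ∈ Submodule.span K {b}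
  tangent : ∀ ξ ∈ Θ, ∀ a ∈ X, a ∈ ξ → ∃ τ, IsOvalTangent X ξ a τ
  join : ∀ x ∈ X, ∀ y ∈ X, ∃ ξ ∈ Θ, x ∈ ξ ∧ y ∈ ξ
  meet : ∀ ξ₁ ∈ Θ, ∀ ξ₂ ∈ Θ, ∃ x ∈ X, x ∈ ξ₁ ∧ x ∈ ξ₂
  inter : ∀ ξ₁ ∈ Θ, ∀ ξ₂ ∈ Θ, ξ₁ ≠ ξ₂ → ∀ x ∈ X, x ∈ ξ₁ → x ∈ ξ₂ → ∀ u ∈ ξ₁, u ∈ ξ₂ →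
    u ∈ Submodule.span K {x}
  exists_notMem : ∀ ξ ∈ Θ, ∃ x ∈ X, x ∉ ξ

section Tangents

variable {X : Set V} {ξ τ : Submodule K V} {a b t : V}

lemma IsOvalTangent.notMem (hτ : IsOvalTangent X ξ a τ) (hb : b ∈ X)
    (hba : b ∉ Submodule.span K {a}) : b ∉ τ :=
  fun h => hba (hτ.only b hb h)

variable [Module.Finite K V]

lemma IsOvalTangent.exists_dir (hτ : IsOvalTangent X ξ a τ) :
    ∃ t ∈ τ, t ∉ Submodule.span K {a} :=
  exists_notMem_of_finrank_lt (by
    have := finrank_single_le (K := K) a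
    rw [hτ.rank]; omega)

lemma IsOvalTangent.eq_pair (hτ : IsOvalTangent X ξ a τ) (ha : a ≠ 0) (ht : t ∈ τ)
    (hta : t ∉ Submodule.span K {a}) : τ = Submodule.span K {a, t} :=
  eq_pair_of_finrank hτ.rank hτ.base ht ha hta

lemma IsOvalTangent.unique (hτ : IsOvalTangent X ξ a τ) {τ' : Submodule K V}
    (hτ' : IsOvalTangent X ξ a τ') : τ' = τ := by
  refine Submodule.eq_of_le_of_finrank_eq (fun g hg => ?_) (by rw [hτ.rank, hτ'.rank])
  by_contra hgτ
  obtain ⟨s, hs⟩ := hτ.lift g (hτ'.le hg) hgτ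
  have h1 := hτ'.only _ hs (τ'.add_mem hg (τ'.smul_mem _ hτ'.base))
  have h2 := (Submodule.add_mem_iff_left _ (smul_mem_single a s)).1 h1
  exact hgτ (single_le hτ.base h2)

lemma IsOvalTangent.sup_eq (hτ : IsOvalTangent X ξ a τ) (h3 : finrank K ξ = 3) {g : V}
    (hg : g ∈ ξ) (hgτ : g ∉ τ) : ξ = τ ⊔ Submodule.span K {g} := by
  refine (Submodule.eq_of_le_of_finrank_eq (sup_le hτ.le (single_le hg)) ?_).symm
  rw [Submodule.finrank_sup_span_singleton hgτ, hτ.rank, h3]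

end Tangents

namespace IsOvalSystem

variable {X : Set V} {Θ : Set (Submodule K V)}
  {ξ₀ ξ₁ ζ ξ τ : Submodule K V} {a b c x p q : V}

lemma eq_of_mem (h : IsOvalSystem X Θ) (h₀ : ξ₀ ∈ Θ) (h₁ : ξ₁ ∈ Θ) (hx : x ∈ X)
    (hx₀ : x ∈ ξ₀) (hx₁ : x ∈ ξ₁) (hp₀ : p ∈ ξ₀) (hp₁ : p ∈ ξ₁)
    (hp : p ∉ Submodule.span K {x}) : ξ₀ = ξ₁ := by
  by_contra hne
  exact hp (h.inter _ h₀ _ h₁ hne x hx hx₀ hx₁ p hp₀ hp₁)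

/-- Points off a plane of the system are determined by their residues modulo the plane. -/
lemma eq_of_sub_mem (h : IsOvalSystem X Θ) (hξ : ξ ∈ Θ) (hp : p ∈ X) (hq : q ∈ X)
    (hpξ : p ∉ ξ) (hm : p - q ∈ ξ) : p = q := by
  by_cases hpq : q ∈ Submodule.span K {p}
  · obtain ⟨k, rfl⟩ := mem_single.1 hpq
    have h1 : (1 - k) • p ∈ ξ := by rwa [sub_smul, one_smul]
    have h2 : 1 - k = 0 := by
      by_contra h0
      exact hpξ ((ξ.smul_mem_iff h0).1 h1)
    rw [← sub_eq_zero.1 h2, one_smul]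
  · exfalso
    have hqξ : q ∉ ξ := fun hq' => hpξ (by simpa using ξ.add_mem hm hq')
    obtain ⟨ζ, hζ, hpζ, hqζ⟩ := h.join p hp q hq
    have hne : ζ ≠ ξ := by rintro rfl; exact hpξ hpζ
    obtain ⟨x, hx, hxζ, hxξ⟩ := h.meet ζ hζ ξ hξ
    obtain ⟨k, hk⟩ := mem_single.1
      (h.inter ζ hζ ξ hξ hne x hx hxζ hxξ _ (ζ.sub_mem hpζ hqζ) hm)
    have hk0 : k ≠ 0 := by
      rintro rfl
      rw [zero_smul, sub_eq_zero] at hk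
      exact hpq (by rw [hk]; exact Submodule.mem_span_singleton_self q)
    have hxpq : x ∈ Submodule.span K {p, q} := by
      refine (Submodule.smul_mem_iff _ hk0).1 ?_
      rw [← hk]
      exact Submodule.sub_mem _ (left_mem_pair p q) (right_mem_pair p q)
    rcases h.arc p hp q hq x hx hxpq with h1 | h1
    · exact hpξ (single_le hxξ (single_comm (h.cone.ne_zero _ hx) h1))
    · exact hqξ (single_le hxξ (single_comm (h.cone.ne_zero _ hx) h1))

variable [Module.Finite K V]

lemma exists_ne (h : IsOvalSystem X Θ) (hξ : ξ ∈ Θ) (ha : a ∈ X) (haξ : a ∈ ξ) :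
    ∃ b ∈ X, b ∈ ξ ∧ b ∉ Submodule.span K {a} := by
  obtain ⟨τ, hτ⟩ := h.tangent ξ hξ a ha haξ
  obtain ⟨g, hg, hgτ⟩ := exists_notMem_of_finrank_lt (W := τ) (U := ξ) (by
    rw [hτ.rank, h.rank ξ hξ]; omega)
  obtain ⟨s, hs⟩ := hτ.lift g hg hgτ
  refine ⟨_, hs, ξ.add_mem hg (ξ.smul_mem _ haξ), fun hc => hgτ ?_⟩
  exact single_le hτ.base ((Submodule.add_mem_iff_left _ (smul_mem_single a s)).1 hc)

/-- An oval has at least four points. -/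
lemma exists_fourth (h : IsOvalSystem X Θ) (hξ : ξ ∈ Θ) (ha : a ∈ X) (haξ : a ∈ ξ)
    (hb : b ∈ X) (hbξ : b ∈ ξ) (hba : b ∉ Submodule.span K {a}) (c : V) :
    ∃ d ∈ X, d ∈ ξ ∧ d ∉ Submodule.span K {a} ∧ d ∉ Submodule.span K {b} ∧
      d ∉ Submodule.span K {c} := by
  obtain ⟨τ, hτ⟩ := h.tangent ξ hξ a ha haξ
  obtain ⟨t, ht, hta⟩ := hτ.exists_dir
  have hbτ := hτ.notMem hb hba
  have key : ∀ l m : K, ∀ s : K, l ≠ 0 → m • b + l • t + s • a ∉ Submodule.span K {b} := by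
    intro l m s hl hm
    obtain ⟨k, hk⟩ := mem_single.1 hm
    have h1 : (k - m) • b = l • t + s • a := by
      rw [sub_smul, ← hk]; abel
    have h2 : k - m = 0 := by
      by_contra hkm
      exact hbτ ((τ.smul_mem_iff hkm).1 (by
        rw [h1]; exact τ.add_mem (τ.smul_mem _ ht) (τ.smul_mem _ hτ.base)))
    rw [h2, zero_smul] at h1
    exact hta ((Submodule.smul_mem_iff _ hl).1 ((Submodule.add_mem_iff_left _
      (smul_mem_single a s)).1 (h1 ▸ Submodule.zero_mem _)))
  have step : ∀ l : K, l ≠ 0 → ∃ s : K, b + l • t + s • a ∈ X := fun l _ =>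
    hτ.lift _ (ξ.add_mem hbξ (ξ.smul_mem _ (hτ.le ht)))
      fun hm => hbτ ((τ.add_mem_iff_left (τ.smul_mem _ ht)).1 hm)
  have hoff : ∀ l s : K, b + l • t + s • a ∉ τ := fun l s hm =>
    hbτ ((τ.add_mem_iff_left (τ.smul_mem _ ht)).1
      ((τ.add_mem_iff_left (τ.smul_mem _ hτ.base)).1 hm))
  have fin : ∀ l s : K, l ≠ 0 → b + l • t + s • a ∈ X →
      b + l • t + s • a ∉ Submodule.span K {c} → ∃ d ∈ X, d ∈ ξ ∧ d ∉ Submodule.span K {a} ∧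
      d ∉ Submodule.span K {b} ∧ d ∉ Submodule.span K {c} := by
    intro l s hl hX hc
    refine ⟨_, hX, ξ.add_mem (ξ.add_mem hbξ (ξ.smul_mem _ (hτ.le ht))) (ξ.smul_mem _ haξ),
      fun hm => hoff l s (single_le hτ.base hm), ?_, hc⟩
    have := key l 1 s hl
    rwa [one_smul] at this
  obtain ⟨l, hl0, hl1⟩ := h.card 1
  obtain ⟨s₁, hs₁⟩ := step 1 one_ne_zero
  obtain ⟨s₂, hs₂⟩ := step l hl0
  by_cases h1 : b + (1 : K) • t + s₁ • a ∈ Submodule.span K {c}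
  · by_cases h2 : b + l • t + s₂ • a ∈ Submodule.span K {c}
    · exfalso
      have h3 := single_comm (h.cone.ne_zero _ hs₁) h1
      obtain ⟨k, hk⟩ := mem_single.1 (single_le h3 h2)
      have h4 : (k - 1) • b = (l - k) • t + (s₂ - k * s₁) • a := by
        have : (k - 1) • b = k • (b + (1 : K) • t + s₁ • a) - b - k • t - (k * s₁) • a := by
          match_scalars <;> noncomm_ring
        rw [this, ← hk]
        match_scalars <;> noncomm_ring
      have h5 : k = 1 := by
        by_contra hk1
        exact hbτ ((τ.smul_mem_iff (sub_ne_zero.2 hk1)).1 (by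
          rw [h4]; exact τ.add_mem (τ.smul_mem _ ht) (τ.smul_mem _ hτ.base)))
      rw [h5, sub_self, zero_smul] at h4
      exact hta ((Submodule.smul_mem_iff _ (sub_ne_zero.2 hl1)).1 ((Submodule.add_mem_iff_left _
        (smul_mem_single a _)).1 (h4 ▸ Submodule.zero_mem _)))
    · exact fin l s₂ hl0 hs₂ h2
  · exact fin 1 s₁ one_ne_zero hs₁ h1

/-- A plane of the system lies in every subspace that contains three of its points. -/
lemma le_of_three (h : IsOvalSystem X Θ) (hξ : ξ ∈ Θ) (ha : a ∈ X) (haξ : a ∈ ξ)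
    (hb : b ∈ X) (hbξ : b ∈ ξ) (hba : b ∉ Submodule.span K {a}) (hc : c ∈ X) (hcξ : c ∈ ξ)
    (hca : c ∉ Submodule.span K {a}) (hcb : c ∉ Submodule.span K {b}) {U : Submodule K V}
    (haU : a ∈ U) (hbU : b ∈ U) (hcU : c ∈ U) : ξ ≤ U := by
  have h1 : c ∉ Submodule.span K {a, b} := fun hm =>
    (h.arc a ha b hb c hc hm).elim hca hcb
  have h2 : ξ = Submodule.span K {a, b} ⊔ Submodule.span K {c} := by
    refine (Submodule.eq_of_le_of_finrank_eq (sup_le (pair_le haξ hbξ) (single_le hcξ)) ?_).symm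
    rw [Submodule.finrank_sup_span_singleton h1, h.rank ξ hξ,
      finrank_pair (h.cone.ne_zero _ ha) hba]
  rw [h2]
  exact sup_le (pair_le haU hbU) (single_le hcU)

/-- A plane of the system lies in every subspace that contains its points. -/
lemma le_of_points (h : IsOvalSystem X Θ) (hξ : ξ ∈ Θ) {U : Submodule K V}
    (hU : ∀ u ∈ X, u ∈ ξ → u ∈ U) : ξ ≤ U := by
  obtain ⟨a, ha, haξ⟩ := h.nonempty ξ hξ
  obtain ⟨b, hb, hbξ, hba⟩ := h.exists_ne hξ ha haξ
  obtain ⟨c, hc, hcξ, hca, hcb, -⟩ := h.exists_fourth hξ ha haξ hb hbξ hba a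
  exact h.le_of_three hξ ha haξ hb hbξ hba hc hcξ hca hcb (hU a ha haξ) (hU b hb hbξ)
    (hU c hc hcξ)

/-- The points in the span of two planes of the system belong to one of the planes. A further
point would be congruent modulo `ξ₀` to a tangent vector `b` of `ξ₁` at the common point `x`; then
the plane joining it to a point `q` of `ξ₁` would agree with `ξ₁` modulo `ξ₀`, and nearly all of
its points would be in `ξ₁`. -/
lemma mem_or_mem (h : IsOvalSystem X Θ) (h₀ : ξ₀ ∈ Θ) (h₁ : ξ₁ ∈ Θ) (hne : ξ₀ ≠ ξ₁)
    (hp : p ∈ X) (hm : p ∈ ξ₀ ⊔ ξ₁) : p ∈ ξ₀ ∨ p ∈ ξ₁ := by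
  by_contra! hc
  obtain ⟨hp₀, hp₁⟩ := hc
  obtain ⟨x, hx, hx₀, hx₁⟩ := h.meet ξ₀ h₀ ξ₁ h₁
  obtain ⟨τ, hτ⟩ := h.tangent ξ₁ h₁ x hx hx₁
  obtain ⟨z, hz, b, hb, rfl⟩ := Submodule.mem_sup.1 hm
  -- `b` is a tangent vector at `x`
  have hbτ : b ∈ τ := by
    by_contra hbτ
    obtain ⟨s, hs⟩ := hτ.lift b hb hbτ
    have h1 := h.eq_of_sub_mem h₀ hp hs hp₀ (by
      have : z + b - (b + s • x) = z - s • x := by abel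
      rw [this]; exact ξ₀.sub_mem hz (ξ₀.smul_mem _ hx₀))
    exact hp₁ (h1 ▸ ξ₁.add_mem hb (ξ₁.smul_mem _ hx₁))
  have hbξ₀ : b ∉ ξ₀ := fun hb₀ => hp₀ (ξ₀.add_mem hz hb₀)
  obtain ⟨q, hq, hq₁, hqx⟩ := h.exists_ne h₁ hx hx₁
  have hqτ := hτ.notMem hq hqx
  have hq₀ : q ∉ ξ₀ := fun hq₀ => hqx (h.inter _ h₀ _ h₁ hne x hx hx₀ hx₁ q hq₀ hq₁)
  obtain ⟨ζ, hζ, hpζ, hqζ⟩ := h.join _ hp q hq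
  have hζ₀ : ζ ≠ ξ₀ := by rintro rfl; exact hp₀ hpζ
  have hζ₁ : ζ ≠ ξ₁ := by rintro rfl; exact hp₁ hpζ
  obtain ⟨m, hm, hmζ, hm₀⟩ := h.meet ζ hζ ξ₀ h₀
  obtain ⟨σ, hσ⟩ := h.tangent ζ hζ m hm hmζ
  have key : ∀ l : K, l ≠ 0 → q + l • (z + b) ∈ σ := by
    intro l hl
    by_contra hσl
    obtain ⟨s, hs⟩ := hσ.lift _ (ζ.add_mem hqζ (ζ.smul_mem l hpζ)) hσl
    obtain ⟨s', hs'⟩ := hτ.lift (q + l • b) (ξ₁.add_mem hq₁ (ξ₁.smul_mem l hb))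
      (fun hc => hqτ ((τ.add_mem_iff_left (τ.smul_mem l hbτ)).1 hc))
    have hs'₁ : q + l • b + s' • x ∈ ξ₁ :=
      ξ₁.add_mem (ξ₁.add_mem hq₁ (ξ₁.smul_mem l hb)) (ξ₁.smul_mem _ hx₁)
    have h1 : q + l • b + s' • x ∉ ξ₀ := fun hc => by
      have h2 := h.inter _ h₀ _ h₁ hne x hx hx₀ hx₁ _ hc hs'₁
      have h3 := single_le hτ.base ((Submodule.add_mem_iff_left _ (smul_mem_single x s')).1 h2)
      exact hqτ ((τ.add_mem_iff_left (τ.smul_mem l hbτ)).1 h3)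
    have h2 := h.eq_of_sub_mem h₀ hs' hs h1 (by
      have : q + l • b + s' • x - (q + l • (z + b) + s • m) = s' • x - l • z - s • m := by
        rw [smul_add]; abel
      rw [this]
      exact ξ₀.sub_mem (ξ₀.sub_mem (ξ₀.smul_mem _ hx₀) (ξ₀.smul_mem _ hz)) (ξ₀.smul_mem _ hm₀))
    have hsζ : q + l • b + s' • x ∈ ζ := by
      rw [h2]; exact ζ.add_mem (ζ.add_mem hqζ (ζ.smul_mem l hpζ)) (ζ.smul_mem _ hmζ)
    -- the point `q + l • b + s' • x` is in `ξ₁` and in `ζ`, hence equal to `q`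
    obtain ⟨k, hk⟩ := mem_single.1 (h.inter _ h₁ _ hζ hζ₁.symm q hq hq₁ hqζ _ hs'₁ hsζ)
    have h3 : (k - 1) • q = l • b + s' • x := by
      rw [sub_smul, ← hk, one_smul]; abel
    have h4 : k - 1 = 0 := by
      by_contra hk1
      exact hqτ ((τ.smul_mem_iff hk1).1 (by
        rw [h3]; exact τ.add_mem (τ.smul_mem _ hbτ) (τ.smul_mem _ hτ.base)))
    rw [h4, zero_smul] at h3
    exact hbξ₀ ((ξ₀.smul_mem_iff hl).1 ((ξ₀.add_mem_iff_left (ξ₀.smul_mem s' hx₀)).1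
      (h3 ▸ ξ₀.zero_mem)))
  obtain ⟨l, hl0, hl1⟩ := h.card 1
  have h1 : (l - 1) • (z + b) ∈ σ := by
    have : (l - 1) • (z + b) = (q + l • (z + b)) - (q + (1 : K) • (z + b)) := by
      rw [sub_smul]; abel
    rw [this]
    exact σ.sub_mem (key l hl0) (key 1 one_ne_zero)
  have h2 := hσ.only _ hp ((σ.smul_mem_iff (sub_ne_zero.2 hl1)).1 h1)
  exact hp₀ (single_le hm₀ h2)

/-- The points lie in the span of two planes and a further point. -/
lemma mem_sup (h : IsOvalSystem X Θ) (h₀ : ξ₀ ∈ Θ) (h₁ : ξ₁ ∈ Θ) (hne : ξ₀ ≠ ξ₁)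
    {z : V} (hz : z ∈ X) (hz₀ : z ∉ ξ₀) (hz₁ : z ∉ ξ₁) (hq : q ∈ X) :
    q ∈ ξ₀ ⊔ ξ₁ ⊔ Submodule.span K {z} := by
  obtain ⟨x, hx, hx₀, hx₁⟩ := h.meet ξ₀ h₀ ξ₁ h₁
  set U := ξ₀ ⊔ ξ₁ ⊔ Submodule.span K {z} with hU
  have hU₀ : ξ₀ ≤ U := le_sup_left.trans le_sup_left
  have hU₁ : ξ₁ ≤ U := le_sup_right.trans le_sup_left
  have hzU : z ∈ U := Submodule.mem_sup_right (Submodule.mem_span_singleton_self z)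
  -- planes through `z` but not through `x` meet `ξ₀` and `ξ₁` in different points
  have main : ∀ q ∈ X, ∀ ζ ∈ Θ, z ∈ ζ → q ∈ ζ → x ∉ ζ → q ∈ U := by
    intro q hq ζ hζ hzζ hqζ hxζ
    obtain ⟨a, ha, haζ, ha₀⟩ := h.meet ζ hζ ξ₀ h₀
    obtain ⟨b, hb, hbζ, hb₁⟩ := h.meet ζ hζ ξ₁ h₁
    have hba : b ∉ Submodule.span K {a} := fun hc => by
      have hax := h.inter _ h₀ _ h₁ hne x hx hx₀ hx₁ a ha₀
        (single_le hb₁ (single_comm (h.cone.ne_zero _ hb) hc))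
      exact hxζ (single_le haζ (single_comm (h.cone.ne_zero _ ha) hax))
    exact h.le_of_three hζ ha haζ hb hbζ hba hz hzζ (fun hc => hz₀ (single_le ha₀ hc))
      (fun hc => hz₁ (single_le hb₁ hc)) (hU₀ ha₀) (hU₁ hb₁) hzU hqζ
  by_cases hq₀ : q ∈ ξ₀
  · exact hU₀ hq₀
  by_cases hq₁ : q ∈ ξ₁
  · exact hU₁ hq₁
  obtain ⟨ζ, hζ, hzζ, hqζ⟩ := h.join z hz q hq
  by_cases hxζ : x ∈ ζ
  · obtain ⟨r, hr, hr₀, hrx⟩ := h.exists_ne h₀ hx hx₀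
    obtain ⟨η, hη, hqη, hrη⟩ := h.join q hq r hr
    have hη₀ : η ≠ ξ₀ := by rintro rfl; exact hq₀ hqη
    have hxη : x ∉ η := fun hxη =>
      hη₀ (h.eq_of_mem hη h₀ hx hxη hx₀ hrη hr₀ hrx)
    have hηζ : η ≠ ζ := by rintro rfl; exact hxη hxζ
    obtain ⟨s, hs, hsη, hs₁⟩ := h.meet η hη ξ₁ h₁
    have hsr : s ∉ Submodule.span K {r} := fun hc => by
      have hsx := h.inter _ h₀ _ h₁ hne x hx hx₀ hx₁ s (single_le hr₀ hc) hs₁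
      exact hxη (single_le hsη (single_comm (h.cone.ne_zero _ hs) hsx))
    obtain ⟨c, hc, hcη, hcr, hcs, hcq⟩ := h.exists_fourth hη hr hrη hs hsη hsr q
    obtain ⟨ζ', hζ', hzζ', hcζ'⟩ := h.join z hz c hc
    refine h.le_of_three hη hr hrη hs hsη hsr hc hcη hcr hcs (hU₀ hr₀) (hU₁ hs₁)
      (main c hc ζ' hζ' hzζ' hcζ' fun hxζ' => hcq ?_) hqη
    -- otherwise `c` is in the plane joining `x` and `z`, which meets `η` in `q` only
    have he : ζ' = ζ := h.eq_of_mem hζ' hζ hx hxζ' hxζ hzζ' hzζ fun hc => hz₀ (single_le hx₀ hc)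
    exact h.inter _ hη _ hζ hηζ q hq hqη hqζ c hcη (he ▸ hcζ')
  · exact main q hq ζ hζ hzζ hqζ hxζ

lemma exists_off (h : IsOvalSystem X Θ) (h₀ : ξ₀ ∈ Θ) (h₁ : ξ₁ ∈ Θ) (hne : ξ₀ ≠ ξ₁) :
    ∃ z ∈ X, z ∉ ξ₀ ∧ z ∉ ξ₁ := by
  obtain ⟨x, hx, hx₀, hx₁⟩ := h.meet ξ₀ h₀ ξ₁ h₁
  obtain ⟨a, ha, ha₀, hax⟩ := h.exists_ne h₀ hx hx₀
  obtain ⟨b, hb, hb₁, hbx⟩ := h.exists_ne h₁ hx hx₁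
  have ha₁ : a ∉ ξ₁ := fun hc => hax (h.inter _ h₀ _ h₁ hne x hx hx₀ hx₁ a ha₀ hc)
  have hb₀ : b ∉ ξ₀ := fun hc => hbx (h.inter _ h₀ _ h₁ hne x hx hx₀ hx₁ b hc hb₁)
  obtain ⟨ζ, hζ, haζ, hbζ⟩ := h.join a ha b hb
  obtain ⟨z, hz, hzζ, hza, hzb, -⟩ := h.exists_fourth hζ ha haζ hb hbζ
    (fun hc => hb₀ (single_le ha₀ hc)) a
  exact ⟨z, hz, fun hc => hb₀ (h.eq_of_mem hζ h₀ ha haζ ha₀ hzζ hc hza ▸ hbζ),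
    fun hc => ha₁ (h.eq_of_mem hζ h₁ hb hbζ hb₁ hzζ hc hzb ▸ haζ)⟩

lemma finrank_sup (h : IsOvalSystem X Θ) (h₀ : ξ₀ ∈ Θ) (h₁ : ξ₁ ∈ Θ) (hne : ξ₀ ≠ ξ₁) :
    finrank K (ξ₀ ⊔ ξ₁ : Submodule K V) = 5 := by
  obtain ⟨x, hx, hx₀, hx₁⟩ := h.meet ξ₀ h₀ ξ₁ h₁
  have h1 := Submodule.finrank_sup_add_finrank_inf_eq ξ₀ ξ₁
  have h2 : ξ₀ ⊓ ξ₁ = Submodule.span K {x} := le_antisymm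
    (fun u hu => h.inter _ h₀ _ h₁ hne x hx hx₀ hx₁ u hu.1 hu.2) (single_le ⟨hx₀, hx₁⟩)
  rw [h2, finrank_span_singleton (h.cone.ne_zero _ hx), h.rank _ h₀, h.rank _ h₁] at h1
  omega

/-- The tangent lines at a point of the plane `ξ₀` to the ovals in other planes agree modulo
`ξ₀`. -/
lemma tangent_le (h : IsOvalSystem X Θ) (h₀ : ξ₀ ∈ Θ) (h₁ : ξ₁ ∈ Θ) (hne : ξ₁ ≠ ξ₀) (hζ : ζ ∈ Θ)
    (hζ₀ : ζ ≠ ξ₀) (hx : x ∈ X) (hx₀ : x ∈ ξ₀) (hx₁ : x ∈ ξ₁) (hxζ : x ∈ ζ) {τ σ : Submodule K V}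
    (hτ : IsOvalTangent X ξ₁ x τ) (hσ : IsOvalTangent X ζ x σ) : σ ≤ ξ₀ ⊔ τ := by
  by_cases he : ζ = ξ₁
  · subst he
    rw [hτ.unique hσ]
    exact le_sup_right
  obtain ⟨z, hz, hz₀, hz₁⟩ := h.exists_off h₀ h₁ hne.symm
  have hζU : ζ ≤ ξ₀ ⊔ ξ₁ ⊔ Submodule.span K {z} := h.le_of_points hζ fun u hu _ =>
    h.mem_sup h₀ h₁ hne.symm hz hz₀ hz₁ hu
  obtain ⟨y, ⟨hyζ, hy₁⟩, hy₀⟩ := exists_notMem_of_finrank_lt (W := ξ₀)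
      (U := (ξ₀ ⊔ ζ) ⊓ (ξ₀ ⊔ ξ₁)) (by
    have h1 := Submodule.finrank_sup_add_finrank_inf_eq (ξ₀ ⊔ ζ) (ξ₀ ⊔ ξ₁)
    have h2 : finrank K ((ξ₀ ⊔ ζ) ⊔ (ξ₀ ⊔ ξ₁) : Submodule K V) ≤ 6 := by
      refine (Submodule.finrank_mono (t := ξ₀ ⊔ ξ₁ ⊔ Submodule.span K {z})
        (sup_le (sup_le (le_sup_left.trans le_sup_left) hζU) le_sup_left)).trans ?_
      have h3 := finrank_sup_single_le (ξ₀ ⊔ ξ₁) z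
      rw [h.finrank_sup h₀ h₁ hne.symm] at h3
      exact h3
    rw [h.finrank_sup h₀ h₁ hne.symm, h.finrank_sup h₀ hζ hζ₀.symm] at h1
    rw [h.rank _ h₀]
    omega)
  obtain ⟨c, hc, u, hu, rfl⟩ := Submodule.mem_sup.1 hyζ
  obtain ⟨d, hd, w, hw, hdw⟩ := Submodule.mem_sup.1 hy₁
  have hu₀ : u ∉ ξ₀ := fun hu₀ => hy₀ (ξ₀.add_mem hc hu₀)
  have hw₀ : w ∉ ξ₀ := fun hw₀ => hy₀ (hdw ▸ ξ₀.add_mem hd hw₀)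
  have huw : u = d - c + w := by rw [sub_add_eq_add_sub, hdw]; abel
  have hwu : w = c - d + u := by rw [sub_add_eq_add_sub, ← hdw]; abel
  have huσ : u ∈ σ := by
    by_contra huσ
    obtain ⟨s, hs⟩ := hσ.lift u hu huσ
    have hsζ := ζ.add_mem hu (ζ.smul_mem s hxζ)
    have h1 : u + s • x ∈ Submodule.span K {x} := by
      rcases h.mem_or_mem h₀ h₁ hne.symm hs (Submodule.add_mem _ (huw ▸ Submodule.add_mem _
        (Submodule.mem_sup_left (ξ₀.sub_mem hd hc)) (Submodule.mem_sup_right hw))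
        (Submodule.mem_sup_left (ξ₀.smul_mem s hx₀))) with h2 | h2
      · exact h.inter _ hζ _ h₀ hζ₀ x hx hxζ hx₀ _ hsζ h2
      · exact h.inter _ hζ _ h₁ he x hx hxζ hx₁ _ hsζ h2
    exact hu₀ (single_le hx₀ ((Submodule.add_mem_iff_left _ (smul_mem_single x s)).1 h1))
  have hwτ : w ∈ τ := by
    by_contra hwτ
    obtain ⟨s, hs⟩ := hτ.lift w hw hwτ
    have hsζ := ξ₁.add_mem hw (ξ₁.smul_mem s hx₁)
    have h1 : w + s • x ∈ Submodule.span K {x} := by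
      rcases h.mem_or_mem h₀ hζ hζ₀.symm hs (Submodule.add_mem _ (hwu ▸ Submodule.add_mem _
        (Submodule.mem_sup_left (ξ₀.sub_mem hc hd)) (Submodule.mem_sup_right hu))
        (Submodule.mem_sup_left (ξ₀.smul_mem s hx₀))) with h2 | h2
      · exact h.inter _ h₁ _ h₀ hne x hx hx₁ hx₀ _ hsζ h2
      · exact h.inter _ h₁ _ hζ (Ne.symm he) x hx hx₁ hxζ _ hsζ h2
    exact hw₀ (single_le hx₀ ((Submodule.add_mem_iff_left _ (smul_mem_single x s)).1 h1))
  rw [hσ.eq_pair (h.cone.ne_zero _ hx) huσ fun hc => hu₀ (single_le hx₀ hc)]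
  refine pair_le (Submodule.mem_sup_left hx₀) ?_
  rw [huw]
  exact Submodule.add_mem _ (Submodule.mem_sup_left (ξ₀.sub_mem hd hc))
    (Submodule.mem_sup_right hwτ)

/-- No point off `ξ₀` is congruent to a tangent vector modulo `ξ₀`. -/
lemma mem_of_mem_sup_tangent (h : IsOvalSystem X Θ) (h₀ : ξ₀ ∈ Θ) (h₁ : ξ₁ ∈ Θ) (hne : ξ₁ ≠ ξ₀)
    (hx : x ∈ X) (hx₀ : x ∈ ξ₀) (hx₁ : x ∈ ξ₁) (hτ : IsOvalTangent X ξ₁ x τ) (hp : p ∈ X)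
    (hm : p ∈ ξ₀ ⊔ τ) : p ∈ ξ₀ := by
  by_contra hp₀
  obtain ⟨ζ, hζ, hxζ, hpζ⟩ := h.join x hx p hp
  have hζ₀ : ζ ≠ ξ₀ := by rintro rfl; exact hp₀ hpζ
  obtain ⟨σ, hσ⟩ := h.tangent ζ hζ x hx hxζ
  have h1 : p ∈ ξ₀ ⊔ σ := sup_le le_sup_left
    (h.tangent_le h₀ hζ hζ₀ h₁ hne hx hx₀ hxζ hx₁ hσ hτ) hm
  obtain ⟨c, hc, u, hu, rfl⟩ := Submodule.mem_sup.1 h1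
  have h2 := h.inter _ hζ _ h₀ hζ₀ x hx hxζ hx₀ c ((ζ.add_mem_iff_left (hσ.le hu)).1 hpζ) hc
  exact hp₀ (single_le hx₀ (hσ.only _ hp (σ.add_mem (single_le hσ.base h2) hu)))

end IsOvalSystem

end OvalSystems

/-! ### Coordinates for systems of ovals -/

section VeroneseCoordinates

variable {K V : Type*} [DivisionRing K] [AddCommGroup V] [Module K V]

/-- A triangle `p₀`, `p₁`, `p₂` of points in the planes `ξ₀ = ⟨p₁, p₂, c⟩`, `ξ₁ = ⟨p₀, p₂, b⟩` and
`ξ₂ = ⟨p₀, p₁, a⟩`, where `a`, `b`, `c` represent the intersections of the tangent lines at the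
vertices. -/
structure IsFrame (X : Set V) (Θ : Set (Submodule K V)) (ξ₀ ξ₁ ξ₂ : Submodule K V)
    (p₀ p₁ p₂ a b c : V) : Prop where
  mem₀ : ξ₀ ∈ Θ
  mem₁ : ξ₁ ∈ Θ
  mem₂ : ξ₂ ∈ Θ
  base₀ : p₀ ∈ X
  base₁ : p₁ ∈ X
  base₂ : p₂ ∈ X
  eq₀ : ξ₀ = Submodule.span K {p₁, p₂, c}
  eq₁ : ξ₁ = Submodule.span K {p₀, p₂, b}
  eq₂ : ξ₂ = Submodule.span K {p₀, p₁, a}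
  indep : ∀ x₀ x₁ x₂ x₃ x₄ x₅ : K,
    x₀ • p₀ + x₁ • p₁ + x₂ • p₂ + x₃ • a + x₄ • b + x₅ • c = 0 →
      x₀ = 0 ∧ x₁ = 0 ∧ x₂ = 0 ∧ x₃ = 0 ∧ x₄ = 0 ∧ x₅ = 0
  tan₀ : ∀ ζ ∈ Θ, p₀ ∈ ζ → ∀ τ, IsOvalTangent X ζ p₀ τ → τ ≤ Submodule.span K {p₀, a, b}
  tan₁ : ∀ ζ ∈ Θ, p₁ ∈ ζ → ∀ τ, IsOvalTangent X ζ p₁ τ → τ ≤ Submodule.span K {p₁, a, c}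
  tan₂ : ∀ ζ ∈ Θ, p₂ ∈ ζ → ∀ τ, IsOvalTangent X ζ p₂ τ → τ ≤ Submodule.span K {p₂, b, c}
  tangent₀ : IsOvalTangent X ξ₂ p₀ (Submodule.span K {p₀, a})
  tangent₁ : IsOvalTangent X ξ₂ p₁ (Submodule.span K {p₁, a})
  tangent₀' : IsOvalTangent X ξ₁ p₀ (Submodule.span K {p₀, b})
  tangent₂ : IsOvalTangent X ξ₁ p₂ (Submodule.span K {p₂, b})

namespace IsOvalSystem

variable [Module.Finite K V] {X : Set V} {Θ : Set (Submodule K V)}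

/-- The tangent lines at two points of an oval meet in a point off their secant. -/
lemma exists_tangents (h : IsOvalSystem X Θ) {ξ : Submodule K V} (hξ : ξ ∈ Θ) {p q : V}
    (hp : p ∈ X) (hpξ : p ∈ ξ) (hq : q ∈ X) (hqξ : q ∈ ξ) (hqp : q ∉ Submodule.span K {p}) :
    ∃ a : V, ξ = Submodule.span K {p, q, a} ∧ IsOvalTangent X ξ p (Submodule.span K {p, a}) ∧
      IsOvalTangent X ξ q (Submodule.span K {q, a}) := by
  obtain ⟨τ, hτ⟩ := h.tangent ξ hξ p hp hpξ
  obtain ⟨σ, hσ⟩ := h.tangent ξ hξ q hq hqξ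
  have hpq : p ∉ Submodule.span K {q} := fun hc => hqp (single_comm (h.cone.ne_zero _ hp) hc)
  obtain ⟨a, haτ, haσ, ha0⟩ := exists_mem_inf hτ.le hσ.le (by
    rw [hτ.rank, hσ.rank, h.rank ξ hξ]; omega)
  have hap : a ∉ Submodule.span K {p} := fun hc =>
    hσ.notMem hp hpq (single_le haσ (single_comm ha0 hc))
  have haq : a ∉ Submodule.span K {q} := fun hc =>
    hτ.notMem hq hqp (single_le haτ (single_comm ha0 hc))
  have hapq : a ∉ Submodule.span K {p, q} := by
    intro hc
    obtain ⟨k, l, hkl⟩ := mem_pair.1 hc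
    have hl : l = 0 := by
      by_contra hl
      refine hτ.notMem hq hqp ((τ.smul_mem_iff hl).1 ?_)
      rw [show l • q = a - k • p by rw [hkl]; abel]
      exact τ.sub_mem haτ (τ.smul_mem _ hτ.base)
    exact hap (mem_single.2 ⟨k, by rw [hkl, hl]; simp⟩)
  refine ⟨a, ?_, ?_, ?_⟩
  · refine (Submodule.eq_of_le_of_finrank_eq ?_ ?_).symm
    · rw [Submodule.span_le]
      rintro x (rfl | rfl | rfl)
      exacts [hpξ, hqξ, hτ.le haτ]
    · have : ({p, q, a} : Set V) = insert a {p, q} := by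
        ext x; simp only [Set.mem_insert_iff, Set.mem_singleton_iff]; tauto
      rw [this, Submodule.span_insert, sup_comm, Submodule.finrank_sup_span_singleton hapq,
        finrank_pair (h.cone.ne_zero _ hp) hqp, h.rank ξ hξ]
  · rw [← hτ.eq_pair (h.cone.ne_zero _ hp) haτ hap]; exact hτ
  · rw [← hσ.eq_pair (h.cone.ne_zero _ hq) haσ haq]; exact hσ

/-- All tangent lines at a point lie in one plane. -/
lemma tangent_le_span (h : IsOvalSystem X Θ) {ξ₁ ξ₂ ζ τ : Submodule K V} (h₁ : ξ₁ ∈ Θ)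
    (h₂ : ξ₂ ∈ Θ) (hne : ξ₁ ≠ ξ₂) {p a b : V} (hp : p ∈ X)
    (hb : IsOvalTangent X ξ₁ p (Submodule.span K {p, b}))
    (ha : IsOvalTangent X ξ₂ p (Submodule.span K {p, a})) (hζ : ζ ∈ Θ) (hpζ : p ∈ ζ)
    (hτ : IsOvalTangent X ζ p τ) : τ ≤ Submodule.span K {p, a, b} := by
  have hp₁ := hb.le hb.base
  have hp₂ := ha.le ha.base
  by_cases e₁ : ζ = ξ₁
  · subst e₁
    rw [hb.unique hτ]
    exact Submodule.span_mono (by rintro x (rfl | rfl) <;> simp)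
  by_cases e₂ : ζ = ξ₂
  · subst e₂
    rw [ha.unique hτ]
    exact Submodule.span_mono (by rintro x (rfl | rfl) <;> simp)
  intro u hu
  obtain ⟨x₁, hx₁, t₂, ht₂, e⟩ := Submodule.mem_sup.1
    (h.tangent_le h₁ h₂ hne.symm hζ e₁ hp hp₁ hp₂ hpζ ha hτ hu)
  obtain ⟨x₂, hx₂, t₁, ht₁, e'⟩ := Submodule.mem_sup.1
    (h.tangent_le h₂ h₁ hne hζ e₂ hp hp₂ hp₁ hpζ hb hτ hu)
  have h1 : x₁ - t₁ = x₂ - t₂ := by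
    rw [sub_eq_sub_iff_add_eq_add, e, e']
  obtain ⟨k, hk⟩ := mem_single.1 (h.inter _ h₁ _ h₂ hne p hp hp₁ hp₂ _
    (ξ₁.sub_mem hx₁ (hb.le ht₁)) (h1 ▸ ξ₂.sub_mem hx₂ (ha.le ht₂)))
  obtain ⟨m, n, rfl⟩ := mem_pair.1 ht₁
  obtain ⟨m', n', rfl⟩ := mem_pair.1 ht₂
  refine mem_triple.2 ⟨k + m + m', n', n, ?_⟩
  rw [← e, sub_eq_iff_eq_add.1 hk]
  match_scalars <;> noncomm_ring

lemma exists_isFrame (h : IsOvalSystem X Θ) {ξ₀ : Submodule K V} (h₀ : ξ₀ ∈ Θ) :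
    ∃ ξ₁ ξ₂ p₀ p₁ p₂ a b c, IsFrame X Θ ξ₀ ξ₁ ξ₂ p₀ p₁ p₂ a b c := by
  obtain ⟨p₁, hp₁, hp₁ξ⟩ := h.nonempty _ h₀
  obtain ⟨p₂, hp₂, hp₂ξ, h21⟩ := h.exists_ne h₀ hp₁ hp₁ξ
  obtain ⟨p₀, hp₀, hp₀ξ⟩ := h.exists_notMem _ h₀
  obtain ⟨ξ₁, h₁, h01, h21'⟩ := h.join p₀ hp₀ p₂ hp₂
  obtain ⟨ξ₂, h₂, h02, h12⟩ := h.join p₀ hp₀ p₁ hp₁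
  have ne₁ : ξ₁ ≠ ξ₀ := by rintro rfl; exact hp₀ξ h01
  have ne₂ : ξ₂ ≠ ξ₀ := by rintro rfl; exact hp₀ξ h02
  have ne : ξ₁ ≠ ξ₂ := by
    rintro rfl
    exact ne₁ (h.eq_of_mem h₁ h₀ hp₁ h12 hp₁ξ h21' hp₂ξ h21)
  have h10 : p₁ ∉ Submodule.span K {p₀} := fun hc =>
    hp₀ξ (single_le hp₁ξ (single_comm (h.cone.ne_zero _ hp₁) hc))
  have h20 : p₂ ∉ Submodule.span K {p₀} := fun hc =>
    hp₀ξ (single_le hp₂ξ (single_comm (h.cone.ne_zero _ hp₂) hc))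
  obtain ⟨c, e₀, t₁', t₂'⟩ := h.exists_tangents h₀ hp₁ hp₁ξ hp₂ hp₂ξ h21
  obtain ⟨b, e₁, t₀', t₂⟩ := h.exists_tangents h₁ hp₀ h01 hp₂ h21' h20
  obtain ⟨a, e₂, t₀, t₁⟩ := h.exists_tangents h₂ hp₀ h02 hp₁ h12 h10
  have hind : LinearIndependent K ![p₀, p₁, p₂, a, b, c] := by
    rw [linearIndependent_iff_card_eq_finrank_span]
    refine le_antisymm ?_ (finrank_range_le_card _)
    have hm : ∀ i, ![p₀, p₁, p₂, a, b, c] i ∈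
        Submodule.span K (Set.range ![p₀, p₁, p₂, a, b, c]) :=
      fun i => Submodule.subset_span ⟨i, rfl⟩
    have l₀ : ξ₀ ≤ Submodule.span K (Set.range ![p₀, p₁, p₂, a, b, c]) := by
      rw [e₀, Submodule.span_le]
      rintro x (rfl | rfl | rfl)
      exacts [hm 1, hm 2, hm 5]
    have l₁ : ξ₁ ≤ Submodule.span K (Set.range ![p₀, p₁, p₂, a, b, c]) := by
      rw [e₁, Submodule.span_le]
      rintro x (rfl | rfl | rfl)
      exacts [hm 0, hm 2, hm 4]
    have l₂ : ξ₂ ≤ Submodule.span K (Set.range ![p₀, p₁, p₂, a, b, c]) := by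
      rw [e₂, Submodule.span_le]
      rintro x (rfl | rfl | rfl)
      exacts [hm 0, hm 1, hm 3]
    have h5 := h.finrank_sup h₀ h₁ ne₁.symm
    obtain ⟨z, hz, hzξ, hz0, hz1, -⟩ := h.exists_fourth h₂ hp₀ h02 hp₁ h12 h10 p₀
    have hz' : z ∉ ξ₀ ⊔ ξ₁ := by
      intro hc
      rcases h.mem_or_mem h₀ h₁ ne₁.symm hz hc with h3 | h3
      · exact hz1 (h.inter _ h₂ _ h₀ ne₂ p₁ hp₁ h12 hp₁ξ z hzξ h3)
      · exact hz0 (h.inter _ h₂ _ h₁ ne.symm p₀ hp₀ h02 h01 z hzξ h3)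
    have h6 := Submodule.finrank_mono (sup_le (sup_le l₀ l₁) (single_le (l₂ hzξ)))
    rw [Submodule.finrank_sup_span_singleton hz', h5] at h6
    simpa [Set.finrank] using h6
  refine ⟨ξ₁, ξ₂, p₀, p₁, p₂, a, b, c, h₀, h₁, h₂, hp₀, hp₁, hp₂, e₀, e₁, e₂, ?_,
    fun ζ hζ hpζ τ hτ => h.tangent_le_span h₁ h₂ ne hp₀ t₀' t₀ hζ hpζ hτ,
    fun ζ hζ hpζ τ hτ => h.tangent_le_span h₀ h₂ ne₂.symm hp₁ t₁' t₁ hζ hpζ hτ,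
    fun ζ hζ hpζ τ hτ => h.tangent_le_span h₀ h₁ ne₁.symm hp₂ t₂' t₂ hζ hpζ hτ, t₀, t₁, t₀', t₂⟩
  intro x₀ x₁ x₂ x₃ x₄ x₅ hx
  have h1 := Fintype.linearIndependent_iff.1 hind ![x₀, x₁, x₂, x₃, x₄, x₅] (by
    rw [Fin.sum_univ_six]; exact hx)
  exact ⟨h1 0, h1 1, h1 2, h1 3, h1 4, h1 5⟩

end IsOvalSystem

namespace IsFrame

variable {X : Set V} {Θ : Set (Submodule K V)} {ξ₀ ξ₁ ξ₂ : Submodule K V}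
  {p₀ p₁ p₂ a b c : V}

lemma swap (F : IsFrame X Θ ξ₀ ξ₁ ξ₂ p₀ p₁ p₂ a b c) :
    IsFrame X Θ ξ₀ ξ₂ ξ₁ p₀ p₂ p₁ b a c where
  mem₀ := F.mem₀
  mem₁ := F.mem₂
  mem₂ := F.mem₁
  base₀ := F.base₀
  base₁ := F.base₂
  base₂ := F.base₁
  eq₀ := by rw [F.eq₀, Set.insert_comm]
  eq₁ := F.eq₂
  eq₂ := F.eq₁
  indep := by
    intro x₀ x₁ x₂ x₃ x₄ x₅ hx
    obtain ⟨h0, h1, h2, h3, h4, h5⟩ := F.indep x₀ x₂ x₁ x₄ x₃ x₅ (by rw [← hx]; abel)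
    exact ⟨h0, h2, h1, h4, h3, h5⟩
  tan₀ := by
    intro ζ hζ hp τ hτ
    rw [Set.pair_comm]
    exact F.tan₀ ζ hζ hp τ hτ
  tan₁ := F.tan₂
  tan₂ := F.tan₁
  tangent₀ := F.tangent₀'
  tangent₁ := F.tangent₂
  tangent₀' := F.tangent₀
  tangent₂ := F.tangent₁

lemma coord_eq (F : IsFrame X Θ ξ₀ ξ₁ ξ₂ p₀ p₁ p₂ a b c)
    {x₀ x₁ x₂ x₃ x₄ x₅ y₀ y₁ y₂ y₃ y₄ y₅ : K}
    (h : x₀ • p₀ + x₁ • p₁ + x₂ • p₂ + x₃ • a + x₄ • b + x₅ • c =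
      y₀ • p₀ + y₁ • p₁ + y₂ • p₂ + y₃ • a + y₄ • b + y₅ • c) :
    x₀ = y₀ ∧ x₁ = y₁ ∧ x₂ = y₂ ∧ x₃ = y₃ ∧ x₄ = y₄ ∧ x₅ = y₅ := by
  have h1 := F.indep (x₀ - y₀) (x₁ - y₁) (x₂ - y₂) (x₃ - y₃) (x₄ - y₄) (x₅ - y₅) (by
    rw [← sub_eq_zero] at h
    rw [← h]
    simp only [sub_smul]; abel)
  simpa only [sub_eq_zero] using h1

lemma coord_of_mem₀ (F : IsFrame X Θ ξ₀ ξ₁ ξ₂ p₀ p₁ p₂ a b c) {x₀ x₁ x₂ x₃ x₄ x₅ : K}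
    (h : x₀ • p₀ + x₁ • p₁ + x₂ • p₂ + x₃ • a + x₄ • b + x₅ • c ∈ ξ₀) :
    x₀ = 0 ∧ x₃ = 0 ∧ x₄ = 0 := by
  rw [F.eq₀] at h
  obtain ⟨k, l, m, hx⟩ := mem_triple.1 h
  obtain ⟨h0, -, -, h3, h4, -⟩ := F.coord_eq (y₀ := 0) (y₁ := k) (y₂ := l) (y₃ := 0) (y₄ := 0)
    (y₅ := m) (by rw [hx]; simp)
  exact ⟨h0, h3, h4⟩

variable [Module.Finite K V]

/-- The points off `ξ₀` in one plane through `p₂`. -/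
lemma exists_chart (F : IsFrame X Θ ξ₀ ξ₁ ξ₂ p₀ p₁ p₂ a b c) (h : IsOvalSystem X Θ) (l : K) :
    ∃ f k : K, ∀ m : K, ∃ s : K,
      (1 : K) • p₀ + f • p₁ + s • p₂ + l • a + m • b + (m * k) • c ∈ X := by
  obtain ⟨f, hf⟩ := F.tangent₁.lift (p₀ + l • a)
    (by rw [F.eq₂]; exact mem_triple.2 ⟨1, 0, l, by simp⟩) (fun hc => by
      obtain ⟨m, n, hmn⟩ := mem_pair.1 hc
      have := F.coord_eq (x₀ := 1) (x₁ := 0) (x₂ := 0) (x₃ := l) (x₄ := 0) (x₅ := 0)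
        (y₀ := 0) (y₁ := m) (y₂ := 0) (y₃ := n) (y₄ := 0) (y₅ := 0) (by
          simpa using hmn)
      exact one_ne_zero this.1)
  obtain ⟨ζ, hζ, hqζ, hpζ⟩ := h.join _ hf p₂ F.base₂
  have hp₂ : p₂ ∈ ξ₀ := by rw [F.eq₀]; exact Submodule.subset_span (by simp)
  have hq₀ : p₀ + l • a + f • p₁ ∉ ξ₀ := by
    intro hc
    have := F.coord_of_mem₀ (x₀ := 1) (x₁ := f) (x₂ := 0) (x₃ := l) (x₄ := 0) (x₅ := 0) (by
      convert hc using 1; match_scalars <;> simp)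
    exact one_ne_zero this.1
  have hζ₀ : ζ ≠ ξ₀ := by rintro rfl; exact hq₀ hqζ
  obtain ⟨τ, hτ⟩ := h.tangent ζ hζ p₂ F.base₂ hpζ
  obtain ⟨t, ht, htp⟩ := hτ.exists_dir
  obtain ⟨α, β, γ, hte⟩ := mem_triple.1 (F.tan₂ ζ hζ hpζ τ hτ ht)
  have hβ : β ≠ 0 := by
    rintro rfl
    refine htp (h.inter _ hζ _ F.mem₀ hζ₀ p₂ F.base₂ hpζ hp₂ t (hτ.le ht) ?_)
    rw [F.eq₀]
    exact mem_triple.2 ⟨0, α, γ, by rw [hte]; simp⟩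
  refine ⟨f, β⁻¹ * γ, fun m => ?_⟩
  have hqτ := hτ.notMem hf fun hc => hq₀ (single_le hp₂ hc)
  have hmt : (m * β⁻¹) • t ∈ τ := τ.smul_mem _ ht
  obtain ⟨s, hs⟩ := hτ.lift _ (ζ.add_mem hqζ (hτ.le hmt))
    (fun hc => hqτ ((τ.add_mem_iff_left hmt).1 hc))
  refine ⟨m * β⁻¹ * α + s, ?_⟩
  have hb : (m * β⁻¹) • (β • b) = m • b := by rw [smul_smul, mul_assoc, inv_mul_cancel₀ hβ, mul_one]
  rw [hte, smul_add, smul_add, hb] at hs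
  convert hs using 1
  match_scalars <;> noncomm_ring

/-- The residue modulo `ξ₀` of a point off `ξ₀`. -/
lemma exists_residue (F : IsFrame X Θ ξ₀ ξ₁ ξ₂ p₀ p₁ p₂ a b c) (h : IsOvalSystem X Θ) {p : V}
    (hp : p ∈ X) (hp₀ : p ∉ ξ₀) :
    ∃ k l m : K, k ≠ 0 ∧ k • p - (p₀ + l • a + m • b) ∈ ξ₀ := by
  have hp₂ : p₂ ∈ ξ₀ := by rw [F.eq₀]; exact Submodule.subset_span (by simp)
  have hp₁ : p₁ ∈ ξ₀ := by rw [F.eq₀]; exact Submodule.subset_span (by simp)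
  have h21 : p₂ ∉ Submodule.span K {p₁} := by
    intro hc
    obtain ⟨k, hk⟩ := mem_single.1 hc
    have := F.coord_eq (x₀ := 0) (x₁ := 0) (x₂ := 1) (x₃ := 0) (x₄ := 0) (x₅ := 0)
        (y₀ := 0) (y₁ := k) (y₂ := 0) (y₃ := 0) (y₄ := 0) (y₅ := 0) (by simpa using hk)
    exact one_ne_zero this.2.2.1
  obtain ⟨ζ, hζ, hpζ, hp₂ζ⟩ := h.join _ hp p₂ F.base₂
  have hζ₀ : ζ ≠ ξ₀ := by rintro rfl; exact hp₀ hpζ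
  obtain ⟨q, hq, hqζ, hq₂⟩ := h.meet ζ hζ ξ₂ F.mem₂
  have hq1 : q ∉ Submodule.span K {p₁} := fun hc => hζ₀ (h.eq_of_mem hζ F.mem₀ F.base₁
    (single_le hqζ (single_comm (h.cone.ne_zero _ hq) hc)) hp₁ hp₂ζ hp₂ h21)
  have hqt := F.tangent₁.notMem hq hq1
  rw [F.eq₂] at hq₂
  obtain ⟨α, β, γ, hqe⟩ := mem_triple.1 hq₂
  have hα : α ≠ 0 := by
    rintro rfl
    exact hqt (mem_pair.2 ⟨β, γ, by rw [hqe]; simp⟩)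
  have hq₀ : q ∉ ξ₀ := by
    intro hc
    rw [hqe] at hc
    have := F.coord_of_mem₀ (x₀ := α) (x₁ := β) (x₂ := 0) (x₃ := γ) (x₄ := 0) (x₅ := 0) (by
      convert hc using 1; match_scalars <;> simp)
    exact hα this.1
  obtain ⟨τ, hτ⟩ := h.tangent ζ hζ p₂ F.base₂ hp₂ζ
  have hqτ := hτ.notMem hq fun hc => hq₀ (single_le hp₂ hc)
  rw [hτ.sup_eq (h.rank _ hζ) hqζ hqτ] at hpζ
  obtain ⟨m, hm⟩ := mem_sup_single.1 hpζ
  have hm0 : m ≠ 0 := by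
    rintro rfl
    rw [zero_smul, sub_zero] at hm
    exact hτ.notMem hp (fun hc => hp₀ (single_le hp₂ hc)) hm
  obtain ⟨x, y, z, hxyz⟩ := mem_triple.1 (F.tan₂ ζ hζ hp₂ζ τ hτ hm)
  have hk : m * α ≠ 0 := mul_ne_zero hm0 hα
  refine ⟨(m * α)⁻¹, (m * α)⁻¹ * (m * γ), (m * α)⁻¹ * y, inv_ne_zero hk, ?_⟩
  rw [F.eq₀]
  refine mem_triple.2 ⟨(m * α)⁻¹ * (m * β), (m * α)⁻¹ * x, (m * α)⁻¹ * z, ?_⟩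
  have h1 : p₀ = (m * α)⁻¹ • (m * α) • p₀ := by rw [inv_smul_smul₀ hk]
  rw [sub_eq_iff_eq_add.1 hxyz, hqe]
  nth_rw 2 [h1]
  match_scalars <;> noncomm_ring

end IsFrame

end VeroneseCoordinates

/-! ### The quadric Veronese surface -/

section VeroneseSurface

variable {K V : Type*} [DivisionRing K] [AddCommGroup V] [Module K V]

/-- The point of the quadric Veronese surface with parameters `x`. -/
def veronesePoint (e : Fin 6 → V) (x : Fin 3 → K) : V :=
  (x 0 * x 0) • e 0 + (x 1 * x 1) • e 1 + (x 2 * x 2) • e 2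
    + (x 0 * x 1) • e 3 + (x 0 * x 2) • e 4 + (x 1 * x 2) • e 5

namespace IsFrame

variable [Module.Finite K V] {X : Set V} {Θ : Set (Submodule K V)} {ξ₀ ξ₁ ξ₂ : Submodule K V}
  {p₀ p₁ p₂ a b c : V}

/-- The points off `ξ₀` in coordinates. The coordinate at `c` is linear in both parameters, which
forces the field to be commutative. -/
lemma exists_parametrization (F : IsFrame X Θ ξ₀ ξ₁ ξ₂ p₀ p₁ p₂ a b c)
    (h : IsOvalSystem X Θ) : (∀ l m : K, l * m = m * l) ∧ ∃ (f g : K → K) (k : K), k ≠ 0 ∧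
      ∀ l m : K, (1 : K) • p₀ + f l • p₁ + g m • p₂ + l • a + m • b + (l * m * k) • c ∈ X := by
  choose f k s hF using fun l => F.exists_chart h l
  choose g k' s' hG using fun l => F.swap.exists_chart h l
  have hfg : ∀ l m, f l = s' m l ∧ s l m = g m ∧ m * k l = l * k' m := by
    intro l m
    have e := h.eq_of_sub_mem F.mem₀ (hF l m) (hG m l) (fun hc => one_ne_zero
      (F.coord_of_mem₀ hc).1) (by
        rw [F.eq₀]
        exact mem_triple.2 ⟨f l - s' m l, s l m - g m, m * k l - l * k' m, by
          match_scalars <;> noncomm_ring⟩)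
    obtain ⟨-, h1, h2, -, -, h5⟩ := F.coord_eq (y₀ := 1) (y₁ := s' m l) (y₂ := g m) (y₃ := l)
      (y₄ := m) (y₅ := l * k' m) (by rw [e]; abel)
    exact ⟨h1, h2, h5⟩
  have hk : ∀ l, k l = l * k' 1 := fun l => by simpa using (hfg l 1).2.2
  have hk' : ∀ m, k' m = m * k' 1 := fun m => by
    have h1 := (hfg 1 m).2.2
    rw [hk 1, one_mul, one_mul] at h1
    exact h1.symm
  have hX : ∀ l m : K,
      (1 : K) • p₀ + f l • p₁ + g m • p₂ + l • a + m • b + (m * (l * k' 1)) • c ∈ X := by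
    intro l m
    have := hF l m
    rwa [(hfg l m).2.1, hk l] at this
  have hk0 : k' 1 ≠ 0 := by
    intro h0
    have h1 := hX 1 1
    rw [h0] at h1
    have hne : ξ₁ ≠ ξ₂ := by
      intro he
      have h2 : a ∈ ξ₁ := by rw [he, F.eq₂]; exact Submodule.subset_span (by simp)
      rw [F.eq₁] at h2
      obtain ⟨x, y, z, hxyz⟩ := mem_triple.1 h2
      have := F.coord_eq (x₀ := 0) (x₁ := 0) (x₂ := 0) (x₃ := 1) (x₄ := 0) (x₅ := 0)
        (y₀ := x) (y₁ := 0) (y₂ := y) (y₃ := 0) (y₄ := z) (y₅ := 0) (by simpa using hxyz)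
      exact one_ne_zero this.2.2.2.1
    rcases h.mem_or_mem F.mem₁ F.mem₂ hne h1 (Submodule.mem_sup.2
      ⟨(1 : K) • p₀ + g 1 • p₂ + (1 : K) • b, by
        rw [F.eq₁]; exact mem_triple.2 ⟨1, g 1, 1, rfl⟩,
        (0 : K) • p₀ + f 1 • p₁ + (1 : K) • a, by
        rw [F.eq₂]; exact mem_triple.2 ⟨0, f 1, 1, rfl⟩, by match_scalars <;> simp⟩) with h2 | h2
    · rw [F.eq₁] at h2
      obtain ⟨x, y, z, hxyz⟩ := mem_triple.1 h2
      have := F.coord_eq (y₀ := x) (y₁ := 0) (y₂ := y) (y₃ := 0) (y₄ := z) (y₅ := 0)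
        (by rw [hxyz]; simp)
      exact one_ne_zero this.2.2.2.1
    · rw [F.eq₂] at h2
      obtain ⟨x, y, z, hxyz⟩ := mem_triple.1 h2
      have := F.coord_eq (y₀ := x) (y₁ := y) (y₂ := 0) (y₃ := z) (y₄ := 0) (y₅ := 0)
        (by rw [hxyz]; simp)
      exact one_ne_zero this.2.2.2.2.1
  have hcomm : ∀ l m : K, l * m = m * l := by
    intro l m
    have h1 := (hfg l m).2.2
    rw [hk l, hk' m, ← mul_assoc, ← mul_assoc] at h1
    exact (mul_right_cancel₀ hk0 h1).symm
  refine ⟨hcomm, f, g, k' 1, hk0, fun l m => ?_⟩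
  rw [hcomm l m, mul_assoc]
  exact hX l m

variable {f g : K → K} {k : K}

/-- The plane of the system joining `p₀` to a point off `ξ₀`, and its common point with `ξ₀`. -/
lemma exists_meet (F : IsFrame X Θ ξ₀ ξ₁ ξ₂ p₀ p₁ p₂ a b c) (h : IsOvalSystem X Θ)
    (hF : ∀ l m : K, (1 : K) • p₀ + f l • p₁ + g m • p₂ + l • a + m • b + (l * m * k) • c ∈ X)
    {l m : K} (hlm : l ≠ 0 ∨ m ≠ 0) :
    ∃ ζ ∈ Θ, p₀ ∈ ζ ∧ l • a + m • b ∈ ζ ∧ f l • p₁ + g m • p₂ + (l * m * k) • c ∈ ζ ∧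
      f l • p₁ + g m • p₂ + (l * m * k) • c ∈ X := by
  obtain ⟨ζ, hζ, hp, hq⟩ := h.join p₀ F.base₀ _ (hF l m)
  have hζ₀ : ζ ≠ ξ₀ := by
    rintro rfl
    exact one_ne_zero (F.coord_of_mem₀ hq).1
  obtain ⟨r, hr, hrζ, hr₀⟩ := h.meet ζ hζ ξ₀ F.mem₀
  obtain ⟨τ, hτ⟩ := h.tangent ζ hζ p₀ F.base₀ hp
  have hqτ := hτ.notMem (hF l m) (by
    intro hc
    obtain ⟨x, hx⟩ := mem_single.1 hc
    have := F.coord_eq (y₀ := x) (y₁ := 0) (y₂ := 0) (y₃ := 0) (y₄ := 0) (y₅ := 0)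
      (by rw [hx]; simp)
    exact hlm.elim (fun h0 => h0 this.2.2.2.1) fun h0 => h0 this.2.2.2.2.1)
  have hrζ' := hrζ
  rw [hτ.sup_eq (h.rank _ hζ) hq hqτ] at hrζ'
  obtain ⟨x, hx⟩ := mem_sup_single.1 hrζ'
  obtain ⟨u, v, w, huvw⟩ := mem_triple.1 (F.tan₀ ζ hζ hp τ hτ hx)
  have hre := sub_eq_iff_eq_add.1 huvw
  have hx0 : x ≠ 0 := by
    rintro rfl
    rw [zero_smul, sub_zero] at hx
    have h1 := single_comm (h.cone.ne_zero _ hr) (hτ.only _ hr hx)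
    have := F.coord_of_mem₀ (x₀ := 1) (x₁ := 0) (x₂ := 0) (x₃ := 0) (x₄ := 0) (x₅ := 0)
      (by simpa using single_le hr₀ h1)
    exact one_ne_zero this.1
  have hr0 := hr₀
  rw [hre] at hr0
  obtain ⟨h0, h3, h4⟩ := F.coord_of_mem₀ (x₀ := u + x) (x₁ := x * f l) (x₂ := x * g m)
    (x₃ := v + x * l) (x₄ := w + x * m) (x₅ := x * (l * m * k)) (by
      convert hr0 using 1; match_scalars <;> noncomm_ring)
  have hrx : r = x • (f l • p₁ + g m • p₂ + (l * m * k) • c) := by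
    have : r = (u + x) • p₀ + (v + x * l) • a + (w + x * m) • b +
        x • (f l • p₁ + g m • p₂ + (l * m * k) • c) := by
      rw [hre]; match_scalars <;> noncomm_ring
    rw [this, h0, h3, h4]; simp
  have hrX : f l • p₁ + g m • p₂ + (l * m * k) • c ∈ X := by
    have := h.cone.smul_mem x⁻¹ (inv_ne_zero hx0) r hr
    rwa [hrx, inv_smul_smul₀ hx0] at this
  have hrz : f l • p₁ + g m • p₂ + (l * m * k) • c ∈ ζ := by
    rw [hrx] at hrζ
    exact (ζ.smul_mem_iff hx0).1 hrζ
  refine ⟨ζ, hζ, hp, ?_, hrz, hrX⟩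
  have e : l • a + m • b = ((1 : K) • p₀ + f l • p₁ + g m • p₂ + l • a + m • b +
      (l * m * k) • c) - p₀ - (f l • p₁ + g m • p₂ + (l * m * k) • c) := by
    rw [one_smul]; abel
  rw [e]
  exact ζ.sub_mem (ζ.sub_mem hq hp) hrz

/-- The other points of the plane joining `p₀` to the point with parameters `1`, `1`. -/
lemma eq_mul_self (F : IsFrame X Θ ξ₀ ξ₁ ξ₂ p₀ p₁ p₂ a b c) (h : IsOvalSystem X Θ) (hk : k ≠ 0)
    (hF : ∀ l m : K, (1 : K) • p₀ + f l • p₁ + g m • p₂ + l • a + m • b + (l * m * k) • c ∈ X)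
    (l : K) : f l = l * l * f 1 ∧ g l = l * l * g 1 := by
  obtain ⟨ζ, hζ, hp, hab, hr, hrX⟩ := F.exists_meet h hF (l := 1) (m := 1) (Or.inl one_ne_zero)
  set r := f 1 • p₁ + g 1 • p₂ + ((1 : K) * 1 * k) • c with hrdef
  have hr₀ : r ∈ ξ₀ := by rw [F.eq₀]; exact mem_triple.2 ⟨_, _, _, rfl⟩
  have hp₀ : p₀ ∉ ξ₀ := by
    intro hc
    have := F.coord_of_mem₀ (x₀ := 1) (x₁ := 0) (x₂ := 0) (x₃ := 0) (x₄ := 0) (x₅ := 0)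
      (by simpa using hc)
    exact one_ne_zero this.1
  have hζ₀ : ζ ≠ ξ₀ := by rintro rfl; exact hp₀ hp
  obtain ⟨τ, hτ⟩ := h.tangent ζ hζ r hrX hr
  have hq₀ : (1 : K) • p₀ + f l • p₁ + g l • p₂ + l • a + l • b + (l * l * k) • c ∉ ξ₀ :=
    fun hc => one_ne_zero (F.coord_of_mem₀ hc).1
  have hmζ : p₀ + l • ((1 : K) • a + (1 : K) • b) ∈ ζ := ζ.add_mem hp (ζ.smul_mem _ hab)
  have hmτ : p₀ + l • ((1 : K) • a + (1 : K) • b) ∉ τ := by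
    intro hc
    refine hq₀ (h.mem_of_mem_sup_tangent F.mem₀ hζ hζ₀ hrX hr₀ hr hτ (hF l l)
      (Submodule.mem_sup.2 ⟨f l • p₁ + g l • p₂ + (l * l * k) • c, ?_, _, hc, ?_⟩))
    · rw [F.eq₀]; exact mem_triple.2 ⟨_, _, _, rfl⟩
    · match_scalars <;> simp
  obtain ⟨s, hs⟩ := hτ.lift _ hmζ hmτ
  have e := h.eq_of_sub_mem F.mem₀ (hF l l) hs hq₀ (by
    have : (1 : K) • p₀ + f l • p₁ + g l • p₂ + l • a + l • b + (l * l * k) • c -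
        (p₀ + l • ((1 : K) • a + (1 : K) • b) + s • r) =
        (f l • p₁ + g l • p₂ + (l * l * k) • c) - s • r := by match_scalars <;> noncomm_ring
    rw [this]
    refine ξ₀.sub_mem ?_ (ξ₀.smul_mem _ hr₀)
    rw [F.eq₀]; exact mem_triple.2 ⟨_, _, _, rfl⟩)
  obtain ⟨-, h1, h2, -, -, h5⟩ := F.coord_eq (y₀ := 1) (y₁ := s * f 1) (y₂ := s * g 1)
    (y₃ := l) (y₄ := l) (y₅ := s * k) (by
      rw [e, hrdef]; match_scalars <;> noncomm_ring)
  have hs : s = l * l := (mul_right_cancel₀ hk h5).symm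
  rw [← hs]
  exact ⟨h1, h2⟩

lemma exists_veronese (F : IsFrame X Θ ξ₀ ξ₁ ξ₂ p₀ p₁ p₂ a b c) (h : IsOvalSystem X Θ) :
    (∀ l m : K, l * m = m * l) ∧ ∃ e : Fin 6 → V, LinearIndependent K e ∧
      Submodule.span K (Set.range e) = Submodule.span K X ∧
      ∀ u, u ∈ X ↔ ∃ x : Fin 3 → K, x ≠ 0 ∧ ∃ d : K, d ≠ 0 ∧ u = d • veronesePoint e x := by
  obtain ⟨hcomm, f, g, k, hk, hF⟩ := F.exists_parametrization h
  have hsq := F.eq_mul_self h hk hF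
  have hF0 : (1 : K) • p₀ + f 0 • p₁ + g 0 • p₂ + (0 : K) • a + (0 : K) • b +
      ((0 : K) * 0 * k) • c = p₀ := by
    rw [(hsq 0).1, (hsq 0).2]; simp
  have hf : f 1 ≠ 0 := by
    intro h0
    have h1 := hF 1 0
    have h2 := F.tangent₀.only _ h1 (mem_pair.2 ⟨1, 1, by rw [h0, (hsq 0).2]; simp⟩)
    obtain ⟨x, hx⟩ := mem_single.1 h2
    have := F.coord_eq (y₀ := x) (y₁ := 0) (y₂ := 0) (y₃ := 0) (y₄ := 0) (y₅ := 0)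
      (by rw [hx]; simp)
    exact one_ne_zero this.2.2.2.1
  have hg : g 1 ≠ 0 := by
    intro h0
    have h1 := hF 0 1
    have h2 := F.tangent₀'.only _ h1 (mem_pair.2 ⟨1, 1, by rw [h0, (hsq 0).1]; simp⟩)
    obtain ⟨x, hx⟩ := mem_single.1 h2
    have := F.coord_eq (y₀ := x) (y₁ := 0) (y₂ := 0) (y₃ := 0) (y₄ := 0) (y₅ := 0)
      (by rw [hx]; simp)
    exact one_ne_zero this.2.2.2.2.1
  have hmul : ∀ x y z : K, x * x * (y * z) = (x * y) * (x * z) := fun x y z => by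
    rw [mul_assoc, mul_assoc, ← mul_assoc x y z, hcomm x y, mul_assoc]
  set e : Fin 6 → V := ![p₀, f 1 • p₁, g 1 • p₂, a, b, k • c] with he
  have hve : ∀ x : Fin 3 → K, veronesePoint e x = (x 0 * x 0) • p₀ + (x 1 * x 1) • f 1 • p₁ +
      (x 2 * x 2) • g 1 • p₂ + (x 0 * x 1) • a + (x 0 * x 2) • b + (x 1 * x 2) • k • c :=
    fun x => rfl
  -- points off `ξ₀`
  have hoff : ∀ x : Fin 3 → K, x 0 ≠ 0 → veronesePoint e x = (x 0 * x 0) •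
      ((1 : K) • p₀ + f ((x 0)⁻¹ * x 1) • p₁ + g ((x 0)⁻¹ * x 2) • p₂ + ((x 0)⁻¹ * x 1) • a +
        ((x 0)⁻¹ * x 2) • b + ((x 0)⁻¹ * x 1 * ((x 0)⁻¹ * x 2) * k) • c) := by
    intro x hx
    obtain ⟨l, hl⟩ : ∃ l, l = (x 0)⁻¹ * x 1 := ⟨_, rfl⟩
    obtain ⟨m, hm⟩ : ∃ m, m = (x 0)⁻¹ * x 2 := ⟨_, rfl⟩
    have hl' : x 1 = x 0 * l := by rw [hl, mul_inv_cancel_left₀ hx]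
    have hm' : x 2 = x 0 * m := by rw [hm, mul_inv_cancel_left₀ hx]
    rw [← hl, ← hm, hve, hl', hm', (hsq l).1, (hsq m).2, ← hmul, ← hmul, ← hmul]
    simp only [smul_add, smul_smul, mul_assoc, mul_one]
  -- points on `ξ₀`
  have hon : ∀ x : Fin 3 → K, x 0 = 0 → veronesePoint e x =
      f (x 1) • p₁ + g (x 2) • p₂ + (x 1 * x 2 * k) • c := by
    intro x hx
    rw [hve, hx, (hsq (x 1)).1, (hsq (x 2)).2]
    simp only [smul_smul, zero_mul, zero_smul, zero_add, add_zero]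
  have hmem : ∀ x : Fin 3 → K, x ≠ 0 → veronesePoint e x ∈ X := by
    intro x hx
    by_cases h0 : x 0 = 0
    · rw [hon x h0]
      obtain ⟨-, -, -, -, -, h1⟩ := F.exists_meet h hF (l := x 1) (m := x 2) (by
        by_contra! hc
        exact hx (by ext i; fin_cases i <;> simp [h0, hc.1, hc.2]))
      exact h1
    · rw [hoff x h0]
      exact h.cone.smul_mem _ (mul_ne_zero h0 h0) _ (hF _ _)
  -- every point off `ξ₀` is a multiple of one with first parameter `1`
  have hpar : ∀ u ∈ X, u ∉ ξ₀ → ∃ d l m : K, d ≠ 0 ∧ d • u =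
      (1 : K) • p₀ + f l • p₁ + g m • p₂ + l • a + m • b + (l * m * k) • c := by
    intro u hu hu₀
    obtain ⟨d, l, m, hd, hdu⟩ := F.exists_residue h hu hu₀
    refine ⟨d, l, m, hd, h.eq_of_sub_mem F.mem₀ (h.cone.smul_mem d hd u hu) (hF l m)
      (fun hc => hu₀ ((ξ₀.smul_mem_iff hd).1 hc)) ?_⟩
    have : d • u - ((1 : K) • p₀ + f l • p₁ + g m • p₂ + l • a + m • b + (l * m * k) • c) =
        (d • u - (p₀ + l • a + m • b)) - (f l • p₁ + g m • p₂ + (l * m * k) • c) := by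
      rw [one_smul]; abel
    rw [this]
    refine ξ₀.sub_mem hdu ?_
    rw [F.eq₀]; exact mem_triple.2 ⟨_, _, _, rfl⟩
  refine ⟨hcomm, e, ?_, ?_, fun u => ⟨fun hu => ?_, ?_⟩⟩
  · rw [Fintype.linearIndependent_iff]
    intro y hy
    rw [Fin.sum_univ_six] at hy
    obtain ⟨h0, h1, h2, h3, h4, h5⟩ := F.indep (y 0) (y 1 * f 1) (y 2 * g 1) (y 3) (y 4)
      (y 5 * k) (by
        rw [← hy]
        simp only [mul_smul]
        rfl)
    have h1' := (mul_eq_zero.1 h1).resolve_right hf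
    have h2' := (mul_eq_zero.1 h2).resolve_right hg
    have h5' := (mul_eq_zero.1 h5).resolve_right hk
    intro i
    fin_cases i <;> assumption
  · have hle : ∀ ξ ∈ Θ, ξ ≤ Submodule.span K X := fun ξ hξ =>
      h.le_of_points hξ fun u hu _ => Submodule.subset_span hu
    refine le_antisymm (Submodule.span_le.2 ?_) (Submodule.span_le.2 ?_)
    · rintro _ ⟨i, rfl⟩
      have h3 : a ∈ ξ₂ := by rw [F.eq₂]; exact Submodule.subset_span (by simp)
      have h4 : b ∈ ξ₁ := by rw [F.eq₁]; exact Submodule.subset_span (by simp)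
      have h5 : c ∈ ξ₀ := by rw [F.eq₀]; exact Submodule.subset_span (by simp)
      fin_cases i
      exacts [Submodule.subset_span F.base₀,
        Submodule.smul_mem _ _ (Submodule.subset_span F.base₁),
        Submodule.smul_mem _ _ (Submodule.subset_span F.base₂), hle _ F.mem₂ h3,
        hle _ F.mem₁ h4, Submodule.smul_mem _ _ (hle _ F.mem₀ h5)]
    · have hm : ∀ i, e i ∈ Submodule.span K (Set.range e) :=
        fun i => Submodule.subset_span ⟨i, rfl⟩
      have h1 : p₁ ∈ Submodule.span K (Set.range e) := (Submodule.smul_mem_iff _ hf).1 (hm 1)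
      have h2 : p₂ ∈ Submodule.span K (Set.range e) := (Submodule.smul_mem_iff _ hg).1 (hm 2)
      have h5 : c ∈ Submodule.span K (Set.range e) := (Submodule.smul_mem_iff _ hk).1 (hm 5)
      intro u hu
      by_cases hu₀ : u ∈ ξ₀
      · have : ξ₀ ≤ Submodule.span K (Set.range e) := by
          rw [F.eq₀, Submodule.span_le]
          rintro x (rfl | rfl | rfl) <;> assumption
        exact this hu₀
      · obtain ⟨d, l, m, hd, hdu⟩ := hpar u hu hu₀
        refine (Submodule.smul_mem_iff _ hd).1 ?_
        rw [hdu]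
        exact Submodule.add_mem _ (Submodule.add_mem _ (Submodule.add_mem _ (Submodule.add_mem _
          (Submodule.add_mem _ (Submodule.smul_mem _ _ (hm 0)) (Submodule.smul_mem _ _ h1))
          (Submodule.smul_mem _ _ h2)) (Submodule.smul_mem _ _ (hm 3)))
          (Submodule.smul_mem _ _ (hm 4))) (Submodule.smul_mem _ _ h5)
  · by_cases hu₀ : u ∈ ξ₀
    · -- the plane joining `u` to `p₀` contains a further point, whose parameters give `u`
      obtain ⟨ζ, hζ, hp, huζ⟩ := h.join p₀ F.base₀ u hu
      have hp₀ : p₀ ∉ ξ₀ := by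
        intro hc
        have := F.coord_of_mem₀ (x₀ := 1) (x₁ := 0) (x₂ := 0) (x₃ := 0) (x₄ := 0) (x₅ := 0)
          (by simpa using hc)
        exact one_ne_zero this.1
      have hζ₀ : ζ ≠ ξ₀ := by rintro rfl; exact hp₀ hp
      have hup : u ∉ Submodule.span K {p₀} := fun hc =>
        hp₀ (single_le hu₀ (single_comm (h.cone.ne_zero _ hu) hc))
      obtain ⟨q, hq, hqζ, hqp, hqu, -⟩ := h.exists_fourth hζ F.base₀ hp hu huζ hup p₀
      have hq₀ : q ∉ ξ₀ := fun hc => hqu (h.inter _ hζ _ F.mem₀ hζ₀ u hu huζ hu₀ q hqζ hc)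
      obtain ⟨d, l, m, hd, hdq⟩ := hpar q hq hq₀
      have hlm : l ≠ 0 ∨ m ≠ 0 := by
        by_contra! hc
        refine hqp ((Submodule.smul_mem_iff _ hd).1 ?_)
        rw [hdq, hc.1, hc.2, hF0]
        exact Submodule.mem_span_singleton_self p₀
      obtain ⟨η, hη, hpη, hab, hrη, hrX⟩ := F.exists_meet h hF hlm
      have hqη : d • q ∈ η := by
        have e1 : d • q = p₀ + (f l • p₁ + g m • p₂ + (l * m * k) • c) + (l • a + m • b) := by
          rw [hdq, one_smul]; abel
        rw [e1]
        exact η.add_mem (η.add_mem hpη hrη) hab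
      have hηζ : η = ζ := h.eq_of_mem hη hζ F.base₀ hpη hp ((η.smul_mem_iff hd).1 hqη) hqζ hqp
      subst hηζ
      have hr₀ : f l • p₁ + g m • p₂ + (l * m * k) • c ∈ ξ₀ := by
        rw [F.eq₀]; exact mem_triple.2 ⟨_, _, _, rfl⟩
      obtain ⟨y, hy⟩ := mem_single.1 (h.inter _ hη _ F.mem₀ hζ₀ _ hrX hrη hr₀ u huζ hu₀)
      refine ⟨![0, l, m], ?_, y, ?_, ?_⟩
      · intro hc
        exact hlm.elim (fun h0 => h0 (congrFun hc 1)) fun h0 => h0 (congrFun hc 2)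
      · rintro rfl
        exact h.cone.ne_zero _ hu (by simpa using hy)
      · rw [hon ![0, l, m] rfl]
        exact hy
    · obtain ⟨d, l, m, hd, hdu⟩ := hpar u hu hu₀
      refine ⟨![1, l, m], fun hc => one_ne_zero (congrFun hc 0), d⁻¹, inv_ne_zero hd, ?_⟩
      rw [hoff ![1, l, m] one_ne_zero]
      simp only [Matrix.cons_val_zero, Matrix.cons_val_one, Matrix.cons_val, inv_one, one_mul,
        one_smul] at hdu ⊢
      rw [← hdu, inv_smul_smul₀ hd]
  · rintro ⟨x, hx, d, hd, rfl⟩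
    exact h.cone.smul_mem d hd _ (hmem x hx)

end IsFrame

end VeroneseSurface

/-! ### Systems in which all tubes have the same vertex -/

section CommonVertex

variable {K V : Type*} [DivisionRing K] [AddCommGroup V] [Module K V]

namespace IsHVSystem

variable {X Y : Set V} {Ξ : Set (Submodule K V)} {t : V} {W : Submodule K V}

lemma mem_single_of_mem_complement (htW : t ∉ W) {a b : V} (ha : a ∈ W) (hb : b ∈ W)
    (hab : b ∈ Submodule.span K {a, t}) : b ∈ Submodule.span K {a} := by
  obtain ⟨k, l, rfl⟩ := mem_pair.1 hab
  have hl : l = 0 := by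
    by_contra hl
    exact htW ((W.smul_mem_iff hl).1 ((W.add_mem_iff_right (W.smul_mem k ha)).1 hb))
  exact mem_single.2 ⟨k, by rw [hl]; simp⟩

lemma mem_Y_iff (h : IsHVSystem X Y Ξ) (ht : t ∈ Y)
    (hrad : ∀ x ∈ X, rad (K := K) X Y x = Submodule.span K {t}) {y : V} :
    y ∈ Y ↔ ∃ c : K, c ≠ 0 ∧ y = c • t := by
  constructor
  · intro hy
    obtain ⟨ξ, hξ, hv⟩ := h.vertex y hy
    obtain ⟨a, ha, haξ⟩ := hv.nonempty
    have h1 := h.vertex_mem_rad hξ hv ha haξ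
    rw [hrad a ha] at h1
    obtain ⟨c, rfl⟩ := mem_single.1 h1
    exact ⟨c, by rintro rfl; exact hv.ne_zero (by simp), rfl⟩
  · rintro ⟨c, hc, rfl⟩
    exact h.coneY.smul_mem c hc t ht

lemma tube_common (h : IsHVSystem X Y Ξ) (ht : t ∈ Y)
    (hrad : ∀ x ∈ X, rad (K := K) X Y x = Submodule.span K {t}) {ξ : Submodule K V}
    (hξ : ξ ∈ Ξ) : IsVTube X ξ t := by
  obtain ⟨v, hv, htv⟩ := h.tube ξ hξ
  obtain ⟨c, hc, rfl⟩ := (h.mem_Y_iff ht hrad).1 hv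
  exact h.tube_of_mem hξ ht ((ξ.smul_mem_iff hc).1 htv.mem)

/-- If all tubes have the vertex `t`, a hyperplane off `t` meets them in a system of ovals. -/
lemma isOvalSystem (h : IsHVSystem X Y Ξ) (ht : t ∈ Y)
    (hrad : ∀ x ∈ X, rad (K := K) X Y x = Submodule.span K {t}) (htW : t ∉ W)
    (hW : ∀ u : V, ∃ c : K, u + c • t ∈ W) :
    IsOvalSystem {u | u ∈ X ∧ u ∈ W} {η | ∃ ξ ∈ Ξ, η = ξ ⊓ W} := by
  have := h.finite
  have htube : ∀ ξ ∈ Ξ, IsVTube X ξ t := fun ξ hξ => h.tube_common ht hrad hξ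
  -- intersecting with `W` lowers the rank of a subspace through `t` by one
  have hrank : ∀ U : Submodule K V, t ∈ U → finrank K (U ⊓ W : Submodule K V) + 1 =
      finrank K U := by
    intro U htU
    have h1 : U = (U ⊓ W) ⊔ Submodule.span K {t} := by
      refine le_antisymm (fun u hu => ?_) (sup_le inf_le_left (single_le htU))
      obtain ⟨c, hc⟩ := hW u
      exact mem_sup_single.2 ⟨-c, by
        rw [neg_smul, sub_neg_eq_add]
        exact ⟨U.add_mem hu (U.smul_mem c htU), hc⟩⟩
    conv_rhs => rw [h1]
    rw [Submodule.finrank_sup_span_singleton (show t ∉ U ⊓ W from fun hc => htW hc.2)]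
  have hne : ∀ a ∈ X, a ∉ Submodule.span K {t} := fun a ha => by
    rw [← hrad a ha]; exact h.self_notMem_rad ha
  have hsing : ∀ a ∈ X, ∀ b, b ∈ sing (K := K) X Y a → b ∈ Submodule.span K {a, t} := by
    intro a ha b hb
    obtain ⟨k, r, hr, rfl⟩ := mem_sing.1 hb
    rw [hrad a ha] at hr
    exact Submodule.add_mem _ (Submodule.smul_mem _ _ (left_mem_pair a t))
      (single_le_right a t hr)
  have hshift : ∀ a ∈ X, ∃ c : K, a + c • t ∈ X ∧ a + c • t ∈ W := by
    intro a ha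
    obtain ⟨c, hc⟩ := hW a
    refine ⟨c, h.add_rad_mem ha ?_, hc⟩
    rw [hrad a ha]; exact smul_mem_single t c
  refine ⟨h.card, ⟨fun u hu => h.coneX.ne_zero u hu.1,
    fun c hc u hu => ⟨h.coneX.smul_mem c hc u hu.1, W.smul_mem c hu.2⟩⟩, ?_, ?_, ?_, ?_, ?_, ?_,
    ?_, ?_⟩
  · rintro _ ⟨ξ, hξ, rfl⟩
    have h1 := hrank ξ (htube ξ hξ).mem
    rw [(htube ξ hξ).rank] at h1
    omega
  · rintro _ ⟨ξ, hξ, rfl⟩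
    obtain ⟨a, ha, haξ⟩ := (htube ξ hξ).nonempty
    obtain ⟨c, hc, hcW⟩ := hshift a ha
    exact ⟨_, ⟨hc, hcW⟩, ξ.add_mem haξ (ξ.smul_mem c (htube ξ hξ).mem), hcW⟩
  · rintro a ⟨ha, haW⟩ b ⟨hb, hbW⟩ c ⟨hc, hcW⟩ hm
    obtain ⟨ξ, hξ, haξ, hbξ⟩ := h.join a ha b hb
    obtain ⟨k, l, hkl⟩ := mem_pair.1 hm
    exact ((htube ξ hξ).arc a ha haξ b hb hbξ c hc (mem_triple.2 ⟨k, l, 0, by simp [hkl]⟩)).imp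
      (mem_single_of_mem_complement htW haW hcW) (mem_single_of_mem_complement htW hbW hcW)
  · rintro _ ⟨ξ, hξ, rfl⟩ a ⟨ha, haW⟩ ⟨haξ, -⟩
    obtain ⟨τ, hτ⟩ := (htube ξ hξ).tangent a ha haξ
    refine ⟨τ ⊓ W, inf_le_inf_right W hτ.le, ?_, ⟨hτ.base, haW⟩, ?_, ?_⟩
    · have h1 := hrank τ hτ.vertex
      rw [hτ.rank] at h1
      omega
    · rintro u ⟨hu, huW⟩ ⟨huτ, -⟩
      exact mem_single_of_mem_complement htW haW huW (hτ.only u hu huτ)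
    · rintro g ⟨hg, hgW⟩ hgτ
      obtain ⟨s, hs, hgs⟩ := hτ.lift g hg fun hc => hgτ ⟨hc, hgW⟩
      obtain ⟨k, l, rfl⟩ := mem_pair.1 hs
      refine ⟨k, ?_, W.add_mem hgW (W.smul_mem k haW)⟩
      have h1 := h.add_rad_mem hgs (r := (-l) • t) (by rw [hrad _ hgs]; exact smul_mem_single t _)
      rw [neg_smul] at h1
      convert h1 using 1
      abel
  · rintro x ⟨hx, hxW⟩ y ⟨hy, hyW⟩
    obtain ⟨ξ, hξ, hxξ, hyξ⟩ := h.join x hx y hy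
    exact ⟨ξ ⊓ W, ⟨ξ, hξ, rfl⟩, ⟨hxξ, hxW⟩, ⟨hyξ, hyW⟩⟩
  · rintro _ ⟨ξ₁, h₁, rfl⟩ _ ⟨ξ₂, h₂, rfl⟩
    obtain ⟨a, ha, ha₁, ha₂⟩ := h.exists_common h₁ h₂ (htube ξ₁ h₁) (htube ξ₂ h₂).mem
    obtain ⟨c, hc, hcW⟩ := hshift a ha
    exact ⟨_, ⟨hc, hcW⟩, ⟨ξ₁.add_mem ha₁ (ξ₁.smul_mem c (htube ξ₁ h₁).mem), hcW⟩,
      ⟨ξ₂.add_mem ha₂ (ξ₂.smul_mem c (htube ξ₂ h₂).mem), hcW⟩⟩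
  · rintro _ ⟨ξ₁, h₁, rfl⟩ _ ⟨ξ₂, h₂, rfl⟩ hne12 x ⟨hx, hxW⟩ ⟨hx₁, -⟩ ⟨hx₂, -⟩ u ⟨hu₁, huW⟩ ⟨hu₂, -⟩
    exact mem_single_of_mem_complement htW hxW huW (h.mem_pair_of_mem_two h₁ h₂
      (fun he => hne12 (by rw [he])) (htube ξ₁ h₁) hx hx₁ hx₂ hu₁ hu₂)
  · rintro _ ⟨ξ, hξ, rfl⟩
    by_contra! hc
    have h1 : X ⊆ ξ := by
      intro a ha
      obtain ⟨c, hcX, hcW⟩ := hshift a ha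
      exact (ξ.add_mem_iff_left (ξ.smul_mem c (htube ξ hξ).mem)).1 (hc _ ⟨hcX, hcW⟩).1
    have h2 : (⊤ : Submodule K V) ≤ ξ := by rw [← h.span]; exact Submodule.span_le.2 h1
    have h3 := Submodule.finrank_mono h2
    rw [finrank_top, (htube ξ hξ).rank] at h3
    have := h.dim
    omega

/-- If all tubes have the vertex `t`, then `X` consists of the points, other than `t`, of the cone
with vertex `t` over a quadric Veronese surface. -/
lemma exists_veronese (h : IsHVSystem X Y Ξ) (ht : t ∈ Y)
    (hrad : ∀ x ∈ X, rad (K := K) X Y x = Submodule.span K {t}) :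
    finrank K V = 7 ∧ (∀ l m : K, l * m = m * l) ∧ ∃ e : Fin 6 → V, LinearIndependent K e ∧
      t ∉ Submodule.span K (Set.range e) ∧ ∀ u, u ∈ X ↔ ∃ x : Fin 3 → K, x ≠ 0 ∧
        ∃ d c : K, d ≠ 0 ∧ u = d • veronesePoint e x + c • t := by
  have := h.finite
  obtain ⟨W, hcompl⟩ := Submodule.exists_isCompl (Submodule.span K {t})
  have ht0 := h.coneY.ne_zero t ht
  have htW : t ∉ W := fun hc => ht0 ((Submodule.disjoint_def.1 hcompl.disjoint) t
    (Submodule.mem_span_singleton_self t) hc)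
  have hW : ∀ u : V, ∃ c : K, u + c • t ∈ W := by
    intro u
    have h1 : u ∈ W ⊔ Submodule.span K {t} := by
      rw [sup_comm, hcompl.sup_eq_top]; trivial
    obtain ⟨c, hc⟩ := mem_sup_single.1 h1
    exact ⟨-c, by rwa [neg_smul, ← sub_eq_add_neg]⟩
  have hO := h.isOvalSystem ht hrad htW hW
  obtain ⟨x₀, hx₀⟩ := h.nonempty
  obtain ⟨ξ, hξ, -⟩ := h.join x₀ hx₀ x₀ hx₀
  obtain ⟨_, _, _, _, _, _, _, _, F⟩ := hO.exists_isFrame (ξ₀ := ξ ⊓ W) ⟨ξ, hξ, rfl⟩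
  obtain ⟨hcomm, e, hind, hspan, hX⟩ := F.exists_veronese hO
  have heW : Submodule.span K (Set.range e) ≤ W := by
    rw [hspan, Submodule.span_le]
    exact fun u hu => hu.2
  have hadd : ∀ u ∈ X, ∀ c : K, u + c • t ∈ X := fun u hu c =>
    h.add_rad_mem hu (by rw [hrad u hu]; exact smul_mem_single t c)
  have htop : (⊤ : Submodule K V) = Submodule.span K (Set.range e) ⊔ Submodule.span K {t} := by
    refine le_antisymm ?_ le_top
    rw [← h.span, Submodule.span_le]
    intro u hu
    obtain ⟨c, hc⟩ := hW u
    refine mem_sup_single.2 ⟨-c, ?_⟩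
    rw [neg_smul, sub_neg_eq_add, hspan]
    exact Submodule.subset_span ⟨hadd u hu c, hc⟩
  refine ⟨?_, hcomm, e, hind, fun hc => htW (heW hc), fun u => ⟨fun hu => ?_, ?_⟩⟩
  · rw [← finrank_top K V, htop, Submodule.finrank_sup_span_singleton fun hc => htW (heW hc),
      finrank_span_eq_card hind]
    simp
  · obtain ⟨c, hc⟩ := hW u
    obtain ⟨x, hx, d, hd, hu'⟩ := (hX (u + c • t)).1 ⟨hadd u hu c, hc⟩
    exact ⟨x, hx, d, -c, hd, by rw [← hu']; simp⟩
  · rintro ⟨x, hx, d, c, hd, rfl⟩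
    exact hadd _ ((hX _).2 ⟨x, hx, d, hd, rfl⟩).1 c

end IsHVSystem

end CommonVertex

/-! ### From points to vectors -/

section Bridge

variable {K V : Type*} [DivisionRing K] [AddCommGroup V] [Module K V]

/-- The vectors representing the points of `X`. -/
def vecs (X : Set (Projectivization K V)) : Set V :=
  {u | ∃ h : u ≠ 0, Projectivization.mk K u h ∈ X}

lemma mk_mem_pts {W : Submodule K V} {u : V} (h : u ≠ 0) :
    Projectivization.mk K u h ∈ pts W ↔ u ∈ W := by
  rw [pts, Set.mem_ofPred_eq, Projectivization.submodule_mk, Submodule.span_singleton_le_iff_mem]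

lemma rep_mem_iff {W : Submodule K V} {p : Projectivization K V} : p.rep ∈ W ↔ p ∈ pts W := by
  rw [← mk_mem_pts p.rep_nonzero, p.mk_rep]

lemma mk_eq_iff {u w : V} (hu : u ≠ 0) (hw : w ≠ 0) :
    Projectivization.mk K u hu = Projectivization.mk K w hw ↔ u ∈ Submodule.span K {w} := by
  rw [Projectivization.mk_eq_mk_iff', Submodule.mem_span_singleton]

lemma rep_mem_vecs {X : Set (Projectivization K V)} {p : Projectivization K V} :
    p.rep ∈ vecs X ↔ p ∈ X := by
  constructor
  · rintro ⟨h, hp⟩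
    rwa [p.mk_rep] at hp
  · intro hp
    exact ⟨p.rep_nonzero, by rwa [p.mk_rep]⟩

lemma isConeSet_vecs (X : Set (Projectivization K V)) : IsConeSet K (vecs X) := by
  refine ⟨fun u hu => hu.1, fun c hc u hu => ?_⟩
  obtain ⟨h0, hu⟩ := hu
  have h1 : c • u ≠ 0 := smul_ne_zero hc h0
  refine ⟨h1, ?_⟩
  rwa [(mk_eq_iff h1 h0).2 (smul_mem_single u c)]

variable {X : Set (Projectivization K V)} {ξ : Submodule K V} {v : V}

lemma IsTube.isVTube [Module.Finite K V] (hv : v ≠ 0)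
    (h : IsTube ξ (Projectivization.mk K v hv) (X ∩ pts ξ)) : IsVTube (vecs X) ξ v := by
  obtain ⟨h4, hvξ, π, O, hO, hπ, hvπ, hC⟩ := h
  rw [mk_mem_pts] at hvξ hvπ
  have hOπ : ∀ o ∈ vecs O, o ∈ π := fun o ho => (mk_mem_pts ho.1).1 (hO.subset ho.2)
  -- the points of the tube, in terms of the oval
  have key : ∀ u, (u ∈ vecs X ∧ u ∈ ξ) ↔ ∃ o ∈ vecs O, ∃ d : K, u = o + d • v := by
    intro u
    constructor
    · rintro ⟨⟨hu0, hu⟩, huξ⟩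
      have h1 : Projectivization.mk K u hu0 ∈ X ∩ pts ξ := ⟨hu, (mk_mem_pts hu0).2 huξ⟩
      rw [hC] at h1
      obtain ⟨⟨o, ho, hm⟩, hne⟩ := h1
      rw [mk_mem_pts, Projectivization.submodule_mk, o.submodule_eq] at hm
      obtain ⟨d, hd⟩ := mem_sup_single.1 hm
      obtain ⟨c, hc⟩ := mem_single.1 hd
      have hc0 : c ≠ 0 := by
        rintro rfl
        refine hne ((mk_eq_iff hu0 hv).2 (mem_single.2 ⟨d, ?_⟩))
        rw [zero_smul, sub_eq_zero] at hc
        exact hc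
      exact ⟨c • o.rep, (isConeSet_vecs O).smul_mem c hc0 _ (rep_mem_vecs.2 ho), d,
        sub_eq_iff_eq_add.1 hc⟩
    · rintro ⟨o, ho, d, rfl⟩
      have hoπ := hOπ o ho
      have hnv : o + d • v ∉ Submodule.span K {v} := by
        intro hc
        obtain ⟨c, hc⟩ := mem_single.1 ((Submodule.add_mem_iff_left _ (smul_mem_single v d)).1 hc)
        have hc0 : c ≠ 0 := by rintro rfl; exact ho.1 (by simpa using hc)
        exact hvπ ((π.smul_mem_iff hc0).1 (hc ▸ hoπ))
      have h0 : o + d • v ≠ 0 := fun h0 => hnv (h0 ▸ Submodule.zero_mem _)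
      have h1 : Projectivization.mk K (o + d • v) h0 ∈ X ∩ pts ξ := by
        rw [hC]
        refine ⟨⟨Projectivization.mk K o ho.1, ho.2, ?_⟩, fun hc => hnv ((mk_eq_iff h0 hv).1 hc)⟩
        rw [mk_mem_pts, Projectivization.submodule_mk, Projectivization.submodule_mk]
        exact mem_sup_single.2 ⟨d, by simp⟩
      exact ⟨⟨h0, h1.1⟩, (mk_mem_pts h0).1 h1.2⟩
  have hsub : ∀ w ∈ π, ∀ w' ∈ π, ∀ d : K, w - w' = d • v → w = w' := by
    intro w hw w' hw' d hd
    have hd0 : d = 0 := by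
      by_contra hd0
      exact hvπ ((π.smul_mem_iff hd0).1 (hd ▸ π.sub_mem hw hw'))
    rw [hd0, zero_smul, sub_eq_zero] at hd
    exact hd
  have hpair : ∀ (o : V) (d : K), o ∈ Submodule.span K {o + d • v, v} := fun o d =>
    mem_pair.2 ⟨1, -d, by match_scalars <;> simp⟩
  refine ⟨h4, hv, hvξ, ?_, ?_, ?_, ?_, ?_⟩
  · rintro ⟨_, hvX⟩
    have h1 : Projectivization.mk K v hv ∈ X ∩ pts ξ := ⟨hvX, (mk_mem_pts hv).2 hvξ⟩
    rw [hC] at h1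
    exact h1.2 rfl
  · obtain ⟨o, ho⟩ := hO.nonempty
    have h1 := (key o.rep).2 ⟨o.rep, rep_mem_vecs.2 ho, 0, by simp⟩
    exact ⟨o.rep, h1⟩
  · intro a ha haξ c
    obtain ⟨o, ho, d, rfl⟩ := (key a).1 ⟨ha, haξ⟩
    exact ((key _).2 ⟨o, ho, d + c, by rw [add_smul, add_assoc]⟩).1
  · intro a ha haξ b hb hbξ c hc hm
    have hcξ : c ∈ ξ := by
      obtain ⟨p, q, r, rfl⟩ := mem_triple.1 hm
      exact ξ.add_mem (ξ.add_mem (ξ.smul_mem p haξ) (ξ.smul_mem q hbξ)) (ξ.smul_mem r hvξ)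
    obtain ⟨o₁, ho₁, d₁, rfl⟩ := (key a).1 ⟨ha, haξ⟩
    obtain ⟨o₂, ho₂, d₂, rfl⟩ := (key b).1 ⟨hb, hbξ⟩
    obtain ⟨o₃, ho₃, d₃, rfl⟩ := (key c).1 ⟨hc, hcξ⟩
    obtain ⟨p, q, r, hpqr⟩ := mem_triple.1 hm
    have h3 : o₃ = p • o₁ + q • o₂ := by
      refine hsub _ (hOπ _ ho₃) _ (π.add_mem (π.smul_mem p (hOπ _ ho₁))
        (π.smul_mem q (hOπ _ ho₂))) (p * d₁ + q * d₂ + r - d₃) ?_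
      have : o₃ = o₃ + d₃ • v - d₃ • v := by abel
      rw [this, hpqr]
      match_scalars <;> noncomm_ring
    have hlift : ∀ o d, o₃ ∈ Submodule.span K {o} →
        o₃ + d₃ • v ∈ Submodule.span K {o + d • v, v} := fun o d ho =>
      Submodule.add_mem _ (single_le (hpair o d) ho)
        (Submodule.smul_mem _ _ (right_mem_pair _ v))
    by_contra! hc
    have h31 : o₃ ∉ Submodule.span K {o₁} := fun h => hc.1 (hlift _ _ h)
    have h32 : o₃ ∉ Submodule.span K {o₂} := fun h => hc.2 (hlift _ _ h)
    have h21 : o₂ ∉ Submodule.span K {o₁} := fun h => h31 (by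
      rw [h3]
      exact Submodule.add_mem _ (smul_mem_single _ _) (Submodule.smul_mem _ _ h))
    refine hO.no_three _ ho₁.2 _ ho₂.2 _ ho₃.2 ?_ ?_ ?_ (Submodule.span K {o₁, o₂})
      (finrank_pair ho₁.1 h21) ⟨?_, ?_, ?_⟩
    · exact fun he => h21 ((mk_eq_iff ho₂.1 ho₁.1).1 he.symm)
    · exact fun he => h32 ((mk_eq_iff ho₃.1 ho₂.1).1 he.symm)
    · exact fun he => h31 ((mk_eq_iff ho₃.1 ho₁.1).1 he.symm)
    · exact (mk_mem_pts _).2 (left_mem_pair _ _)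
    · exact (mk_mem_pts _).2 (right_mem_pair _ _)
    · exact (mk_mem_pts _).2 (mem_pair.2 ⟨p, q, h3⟩)
  · intro a ha haξ
    obtain ⟨o, ho, d, rfl⟩ := (key a).1 ⟨ha, haξ⟩
    obtain ⟨L, ⟨hL2, hLπ, hLO⟩, huniq⟩ := hO.tangent _ ho.2
    have hoL : o ∈ L := by
      have h1 : Projectivization.mk K o ho.1 ∈ pts L ∩ O := by rw [hLO]; rfl
      exact (mk_mem_pts ho.1).1 h1.1
    refine ⟨L ⊔ Submodule.span K {v}, sup_le (hLπ.trans hπ) (single_le hvξ), ?_, ?_,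
      Submodule.mem_sup_right (Submodule.mem_span_singleton_self v), ?_, ?_⟩
    · rw [Submodule.finrank_sup_span_singleton fun hc => hvπ (hLπ hc), hL2]
    · exact mem_sup_single.2 ⟨d, by simpa using hoL⟩
    · intro u hu huτ
      obtain ⟨o', ho', d', rfl⟩ := (key u).1 ⟨hu,
        (sup_le (hLπ.trans hπ) (single_le hvξ) : L ⊔ Submodule.span K {v} ≤ ξ) huτ⟩
      obtain ⟨c, hc⟩ := mem_sup_single.1 huτ
      have h1 : o' = o' + d' • v - c • v := hsub _ (hOπ _ ho') _ (hLπ hc) (c - d') (by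
        match_scalars <;> noncomm_ring)
      have h2 : Projectivization.mk K o' ho'.1 ∈ pts L ∩ O :=
        ⟨(mk_mem_pts ho'.1).2 (h1 ▸ hc), ho'.2⟩
      rw [hLO] at h2
      exact Submodule.add_mem _ (single_le (hpair o d) ((mk_eq_iff _ _).1 h2))
        (Submodule.smul_mem _ _ (right_mem_pair _ v))
    · intro g hg hgτ
      have hsup : ξ = π ⊔ Submodule.span K {v} := by
        refine (Submodule.eq_of_le_of_finrank_eq (sup_le hπ (single_le hvξ)) ?_).symm
        rw [Submodule.finrank_sup_span_singleton hvπ, hO.plane, h4]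
      rw [hsup] at hg
      obtain ⟨c, hw⟩ := mem_sup_single.1 hg
      obtain ⟨w, hwe⟩ : ∃ w, w = g - c • v := ⟨_, rfl⟩
      rw [← hwe] at hw
      have hge : g = w + c • v := by rw [hwe]; abel
      have hwL : w ∉ L := fun hc => hgτ (mem_sup_single.2 ⟨c, hwe ▸ hc⟩)
      have hwo : w ∉ Submodule.span K {o} := fun hc => hwL (single_le hoL hc)
      -- the line `⟨o, w⟩` is not the tangent, and contains a second point of the oval
      have hex : ∃ o' ∈ vecs O, o' ∈ Submodule.span K {o, w} ∧ o' ∉ Submodule.span K {o} := by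
        by_contra! hc
        refine hwL ?_
        rw [← huniq (Submodule.span K {o, w}) ⟨finrank_pair ho.1 hwo,
          pair_le (hOπ _ ho) hw, ?_⟩]
        · exact right_mem_pair o w
        · ext p
          constructor
          · rintro ⟨hp, hpO⟩
            have h1 := hc _ (rep_mem_vecs.2 hpO) (rep_mem_iff.2 hp)
            rw [Set.mem_singleton_iff, ← p.mk_rep]
            exact (mk_eq_iff p.rep_nonzero ho.1).2 h1
          · rintro rfl
            exact ⟨(mk_mem_pts _).2 (left_mem_pair o w), ho.2⟩
      obtain ⟨o', ho', hm, hne⟩ := hex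
      obtain ⟨α, β, hαβ⟩ := mem_pair.1 hm
      have hβ : β ≠ 0 := by
        rintro rfl
        exact hne (mem_single.2 ⟨α, by rw [hαβ]; simp⟩)
      refine ⟨(β⁻¹ * α) • o, Submodule.smul_mem _ _ (hpair o d), ?_⟩
      refine ((key _).2 ⟨β⁻¹ • o', (isConeSet_vecs O).smul_mem _ (inv_ne_zero hβ) _ ho', c, ?_⟩).1
      rw [hge, hαβ, smul_add, inv_smul_smul₀ hβ, smul_smul]
      abel

lemma IsTangentAt.isTangentPlane {x : V} {τ : Submodule K V} (h : IsVTube (vecs X) ξ v)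
    (hτ : IsTangentAt (vecs X) ξ v x τ) (hx : x ∈ vecs X) :
    IsTangentPlane ξ (Projectivization.mk K v h.ne_zero) (X ∩ pts ξ)
      (Projectivization.mk K x hx.1) τ := by
  refine ⟨hτ.le, hτ.rank, (mk_mem_pts _).2 hτ.base, ?_⟩
  rw [Projectivization.submodule_mk, Projectivization.submodule_mk, ← Submodule.span_union,
    Set.singleton_union]
  ext p
  constructor
  · rintro ⟨hp, hpX, -⟩
    refine ⟨rep_mem_iff.1 (hτ.only _ (rep_mem_vecs.2 hpX) (rep_mem_iff.2 hp)), ?_⟩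
    rintro rfl
    exact h.notMem ⟨h.ne_zero, hpX⟩
  · rintro ⟨hp, hpv⟩
    have hp' := rep_mem_iff.2 hp
    have h1 := h.mem_of_mem_pair (isConeSet_vecs X) hx (hτ.le hτ.base) hp' (fun hc => hpv (by
      rw [Set.mem_singleton_iff, ← p.mk_rep]
      exact (mk_eq_iff _ _).2 hc))
    exact ⟨rep_mem_iff.1 (hτ.pair_le hp'), rep_mem_vecs.1 h1,
      rep_mem_iff.1 (hτ.le (hτ.pair_le hp'))⟩

/-- A Hjelmslevian Veronesean set, in terms of vectors. -/
lemma IsHjelmslevianVeronesean.isHVSystem {Ξ : Set (Submodule K V)} (hK : 2 < ENat.card K)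
    (h : IsHjelmslevianVeronesean X Ξ) : IsHVSystem (vecs X) (vecs (vertexSet X Ξ)) Ξ := by
  have hfin : Module.Finite K V := Module.finite_of_finrank_pos (by have := h.dim; omega)
  have hcard : ∀ a : K, ∃ c : K, c ≠ 0 ∧ c ≠ a := by
    intro a
    by_contra! hc
    have h1 : (Set.univ : Set K) ⊆ {0, a} := fun c _ => by
      by_cases h0 : c = 0
      · exact Or.inl h0
      · exact Or.inr (hc c h0)
    have h2 := (Set.encard_le_encard h1).trans (Set.encard_insert_le {a} 0)
    rw [Set.encard_univ, Set.encard_singleton, one_add_one_eq_two] at h2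
    exact absurd hK (not_lt.2 h2)
  have hspan : Submodule.span K (vecs X) = ⊤ := by
    rw [eq_top_iff, ← h.spanning]
    refine iSup₂_le fun p hp => ?_
    rw [p.submodule_eq]
    exact single_le (Submodule.subset_span (rep_mem_vecs.2 hp))
  have htube : ∀ ξ ∈ Ξ, ∃ v, ∃ h0 : v ≠ 0, IsTube ξ (Projectivization.mk K v h0) (X ∩ pts ξ) := by
    intro ξ hξ
    obtain ⟨-, v, hv⟩ := h.tube ξ hξ
    exact ⟨v.rep, v.rep_nonzero, by rwa [v.mk_rep]⟩
  have hother : ∀ x : V, ∃ z ∈ vecs X, z ∉ Submodule.span K {x} := by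
    intro x
    by_contra! hc
    have h1 : (⊤ : Submodule K V) ≤ Submodule.span K {x} := by
      rw [← hspan]; exact Submodule.span_le.2 hc
    have h2 := (Submodule.finrank_mono h1).trans (finrank_single_le x)
    rw [finrank_top] at h2
    have := h.dim
    omega
  have hjoin : ∀ x ∈ vecs X, ∀ y ∈ vecs X, y ∉ Submodule.span K {x} →
      ∃ ξ ∈ Ξ, x ∈ ξ ∧ y ∈ ξ := by
    intro x hx y hy hyx
    obtain ⟨ξ, hξ, h1, h2⟩ := h.H1 _ hx.2 _ hy.2 fun he => hyx ((mk_eq_iff hy.1 hx.1).1 he.symm)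
    exact ⟨ξ, hξ, (mk_mem_pts _).1 h1, (mk_mem_pts _).1 h2⟩
  refine ⟨hcard, isConeSet_vecs _, isConeSet_vecs _, hspan, h.dim, ?_, ?_, ?_, ?_, ?_, ?_⟩
  · intro ξ hξ
    obtain ⟨v, h0, hv⟩ := htube ξ hξ
    exact ⟨v, ⟨h0, ξ, hξ, hv⟩, hv.isVTube h0⟩
  · rintro y ⟨h0, ξ, hξ, hy⟩
    exact ⟨ξ, hξ, hy.isVTube h0⟩
  · intro x hx y hy
    by_cases hyx : y ∈ Submodule.span K {x}
    · obtain ⟨z, hz, hzx⟩ := hother x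
      obtain ⟨ξ, hξ, hxξ, -⟩ := hjoin x hx z hz hzx
      exact ⟨ξ, hξ, hxξ, single_le hxξ hyx⟩
    · exact hjoin x hx y hy hyx
  · intro ξ₁ h₁ ξ₂ h₂ hne u hu₁ hu₂ h0
    have h1 := (h.H2 ξ₁ h₁ ξ₂ h₂ hne).1 ((mk_mem_pts h0).2 ⟨hu₁, hu₂⟩)
    exact h1.imp (fun h1 => ⟨h0, h1⟩) fun h1 => ⟨h0, h1⟩
  · intro ξ₁ h₁ ξ₂ h₂ hne hI
    obtain ⟨H, -, hH, hY⟩ := (h.H2 ξ₁ h₁ ξ₂ h₂ hne).2 hI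
    refine ⟨H, by omega, fun y hy hy₁ hy₂ => ?_⟩
    exact (mk_mem_pts hy.1).1 (hY ⟨(mk_mem_pts hy.1).2 ⟨hy₁, hy₂⟩, hy.2⟩)
  · intro x hx
    obtain ⟨T, hT, hT'⟩ := h.H3 _ hx.2
    refine ⟨T, hT, fun y hy hyx ξ hξ hxξ hyξ huniq v τ hv hτ => ?_⟩
    obtain ⟨w, h0, hw⟩ := htube ξ hξ
    have hvw := (hw.isVTube h0).vertex_unique (isConeSet_vecs X) (hcard 1) hv
    refine hT' _ hy.2 (fun he => hyx ((mk_eq_iff hy.1 hx.1).1 he)) ξ hξ ((mk_mem_pts _).2 hxξ)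
      ((mk_mem_pts _).2 hyξ) (fun ξ' hξ' h1 h2 => huniq ξ' hξ' ((mk_mem_pts _).1 h1)
      ((mk_mem_pts _).1 h2)) _ τ ?_ (hτ.isTangentPlane hv hx)
    rwa [(mk_eq_iff hv.ne_zero h0).2 hvw]

/-- A system of tubes with a common vertex comes from a quadric Veronese cone. -/
lemma isVeroneseCone_of_rad_eq {Y : Set (Projectivization K V)} {Ξ : Set (Submodule K V)}
    (h : IsHVSystem (vecs X) (vecs Y) Ξ) {t : V} (ht : t ∈ vecs Y)
    (hrad : ∀ x ∈ vecs X, IsHVSystem.rad (K := K) (vecs X) (vecs Y) x = Submodule.span K {t}) :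
    IsVeroneseCone X Y := by
  obtain ⟨h7, hcomm, e, hind, hte, hX⟩ := h.exists_veronese ht hrad
  have hYmk : ∀ p, p ∈ Y ↔ p = Projectivization.mk K t ht.1 := by
    intro p
    rw [← rep_mem_vecs, h.mem_Y_iff ht hrad]
    conv_rhs => rw [← p.mk_rep]
    rw [mk_eq_iff, mem_single]
    exact ⟨fun ⟨c, _, hc⟩ => ⟨c, hc⟩, fun ⟨c, hc⟩ =>
      ⟨c, by rintro rfl; exact p.rep_nonzero (by simpa using hc), hc⟩⟩
  have hmem : ∀ x : Fin 3 → K, x ≠ 0 → veronesePoint e x ∈ vecs X := fun x hx =>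
    (hX _).2 ⟨x, hx, 1, 0, one_ne_zero, by simp⟩
  refine ⟨Projectivization.mk K t ht.1, Submodule.span K (Set.range e), _, h7,
    ⟨hcomm, e, hind, rfl, rfl⟩, fun hc => hte ((mk_mem_pts _).1 hc), ?_, ?_⟩
  · ext p
    constructor
    · rintro (hp | hp)
      · obtain ⟨x, hx, d, c, hd, he⟩ := (hX _).1 (rep_mem_vecs.2 hp)
        refine ⟨Projectivization.mk K _ (hmem x hx).1, ⟨x, hx, Projectivization.submodule_mk _ _⟩,
          rep_mem_iff.1 ?_⟩
        rw [Projectivization.submodule_mk, Projectivization.submodule_mk, he]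
        exact Submodule.add_mem _ (Submodule.mem_sup_left (smul_mem_single _ _))
          (Submodule.mem_sup_right (smul_mem_single _ _))
      · have hx : (fun _ : Fin 3 => (1 : K)) ≠ 0 := fun hc => one_ne_zero (congrFun hc 0)
        refine ⟨Projectivization.mk K _ (hmem _ hx).1, ⟨_, hx, Projectivization.submodule_mk _ _⟩,
          ?_⟩
        rw [(hYmk p).1 hp, mk_mem_pts, Projectivization.submodule_mk]
        exact Submodule.mem_sup_right (Submodule.mem_span_singleton_self t)
    · rintro ⟨o, ⟨x, hx, ho⟩, hp⟩
      have hp' := rep_mem_iff.2 hp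
      rw [ho, Projectivization.submodule_mk] at hp'
      obtain ⟨c, hc⟩ := mem_sup_single.1 hp'
      obtain ⟨d, hd⟩ := mem_single.1 hc
      by_cases hd0 : d = 0
      · refine Or.inr ((hYmk p).2 ?_)
        conv_lhs => rw [← p.mk_rep]
        rw [mk_eq_iff, mem_single]
        exact ⟨c, by rwa [hd0, zero_smul, sub_eq_zero] at hd⟩
      · exact Or.inl (rep_mem_vecs.1 ((hX _).2 ⟨x, hx, d, c, hd0, sub_eq_iff_eq_add.1 hd⟩))
  · ext p
    exact hYmk p

end Bridge

/-! ### Tubes and classes of a thick system -/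

section ThickSystems

variable {K V : Type*} [DivisionRing K] [AddCommGroup V] [Module K V]

/-- A tube lies in every subspace that contains its points. -/
lemma IsVTube.le_of_points [Module.Finite K V] {X : Set V} {ξ W : Submodule K V} {v : V}
    (h : IsVTube X ξ v) (hX : IsConeSet K X) (hW : ∀ u ∈ X, u ∈ ξ → u ∈ W) : ξ ≤ W := by
  obtain ⟨a, ha, haξ⟩ := h.nonempty
  obtain ⟨b, hb, hbξ, hba⟩ := h.exists_notMem ha haξ
  obtain ⟨c, hc, hcξ, hca, hcb⟩ := h.exists_third ha haξ hb hbξ hba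
  have hav := h.cone a ha haξ 1
  rw [one_smul] at hav
  exact h.le_of_three hX ha haξ hb hbξ hba hc hcξ hca hcb
    ((W.add_mem_iff_right (hW a ha haξ)).1 (hW _ hav (ξ.add_mem haξ h.mem)))
    (hW a ha haξ) (hW b hb hbξ) (hW c hc hcξ)

namespace IsHVSystem

/-- A thick system, with the plane `π` that contains all radicals. -/
structure IsRadicalPlane (X Y : Set V) (Ξ : Set (Submodule K V)) (π : Submodule K V) :
    Prop where
  sys : IsHVSystem X Y Ξ
  thick : Thick (K := K) X Y
  rank : finrank K π = 3
  le : ∀ x ∈ X, rad (K := K) X Y x ≤ π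

namespace IsRadicalPlane

variable {X Y : Set V} {Ξ : Set (Submodule K V)} {π ξ ξ₁ ξ₂ L : Submodule K V}
  {u v w x y a b : V}

lemma mem_plane (h : IsRadicalPlane X Y Ξ π) (hy : y ∈ Y) : y ∈ π := by
  obtain ⟨ξ, hξ, ht⟩ := h.sys.vertex y hy
  obtain ⟨a, ha, haξ⟩ := ht.nonempty
  exact h.le a ha (h.sys.vertex_mem_rad hξ ht ha haξ)

/-- Every line of the plane of the radicals is a radical. -/
lemma exists_rad_eq (h : IsRadicalPlane X Y Ξ π) (hL : L ≤ π) (hL2 : finrank K L = 2) :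
    ∃ x ∈ X, rad (K := K) X Y x = L := by
  obtain ⟨x, hx⟩ := h.sys.nonempty
  obtain ⟨y, hyx, hyL, hy0⟩ := h.sys.exists_rad_mem h.thick h.rank h.le hx hL hL2.ge
  obtain ⟨ξ, hξ, ht⟩ := h.sys.vertex y (h.sys.mem_Y_of_rad hx hyx hy0)
  exact IsPointed.exists_rad_eq ⟨h.sys, h.thick, h.rank, h.le, hξ, ht⟩ hL hL2 hyL

lemma exists_line (h : IsRadicalPlane X Y Ξ π) (hv : v ∈ π) (hv0 : v ≠ 0)
    (hvw : w ∉ Submodule.span K {v}) :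
    ∃ L ≤ π, finrank K L = 2 ∧ v ∈ L ∧ w ∉ L := by
  have := h.sys.finite
  obtain ⟨u, hu, huvw⟩ := exists_notMem_of_finrank_lt (W := Submodule.span K {v, w}) (U := π)
    (by have := finrank_pair_le (K := K) v w; rw [h.rank]; omega)
  refine ⟨Submodule.span K {v, u}, pair_le hv hu,
    finrank_pair hv0 fun hc => huvw (single_le_left v w hc), left_mem_pair v u, fun hc => huvw ?_⟩
  rw [pair_comm v u] at hc
  rw [pair_comm v w]
  exact pair_exchange hc hvw

lemma mem_Y (h : IsRadicalPlane X Y Ξ π) (hu : u ∈ π) (hu0 : u ≠ 0) : u ∈ Y := by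
  have := h.sys.finite
  obtain ⟨w, hw, hwu⟩ := exists_notMem_of_finrank_lt (W := Submodule.span K {u}) (U := π)
    (by have := finrank_single_le (K := K) u; rw [h.rank]; omega)
  obtain ⟨x, hx, hxr⟩ := h.exists_rad_eq (pair_le hu hw) (finrank_pair hu0 hwu)
  exact h.sys.mem_Y_of_rad hx (hxr ▸ left_mem_pair u w) hu0

lemma rad_eq_iff (h : IsRadicalPlane X Y Ξ π) (hx : x ∈ X) (hw : w ∈ X) :
    rad (K := K) X Y w = rad X Y x ↔ w ∈ sing (K := K) X Y x := by
  refine ⟨fun he => ?_, h.sys.rad_eq hx hw⟩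
  obtain ⟨a, ha, ha0⟩ := h.sys.exists_rad hx
  obtain ⟨b, hb, hba⟩ := h.sys.exists_ne (v := a) (h.thick x hx)
  exact h.sys.mem_sing_of_rads hx hw ha hb (he ▸ ha) (he ▸ hb) ha0 hba

/-- A tube has points with each radical through its vertex. -/
lemma exists_mem_rad_eq (h : IsRadicalPlane X Y Ξ π) (hξ : ξ ∈ Ξ) (ht : IsVTube X ξ v)
    (hL : L ≤ π) (hL2 : finrank K L = 2) (hv : v ∈ L) :
    ∃ q ∈ X, q ∈ ξ ∧ rad (K := K) X Y q = L := by
  obtain ⟨x, hx, rfl⟩ := h.exists_rad_eq hL hL2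
  obtain ⟨q, hq, hqξ, hqx⟩ := h.sys.exists_mem_sing_of_vertex h.thick hξ ht hx hv
  exact ⟨q, hq, hqξ, h.sys.rad_eq hx hq hqx⟩

/-- A vector in the radicals of all points of a tube represents the vertex. -/
lemma mem_single_vertex (h : IsRadicalPlane X Y Ξ π) (hξ : ξ ∈ Ξ) (ht : IsVTube X ξ v)
    (hu : ∀ a ∈ X, a ∈ ξ → u ∈ rad (K := K) X Y a) : u ∈ Submodule.span K {v} := by
  have := h.sys.finite
  obtain ⟨a, ha, haξ⟩ := ht.nonempty
  obtain ⟨b, hb, hbξ, hba⟩ := ht.exists_notMem ha haξ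
  exact h.sys.mem_vertex_of_rads ha hb
    (h.sys.notMem_sing_of_notMem_pair hξ ht ha haξ hbξ hba) hξ ht haξ hbξ (hu a ha haξ)
    (hu b hb hbξ)

/-- A tube with the same vertex that meets a tube in one of two given generators only. -/
lemma exists_tube_notMem (h : IsRadicalPlane X Y Ξ π) (hξ : ξ ∈ Ξ) (ht : IsVTube X ξ v)
    (ha : a ∈ X) (haξ : a ∈ ξ) (hb : b ∈ X) (hbξ : b ∈ ξ) (hba : b ∉ sing (K := K) X Y a) :
    ∃ ζ ∈ Ξ, IsVTube X ζ v ∧ b ∈ ζ ∧ a ∉ ζ := by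
  have hva := h.sys.vertex_mem_rad hξ ht ha haξ
  have hvb := h.sys.vertex_mem_rad hξ ht hb hbξ
  obtain ⟨s, hs, hsv⟩ := h.sys.exists_ne (v := v) (h.thick a ha)
  have has := h.sys.add_rad_mem ha hs
  have has' : a + s ∈ sing (K := K) X Y a :=
    Submodule.add_mem _ (self_mem_sing a) (rad_le_sing a hs)
  obtain ⟨ζ, hζ, hasζ, hbζ, htζ⟩ := h.sys.exists_join_of_rads has hb
    (by rw [h.sys.sing_eq ha has has']; exact hba)
    (by rw [h.sys.rad_eq ha has has']; exact hva) hvb ht.ne_zero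
  exact ⟨ζ, hζ, htζ, hbζ, fun haζ =>
    hsv (h.sys.rad_inf_tube hζ htζ ha hs ((ζ.add_mem_iff_right haζ).1 hasζ))⟩

/-- Every generator is on a second tube with the same vertex. -/
lemma exists_tube_ne (h : IsRadicalPlane X Y Ξ π) (hξ : ξ ∈ Ξ) (ht : IsVTube X ξ v)
    (hb : b ∈ X) (hbξ : b ∈ ξ) : ∃ ζ ∈ Ξ, IsVTube X ζ v ∧ b ∈ ζ ∧ ζ ≠ ξ := by
  have := h.sys.finite
  obtain ⟨a, ha, haξ, hab⟩ := ht.exists_notMem hb hbξ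
  have hab' := h.sys.notMem_sing_of_notMem_pair hξ ht hb hbξ haξ hab
  obtain ⟨ζ, hζ, htζ, hbζ, haζ⟩ := h.exists_tube_notMem hξ ht ha haξ hb hbξ
    fun hc => hab' (h.sys.mem_sing_symm ha hb hc)
  exact ⟨ζ, hζ, htζ, hbζ, by rintro rfl; exact haζ haξ⟩

/-- Any two tubes have a common point. If their vertices are different, both contain a generator
in the singular plane with radical joining the vertices. -/
lemma exists_mem_mem (h : IsRadicalPlane X Y Ξ π) (h₁ : ξ₁ ∈ Ξ) (h₂ : ξ₂ ∈ Ξ) :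
    ∃ a ∈ X, a ∈ ξ₁ ∧ a ∈ ξ₂ := by
  have := h.sys.finite
  obtain ⟨v, hv, tv⟩ := h.sys.tube _ h₁
  obtain ⟨w, hw, tw⟩ := h.sys.tube _ h₂
  by_cases hwv : w ∈ Submodule.span K {v}
  · exact h.sys.exists_common h₁ h₂ tv (single_le tw.mem (single_comm tw.ne_zero hwv))
  have hL : Submodule.span K {v, w} ≤ π := pair_le (h.mem_plane hv) (h.mem_plane hw)
  have hL2 := finrank_pair tv.ne_zero hwv
  obtain ⟨p, hp, hp₁, hpr⟩ := h.exists_mem_rad_eq h₁ tv hL hL2 (left_mem_pair v w)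
  obtain ⟨q, hq, hq₂, hqr⟩ := h.exists_mem_rad_eq h₂ tw hL hL2 (right_mem_pair v w)
  obtain ⟨k, hk, r, hr, hqe⟩ := h.sys.exists_of_mem_sing hp hq
    ((h.rad_eq_iff hp hq).1 (hqr.trans hpr.symm))
  rw [hpr] at hr
  obtain ⟨α, β, rfl⟩ := mem_pair.1 hr
  refine ⟨q + (-β) • w, tw.cone q hq hq₂ _, ?_, ξ₂.add_mem hq₂ (ξ₂.smul_mem _ tw.mem)⟩
  have : q + (-β) • w = k • p + α • v := by
    rw [hqe, neg_smul]; abel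
  rw [this]
  exact ξ₁.add_mem (ξ₁.smul_mem k hp₁) (ξ₁.smul_mem α tv.mem)

/-- Tubes with different vertices have only one common point. -/
lemma mem_single_of_mem_mem (h : IsRadicalPlane X Y Ξ π) (h₁ : ξ₁ ∈ Ξ) (h₂ : ξ₂ ∈ Ξ)
    (tv : IsVTube X ξ₁ v) (tw : IsVTube X ξ₂ w) (hwv : w ∉ Submodule.span K {v}) (ha : a ∈ X)
    (ha₁ : a ∈ ξ₁) (ha₂ : a ∈ ξ₂) (hb₁ : b ∈ ξ₁) (hb₂ : b ∈ ξ₂) :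
    b ∈ Submodule.span K {a} := by
  have := h.sys.finite
  have hne : ξ₁ ≠ ξ₂ := by
    rintro rfl
    exact hwv (tv.vertex_unique h.sys.coneX h.sys.card' tw)
  have hav := h.sys.vertex_mem_rad h₁ tv ha ha₁
  have haw := h.sys.vertex_mem_rad h₂ tw ha ha₂
  obtain ⟨α, β, hb⟩ := mem_pair.1 (h.sys.mem_pair_of_mem_two h₁ h₂ hne tv ha ha₁ ha₂ hb₁ hb₂)
  obtain ⟨γ, δ, hb'⟩ := mem_pair.1
    (h.sys.mem_pair_of_mem_two h₂ h₁ hne.symm tw ha ha₂ ha₁ hb₂ hb₁)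
  have e : (γ - α) • a = β • v - δ • w := by
    have e' : α • a + β • v = γ • a + δ • w := hb ▸ hb'
    rw [sub_smul, sub_eq_sub_iff_add_eq_add, ← e']; abel
  have h1 : γ - α = 0 := by
    by_contra h0
    refine h.sys.self_notMem_rad ha ((Submodule.smul_mem_iff _ h0).1 ?_)
    rw [e]
    exact Submodule.sub_mem _ (Submodule.smul_mem _ _ hav) (Submodule.smul_mem _ _ haw)
  rw [h1, zero_smul] at e
  have hδ : δ = 0 := by
    by_contra h0
    refine hwv ((Submodule.smul_mem_iff _ h0).1 ?_)
    rw [← sub_eq_zero.1 e.symm]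
    exact smul_mem_single v β
  exact mem_single.2 ⟨γ, by rw [hb', hδ]; simp⟩

end IsRadicalPlane

end IsHVSystem

end ThickSystems

/-! ### The projective Hjelmslev plane -/

section HjelmslevPlane

variable {K V : Type*} [DivisionRing K] [AddCommGroup V] [Module K V]

/-- The points of `X` in the subspace `ξ`. -/
def tubePts (X : Set (Projectivization K V)) (ξ : Submodule K V) : Set X :=
  {p : X | (p : Projectivization K V) ∈ pts ξ}

/-- The pencil of the lines of the plane `π` through the point represented by `v`. -/
def pencil (π : Submodule K V) (v : V) : Set (DualPoint π) :=
  {L : DualPoint π | v ∈ L.1}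

lemma mem_dualLines {π : Submodule K V} {m : Set (DualPoint π)} :
    m ∈ dualLines π ↔ ∃ v ∈ π, v ≠ 0 ∧ m = pencil π v := by
  constructor
  · rintro ⟨y, hy, rfl⟩
    refine ⟨y.rep, rep_mem_iff.2 hy, y.rep_nonzero, ?_⟩
    ext L
    exact rep_mem_iff.symm
  · rintro ⟨v, hv, h0, rfl⟩
    refine ⟨Projectivization.mk K v h0, (mk_mem_pts h0).2 hv, ?_⟩
    ext L
    exact (mk_mem_pts h0).symm

variable {X : Set (Projectivization K V)}

lemma mem_tubePts {ξ : Submodule K V} {p : X} : p ∈ tubePts X ξ ↔ p.1.rep ∈ ξ :=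
  rep_mem_iff.symm

lemma rep_mem (p : X) : p.1.rep ∈ vecs X := rep_mem_vecs.2 p.2

lemma eq_iff_rep {p q : X} : q = p ↔ q.1.rep ∈ Submodule.span K {p.1.rep} := by
  rw [← mk_eq_iff q.1.rep_nonzero p.1.rep_nonzero, Projectivization.mk_rep,
    Projectivization.mk_rep, Subtype.ext_iff]

/-- The point represented by a vector. -/
lemma exists_point {a : V} (ha : a ∈ vecs X) :
    ∃ p : X, ∀ W : Submodule K V, p.1.rep ∈ W ↔ a ∈ W :=
  ⟨⟨Projectivization.mk K a ha.1, ha.2⟩, fun _ => by rw [rep_mem_iff, mk_mem_pts]⟩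

namespace IsHVSystem.IsRadicalPlane

open IsHVSystem

variable {Y : Set (Projectivization K V)} {Ξ : Set (Submodule K V)} {π ξ ζ : Submodule K V}
  {v w : V}

/-- The map sending a point of `X` to its radical, a line of the plane of the radicals. -/
noncomputable def radLine (h : IsRadicalPlane (vecs X) (vecs Y) Ξ π) (p : X) : DualPoint π :=
  ⟨rad (vecs X) (vecs Y) p.1.rep, h.sys.finrank_rad h.thick (rep_mem p), h.le _ (rep_mem p)⟩

lemma radLine_eq (h : IsRadicalPlane (vecs X) (vecs Y) Ξ π) {a : V} (ha : a ∈ vecs X) {p : X}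
    (hp : ∀ W : Submodule K V, p.1.rep ∈ W ↔ a ∈ W) :
    (h.radLine p).1 = rad (vecs X) (vecs Y) a :=
  h.sys.rad_eq ha (rep_mem p) ((hp _).2 (self_mem_sing a))

lemma radLine_eq_iff (h : IsRadicalPlane (vecs X) (vecs Y) Ξ π) {p q : X} :
    h.radLine q = h.radLine p ↔ q.1.rep ∈ sing (K := K) (vecs X) (vecs Y) p.1.rep :=
  Subtype.ext_iff.trans (h.rad_eq_iff (rep_mem p) (rep_mem q))

lemma isSingularPlane (h : IsRadicalPlane (vecs X) (vecs Y) Ξ π) (p : X) :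
    IsSingularPlane X Y (sing (vecs X) (vecs Y) p.1.rep) (h.radLine p).1 := by
  have := h.sys.finite
  have hp := rep_mem p
  refine ⟨?_, (h.radLine p).2.1, rad_le_sing _, fun q hq => ?_, fun L hL hLs hLY => ?_,
    fun q hq => ?_⟩
  · rw [h.sys.finrank_sing hp, h.sys.finrank_rad h.thick hp]
  · exact rep_mem_vecs.1 (h.sys.mem_Y_of_rad hp (rep_mem_iff.2 hq) q.rep_nonzero)
  · refine Submodule.eq_of_le_of_finrank_eq (fun u hu => ?_)
      (by rw [hL, (h.radLine p).2.1])
    by_cases hu0 : u = 0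
    · rw [hu0]; exact Submodule.zero_mem _
    · exact h.sys.mem_rad_of_mem_sing hp ⟨hu0, hLY ((mk_mem_pts hu0).2 hu)⟩ (hLs hu)
  · obtain ⟨a, r, hr, he⟩ := mem_sing.1 (rep_mem_iff.2 hq.1)
    have ha : a ≠ 0 := by
      rintro rfl
      refine hq.2 (rep_mem_iff.1 ?_)
      rw [he, zero_smul, zero_add]
      exact hr
    exact rep_mem_vecs.1 (he ▸ h.sys.smul_add_rad_mem hp hr ha)

lemma singularPlane_unique (h : IsRadicalPlane (vecs X) (vecs Y) Ξ π) (p : X)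
    {σ L : Submodule K V} (hpσ : p.1.rep ∈ σ) (hσ : IsSingularPlane X Y σ L) :
    σ = sing (vecs X) (vecs Y) p.1.rep := by
  have := h.sys.finite
  have hp := rep_mem p
  have hLY : ∀ l ∈ L, l ≠ 0 → l ∈ vecs Y := fun l hl h0 =>
    ⟨h0, hσ.radical ((mk_mem_pts h0).2 hl)⟩
  have hpL : p.1.rep ∉ L := fun hc => h.sys.disj hp (hLY _ hc p.1.rep_nonzero)
  have hle : L ≤ rad (vecs X) (vecs Y) p.1.rep := by
    intro l hl
    by_cases hl0 : l = 0
    · rw [hl0]; exact Submodule.zero_mem _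
    have h1 : p.1.rep + l ∉ L := fun hc => hpL ((L.add_mem_iff_left hl).1 hc)
    have h0 : p.1.rep + l ≠ 0 := fun h0 => h1 (h0 ▸ L.zero_mem)
    exact h.sys.mem_rad_of_add hp (hLY l hl hl0) ⟨h0, hσ.rest
      ⟨(mk_mem_pts h0).2 (σ.add_mem hpσ (hσ.le hl)), fun hc => h1 ((mk_mem_pts h0).1 hc)⟩⟩
  have he : L = rad (vecs X) (vecs Y) p.1.rep :=
    Submodule.eq_of_le_of_finrank_eq hle (by rw [hσ.line, h.sys.finrank_rad h.thick hp])
  refine (Submodule.eq_of_le_of_finrank_eq (sup_le (single_le hpσ) (he ▸ hσ.le)) ?_).symm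
  rw [hσ.plane]
  exact (h.isSingularPlane p).plane

lemma pts_plane (h : IsRadicalPlane (vecs X) (vecs Y) Ξ π) : pts π = Y := by
  ext p
  rw [← rep_mem_iff, ← rep_mem_vecs]
  exact ⟨fun hp => h.mem_Y hp p.rep_nonzero, h.mem_plane⟩

lemma pencil_eq_iff (h : IsRadicalPlane (vecs X) (vecs Y) Ξ π) (hv : v ∈ π) (hv0 : v ≠ 0)
    (hw0 : w ≠ 0) : pencil π v = pencil π w ↔ w ∈ Submodule.span K {v} := by
  constructor
  · intro he
    by_contra hwv
    obtain ⟨L, hL, hL2, hvL, hwL⟩ := h.exists_line hv hv0 hwv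
    have h1 : (⟨L, hL2, hL⟩ : DualPoint π) ∈ pencil π v := hvL
    rw [he] at h1
    exact hwL h1
  · intro hwv
    ext L
    exact ⟨fun hL => single_le hL hwv, fun hL => single_le hL (single_comm hw0 hwv)⟩

lemma image_tubePts (h : IsRadicalPlane (vecs X) (vecs Y) Ξ π) (hξ : ξ ∈ Ξ)
    (ht : IsVTube (vecs X) ξ v) : h.radLine '' tubePts X ξ = pencil π v := by
  ext L
  constructor
  · rintro ⟨p, hp, rfl⟩
    exact h.sys.vertex_mem_rad hξ ht (rep_mem p) (mem_tubePts.1 hp)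
  · intro hv
    obtain ⟨q, hq, hqξ, hqL⟩ := h.exists_mem_rad_eq hξ ht L.2.2 L.2.1 hv
    obtain ⟨p, hp⟩ := exists_point hq
    exact ⟨p, mem_tubePts.2 ((hp ξ).2 hqξ), Subtype.ext ((h.radLine_eq hq hp).trans hqL)⟩

lemma image_eq_iff (h : IsRadicalPlane (vecs X) (vecs Y) Ξ π) (hξ : ξ ∈ Ξ) (hζ : ζ ∈ Ξ)
    (hv : IsVTube (vecs X) ξ v) (hw : IsVTube (vecs X) ζ w) :
    h.radLine '' tubePts X ξ = h.radLine '' tubePts X ζ ↔ w ∈ Submodule.span K {v} := by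
  rw [h.image_tubePts hξ hv, h.image_tubePts hζ hw,
    h.pencil_eq_iff (h.mem_plane (h.sys.vertex_mem hξ hv)) hv.ne_zero hw.ne_zero]

lemma tubePts_injective (h : IsRadicalPlane (vecs X) (vecs Y) Ξ π) (hξ : ξ ∈ Ξ) (hζ : ζ ∈ Ξ)
    (he : tubePts X ξ = tubePts X ζ) : ξ = ζ := by
  have := h.sys.finite
  obtain ⟨v, hv, ht⟩ := h.sys.tube ξ hξ
  obtain ⟨w, hw, ht'⟩ := h.sys.tube ζ hζ
  refine Submodule.eq_of_le_of_finrank_eq (ht.le_of_points h.sys.coneX fun u hu huξ => ?_)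
    (by rw [ht.rank, ht'.rank])
  obtain ⟨p, hp⟩ := exists_point hu
  have h1 : p ∈ tubePts X ξ := mem_tubePts.2 ((hp ξ).2 huξ)
  rw [he] at h1
  exact (hp ζ).1 (mem_tubePts.1 h1)

lemma isGeomEpi (h : IsRadicalPlane (vecs X) (vecs Y) Ξ π) :
    IsGeomEpi (tubes X Ξ) (dualLines π) h.radLine := by
  refine ⟨fun L => ?_, ?_, fun m hm => ?_⟩
  · obtain ⟨x, hx, hxL⟩ := h.exists_rad_eq L.2.2 L.2.1
    obtain ⟨p, hp⟩ := exists_point hx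
    exact ⟨p, Subtype.ext ((h.radLine_eq hx hp).trans hxL)⟩
  · rintro _ ⟨ξ, hξ, rfl⟩
    obtain ⟨v, hv, ht⟩ := h.sys.tube ξ hξ
    exact mem_dualLines.2 ⟨v, h.mem_plane hv, ht.ne_zero, h.image_tubePts hξ ht⟩
  · obtain ⟨v, hv, hv0, rfl⟩ := mem_dualLines.1 hm
    obtain ⟨ξ, hξ, ht⟩ := h.sys.vertex v (h.mem_Y hv hv0)
    exact ⟨tubePts X ξ, ⟨ξ, hξ, rfl⟩, h.image_tubePts hξ ht⟩

lemma unique_join_iff (h : IsRadicalPlane (vecs X) (vecs Y) Ξ π) {p q : X} (hpq : p ≠ q) :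
    (∃! C, C ∈ tubes X Ξ ∧ p ∈ C ∧ q ∈ C) ↔ h.radLine p ≠ h.radLine q := by
  constructor
  · -- two points of a class are on several tubes with the vertex on the line joining them
    rintro ⟨C, -, huniq⟩ he
    obtain ⟨k, r, hr, hqe⟩ := mem_sing.1 (h.radLine_eq_iff.1 he.symm)
    have hr0 : r ≠ 0 := by
      rintro rfl
      exact hpq (eq_iff_rep.2 (mem_single.2 ⟨k, by rw [hqe, add_zero]⟩)).symm
    obtain ⟨ξ, hξ, ht, hpξ, -⟩ := h.sys.exists_tube_of_rad (rep_mem p) hr hr0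
    obtain ⟨ζ, hζ, ht', hpζ, hne⟩ := h.exists_tube_ne hξ ht (rep_mem p) hpξ
    have hq : ∀ η : Submodule K V, p.1.rep ∈ η → r ∈ η → q ∈ tubePts X η := fun η h1 h2 =>
      mem_tubePts.2 (hqe ▸ η.add_mem (η.smul_mem k h1) h2)
    have e₁ := huniq (tubePts X ξ) ⟨⟨ξ, hξ, rfl⟩, mem_tubePts.2 hpξ, hq ξ hpξ ht.mem⟩
    have e₂ := huniq (tubePts X ζ) ⟨⟨ζ, hζ, rfl⟩, mem_tubePts.2 hpζ, hq ζ hpζ ht'.mem⟩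
    exact hne (h.tubePts_injective hζ hξ (e₂.trans e₁.symm))
  · intro hne
    have hs : q.1.rep ∉ sing (K := K) (vecs X) (vecs Y) p.1.rep := fun hc =>
      hne (h.radLine_eq_iff.2 hc).symm
    obtain ⟨ξ, hξ, hpξ, hqξ⟩ := h.sys.join _ (rep_mem p) _ (rep_mem q)
    refine ⟨tubePts X ξ, ⟨⟨ξ, hξ, rfl⟩, mem_tubePts.2 hpξ, mem_tubePts.2 hqξ⟩, ?_⟩
    rintro _ ⟨⟨ζ, hζ, rfl⟩, hp, hq⟩
    rw [h.sys.tube_unique (rep_mem p) hs hζ hξ (mem_tubePts.1 hp) hpξ (mem_tubePts.1 hq) hqξ]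
    rfl

lemma tubePts_inter_nonempty (h : IsRadicalPlane (vecs X) (vecs Y) Ξ π) (hξ : ξ ∈ Ξ)
    (hζ : ζ ∈ Ξ) : (tubePts X ξ ∩ tubePts X ζ).Nonempty := by
  obtain ⟨a, ha, haξ, haζ⟩ := h.exists_mem_mem hξ hζ
  obtain ⟨p, hp⟩ := exists_point ha
  exact ⟨p, mem_tubePts.2 ((hp ξ).2 haξ), mem_tubePts.2 ((hp ζ).2 haζ)⟩

lemma unique_meet_iff (h : IsRadicalPlane (vecs X) (vecs Y) Ξ π) (hξ : ξ ∈ Ξ) (hζ : ζ ∈ Ξ) :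
    (∃! p, p ∈ tubePts X ξ ∩ tubePts X ζ) ↔
      h.radLine '' tubePts X ξ ≠ h.radLine '' tubePts X ζ := by
  obtain ⟨v, hv, tv⟩ := h.sys.tube ξ hξ
  obtain ⟨w, hw, tw⟩ := h.sys.tube ζ hζ
  rw [Ne, h.image_eq_iff hξ hζ tv tw]
  constructor
  · -- tubes with the same vertex share a generator
    rintro ⟨p, ⟨hpξ, hpζ⟩, huniq⟩ hwv
    rw [mem_tubePts] at hpξ hpζ
    have hvζ : v ∈ ζ := single_le tw.mem (single_comm tw.ne_zero hwv)
    have h1 := tv.cone _ (rep_mem p) hpξ 1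
    rw [one_smul] at h1
    obtain ⟨q, hq⟩ := exists_point h1
    have h2 := huniq q ⟨mem_tubePts.2 ((hq ξ).2 (ξ.add_mem hpξ tv.mem)),
      mem_tubePts.2 ((hq ζ).2 (ζ.add_mem hpζ hvζ))⟩
    have h3 := (hq _).1 (eq_iff_rep.1 h2)
    exact tv.vertex_notMem_single h.sys.coneX (rep_mem p)
      ((Submodule.add_mem_iff_right _ (Submodule.mem_span_singleton_self _)).1 h3)
  · intro hwv
    obtain ⟨p, hpξ, hpζ⟩ := h.tubePts_inter_nonempty hξ hζ
    refine ⟨p, ⟨hpξ, hpζ⟩, fun q hq => eq_iff_rep.2 ?_⟩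
    rw [mem_tubePts] at hpξ hpζ
    exact h.mem_single_of_mem_mem hξ hζ tv tw hwv (rep_mem p) hpξ hpζ (mem_tubePts.1 hq.1)
      (mem_tubePts.1 hq.2)

/-- In a class, the tubes induce the lines through points of the radical. -/
lemma mem_class_lines (h : IsRadicalPlane (vecs X) (vecs Y) Ξ π) {L : DualPoint π} {l : Set X} :
    l ∈ {l | ∃ C ∈ tubes X Ξ, l = C ∩ h.radLine ⁻¹' {L} ∧ l.Nonempty} ↔
      ∃ p : X, h.radLine p = L ∧ ∃ v ∈ L.1, v ≠ 0 ∧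
        l = tubePts X (Submodule.span K {p.1.rep, v}) := by
  have key : ∀ ξ ∈ Ξ, ∀ v, IsVTube (vecs X) ξ v → ∀ p : X, p.1.rep ∈ ξ → h.radLine p = L →
      tubePts X ξ ∩ h.radLine ⁻¹' {L} = tubePts X (Submodule.span K {p.1.rep, v}) := by
    rintro ξ hξ v ht p hp rfl
    ext q
    rw [Set.mem_inter_iff, mem_tubePts, mem_tubePts, Set.mem_preimage, Set.mem_singleton_iff,
      h.radLine_eq_iff]
    exact ⟨fun hq => h.sys.mem_pair_of_sing hξ ht (rep_mem p) hp hq.1 hq.2, fun hq =>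
      ⟨pair_le hp ht.mem hq, h.sys.pair_le_sing hξ ht (rep_mem p) hp hq⟩⟩
  constructor
  · rintro ⟨_, ⟨ξ, hξ, rfl⟩, rfl, p, hp, hpL⟩
    obtain ⟨v, hv, ht⟩ := h.sys.tube ξ hξ
    have hp' : p.1.rep ∈ ξ := mem_tubePts.1 hp
    refine ⟨p, hpL, v, ?_, ht.ne_zero, key ξ hξ v ht p hp' hpL⟩
    rw [← hpL]
    exact h.sys.vertex_mem_rad hξ ht (rep_mem p) hp'
  · rintro ⟨p, rfl, v, hv, hv0, rfl⟩
    obtain ⟨ξ, hξ, ht, hpξ, -⟩ := h.sys.exists_tube_of_rad (rep_mem p) hv hv0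
    exact ⟨tubePts X ξ, ⟨ξ, hξ, rfl⟩, (key ξ hξ v ht p hpξ rfl).symm, p,
      mem_tubePts.2 (left_mem_pair _ _)⟩

lemma span_eq_of_mem (h : IsRadicalPlane (vecs X) (vecs Y) Ξ π) {p q : X}
    (hv : v ∈ (h.radLine q).1) (hq : q ∈ tubePts X (Submodule.span K {p.1.rep, v})) :
    Submodule.span K {p.1.rep, v} = Submodule.span K {q.1.rep, v} :=
  (pair_eq_of_mem (mem_tubePts.1 hq)
    fun hc => h.sys.self_notMem_rad (rep_mem q) (single_le hv hc)).symm

/-- A class is the affine plane obtained from a singular plane by deleting the radical. -/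
lemma isAffinePlane_class (h : IsRadicalPlane (vecs X) (vecs Y) Ξ π) (L : DualPoint π) :
    IsAffinePlane (h.radLine ⁻¹' {L})
      {l | ∃ C ∈ tubes X Ξ, l = C ∩ h.radLine ⁻¹' {L} ∧ l.Nonempty} := by
  have := h.sys.finite
  have hsub : ∀ l ∈ {l | ∃ C ∈ tubes X Ξ, l = C ∩ h.radLine ⁻¹' {L} ∧ l.Nonempty},
      l ⊆ h.radLine ⁻¹' {L} := by
    rintro l ⟨C, -, rfl, -⟩
    exact Set.inter_subset_right
  have hmem : ∀ {p : X} {v : V}, h.radLine p = L → v ∈ L.1 → v ≠ 0 →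
      tubePts X (Submodule.span K {p.1.rep, v}) ∈
        {l | ∃ C ∈ tubes X Ξ, l = C ∩ h.radLine ⁻¹' {L} ∧ l.Nonempty} := fun hp hv h0 =>
    h.mem_class_lines.2 ⟨_, hp, _, hv, h0, rfl⟩
  refine ⟨hsub, ?_, ?_, ?_⟩
  · intro p hp q hq hpq
    rw [Set.mem_preimage, Set.mem_singleton_iff] at hp hq
    obtain ⟨k, r, hr, hqe⟩ := mem_sing.1 (h.radLine_eq_iff.1 (hq.trans hp.symm))
    have hrL : r ∈ L.1 := by rw [← hp]; exact hr
    have hr0 : r ≠ 0 := by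
      rintro rfl
      exact hpq (eq_iff_rep.2 (mem_single.2 ⟨k, by rw [hqe, add_zero]⟩)).symm
    refine ⟨_, ⟨hmem hp hrL hr0, mem_tubePts.2 (left_mem_pair _ _),
      mem_tubePts.2 (mem_pair.2 ⟨k, 1, by rw [hqe, one_smul]⟩)⟩, ?_⟩
    rintro l ⟨hl, hpl, hql⟩
    obtain ⟨a, ha, v, hv, hv0, rfl⟩ := h.mem_class_lines.1 hl
    rw [h.span_eq_of_mem (hp ▸ hv) hpl] at hql ⊢
    have hrm : r ∈ Submodule.span K {p.1.rep, v} := by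
      have h1 := mem_tubePts.1 hql
      rw [hqe] at h1
      exact (Submodule.add_mem_iff_right _ (Submodule.smul_mem _ _ (left_mem_pair _ _))).1 h1
    have hrp : r ∉ Submodule.span K {p.1.rep} := fun hc =>
      h.sys.self_notMem_rad (rep_mem p) (single_le hr (single_comm hr0 hc))
    rw [pair_comm] at hrm
    rw [pair_comm _ v, pair_comm _ r, pair_eq_of_mem hrm hrp]
  · intro l hl p hp hpl
    rw [Set.mem_preimage, Set.mem_singleton_iff] at hp
    obtain ⟨a, ha, v, hv, hv0, rfl⟩ := h.mem_class_lines.1 hl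
    refine ⟨tubePts X (Submodule.span K {p.1.rep, v}), ⟨hmem hp hv hv0,
      mem_tubePts.2 (left_mem_pair _ _), ?_⟩, ?_⟩
    · rw [Set.disjoint_left]
      intro q hq hqa
      have hqL : h.radLine q = L := hsub _ hl hqa
      refine hpl ?_
      rw [h.span_eq_of_mem (hqL ▸ hv) hqa, ← h.span_eq_of_mem (hqL ▸ hv) hq]
      exact mem_tubePts.2 (left_mem_pair _ _)
    · rintro m ⟨hm, hpm, hdis⟩
      obtain ⟨b, hb, w, hw, hw0, rfl⟩ := h.mem_class_lines.1 hm
      rw [h.span_eq_of_mem (hp ▸ hw) hpm] at hdis ⊢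
      by_cases hwv : w ∈ Submodule.span K {v}
      · obtain ⟨c, rfl⟩ := mem_single.1 hwv
        rw [pair_smul_right (by rintro rfl; simp at hw0)]
      · -- lines with different points at infinity meet
        exfalso
        have hLe := eq_pair_of_finrank L.2.1 hv hw hv0 hwv
        obtain ⟨k, r, hr, hpe⟩ := mem_sing.1 (h.radLine_eq_iff.1 (hp.trans ha.symm))
        have hrL : r ∈ L.1 := by rw [← ha]; exact hr
        rw [hLe] at hrL
        obtain ⟨α, β, rfl⟩ := mem_pair.1 hrL
        have hwp : (-β) • w ∈ rad (K := K) (vecs X) (vecs Y) p.1.rep :=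
          Submodule.smul_mem _ _ (by rw [← hp] at hw; exact hw)
        obtain ⟨q, hq⟩ := exists_point (h.sys.add_rad_mem (rep_mem p) hwp)
        refine Set.disjoint_left.1 hdis (mem_tubePts.2 ((hq _).2 ?_) : q ∈ _)
          (mem_tubePts.2 ((hq _).2 ?_))
        · exact mem_pair.2 ⟨1, -β, by rw [one_smul]⟩
        · exact mem_pair.2 ⟨k, α, by rw [hpe, neg_smul]; abel⟩
  · obtain ⟨x, hx, hxL⟩ := h.exists_rad_eq L.2.2 L.2.1
    obtain ⟨p, hp⟩ := exists_point hx
    have hpL : h.radLine p = L := Subtype.ext ((h.radLine_eq hx hp).trans hxL)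
    obtain ⟨v, hv, hv0⟩ := h.sys.exists_rad (rep_mem p)
    obtain ⟨w, hw, hwv⟩ := h.sys.exists_ne (v := v) (h.thick _ (rep_mem p))
    have hpv := h.sys.add_rad_mem (rep_mem p) hv
    have hpw := h.sys.add_rad_mem (rep_mem p) hw
    obtain ⟨q, hq⟩ := exists_point hpv
    obtain ⟨r, hr⟩ := exists_point hpw
    have hcl : ∀ {u : V} {q : X}, u ∈ rad (K := K) (vecs X) (vecs Y) p.1.rep →
        (∀ W : Submodule K V, q.1.rep ∈ W ↔ p.1.rep + u ∈ W) → h.radLine q = L := by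
      intro u q hu hq
      rw [← hpL, h.radLine_eq_iff, hq]
      exact Submodule.add_mem _ (self_mem_sing _) (rad_le_sing _ hu)
    refine ⟨p, hpL, q, hcl hv hq, r, hcl hw hr, ?_, ?_⟩
    · intro he
      have h1 := (hq _).1 (eq_iff_rep.1 he.symm)
      have h2 := (Submodule.add_mem_iff_right _ (Submodule.mem_span_singleton_self _)).1 h1
      exact h.sys.self_notMem_rad (rep_mem p) (single_le hv (single_comm hv0 h2))
    · rintro ⟨l, hl, hpl, hql, hrl⟩
      obtain ⟨a, ha, u, hu, hu0, rfl⟩ := h.mem_class_lines.1 hl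
      have hu' : u ∈ rad (K := K) (vecs X) (vecs Y) p.1.rep := by rw [← hpL] at hu; exact hu
      rw [h.span_eq_of_mem (hpL ▸ hu) hpl] at hql hrl
      have hin : ∀ {s : V}, s ∈ rad (K := K) (vecs X) (vecs Y) p.1.rep →
          p.1.rep + s ∈ Submodule.span K {p.1.rep, u} → s ∈ Submodule.span K {u} := by
        intro s hs hm
        obtain ⟨α, β, hαβ⟩ := mem_pair.1
          ((Submodule.add_mem_iff_right _ (left_mem_pair _ _)).1 hm)
        have hα : α = 0 := by
          by_contra h0
          refine h.sys.self_notMem_rad (rep_mem p) ((Submodule.smul_mem_iff _ h0).1 ?_)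
          rw [show α • p.1.rep = s - β • u by rw [hαβ]; abel]
          exact Submodule.sub_mem _ hs (Submodule.smul_mem _ _ hu')
        exact mem_single.2 ⟨β, by rw [hαβ, hα]; simp⟩
      have h1 := hin hv ((hq _).1 (mem_tubePts.1 hql))
      have h2 := hin hw ((hr _).1 (mem_tubePts.1 hrl))
      exact hwv (single_le (single_comm hv0 h1) h2)

/-- The tubes whose points have radicals in the pencil of `v` are those with vertex `v`. -/
lemma subset_preimage_iff (h : IsRadicalPlane (vecs X) (vecs Y) Ξ π) (hv : v ∈ π) (hv0 : v ≠ 0)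
    (hξ : ξ ∈ Ξ) : tubePts X ξ ⊆ h.radLine ⁻¹' pencil π v ↔ IsVTube (vecs X) ξ v := by
  constructor
  · intro hs
    obtain ⟨w, hw, ht⟩ := h.sys.tube ξ hξ
    have h1 : v ∈ Submodule.span K {w} := by
      refine h.mem_single_vertex hξ ht fun a ha haξ => ?_
      obtain ⟨p, hp⟩ := exists_point ha
      have h2 : v ∈ (h.radLine p).1 := hs (mem_tubePts.2 ((hp ξ).2 haξ))
      rwa [h.radLine_eq ha hp] at h2
    exact h.sys.tube_of_mem hξ (h.mem_Y hv hv0) (single_le ht.mem h1)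
  · intro ht p hp
    exact h.sys.vertex_mem_rad hξ ht (rep_mem p) (mem_tubePts.1 hp)

/-- The tubes with vertex `v` through a point, or equivalently through its generator. -/
def star (X : Set (Projectivization K V)) (Ξ : Set (Submodule K V)) (v a : V) : Set (Set X) :=
  {E | ∃ ξ ∈ Ξ, IsVTube (vecs X) ξ v ∧ a ∈ ξ ∧ E = tubePts X ξ}

/-- Among the tubes with vertex `v`, the lines are the sets of tubes through one generator. -/
lemma mem_pencil_lines (h : IsRadicalPlane (vecs X) (vecs Y) Ξ π) (hv : v ∈ π) (hv0 : v ≠ 0)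
    {l : Set (Set X)} :
    l ∈ {l | ∃ C D, (C ∈ tubes X Ξ ∧ C ⊆ h.radLine ⁻¹' pencil π v) ∧
      (D ∈ tubes X Ξ ∧ D ⊆ h.radLine ⁻¹' pencil π v) ∧ C ≠ D ∧
      l = {E | (E ∈ tubes X Ξ ∧ E ⊆ h.radLine ⁻¹' pencil π v) ∧ C ∩ D ⊆ E}} ↔
    ∃ a ∈ vecs X, v ∈ rad (K := K) (vecs X) (vecs Y) a ∧ l = star X Ξ v a := by
  have key : ∀ ξ ∈ Ξ, IsVTube (vecs X) ξ v → ∀ ζ ∈ Ξ, IsVTube (vecs X) ζ v → ξ ≠ ζ →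
      ∀ a ∈ vecs X, a ∈ ξ → a ∈ ζ →
      {E | (E ∈ tubes X Ξ ∧ E ⊆ h.radLine ⁻¹' pencil π v) ∧ tubePts X ξ ∩ tubePts X ζ ⊆ E} =
        star X Ξ v a := by
    intro ξ hξ hvξ ζ hζ hvζ hne a ha haξ haζ
    ext E
    constructor
    · rintro ⟨⟨⟨η, hη, rfl⟩, hE⟩, hsub⟩
      obtain ⟨p, hp⟩ := exists_point ha
      have h1 : p ∈ tubePts X η :=
        hsub ⟨mem_tubePts.2 ((hp ξ).2 haξ), mem_tubePts.2 ((hp ζ).2 haζ)⟩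
      exact ⟨η, hη, (h.subset_preimage_iff hv hv0 hη).1 hE, (hp η).1 (mem_tubePts.1 h1), rfl⟩
    · rintro ⟨η, hη, hvη, haη, rfl⟩
      refine ⟨⟨⟨η, hη, rfl⟩, (h.subset_preimage_iff hv hv0 hη).2 hvη⟩, fun p hp => ?_⟩
      exact mem_tubePts.2 (pair_le haη hvη.mem (h.sys.mem_pair_of_mem_two hξ hζ hne hvξ ha haξ
        haζ (mem_tubePts.1 hp.1) (mem_tubePts.1 hp.2)))
  constructor
  · rintro ⟨_, _, ⟨⟨ξ, hξ, rfl⟩, hC⟩, ⟨⟨ζ, hζ, rfl⟩, hD⟩, hne, rfl⟩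
    have hvξ := (h.subset_preimage_iff hv hv0 hξ).1 hC
    have hvζ := (h.subset_preimage_iff hv hv0 hζ).1 hD
    obtain ⟨a, ha, haξ, haζ⟩ := h.exists_mem_mem hξ hζ
    exact ⟨a, ha, h.sys.vertex_mem_rad hξ hvξ ha haξ,
      key ξ hξ hvξ ζ hζ hvζ (fun he => hne (by rw [he])) a ha haξ haζ⟩
  · rintro ⟨a, ha, hva, rfl⟩
    obtain ⟨ξ, hξ, hvξ, haξ, -⟩ := h.sys.exists_tube_of_rad ha hva hv0
    obtain ⟨ζ, hζ, hvζ, haζ, hne⟩ := h.exists_tube_ne hξ hvξ ha haξ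
    exact ⟨tubePts X ξ, tubePts X ζ,
      ⟨⟨ξ, hξ, rfl⟩, (h.subset_preimage_iff hv hv0 hξ).2 hvξ⟩,
      ⟨⟨ζ, hζ, rfl⟩, (h.subset_preimage_iff hv hv0 hζ).2 hvζ⟩,
      fun he => hne (h.tubePts_injective hξ hζ he).symm,
      (key ξ hξ hvξ ζ hζ hvζ hne.symm a ha haξ haζ).symm⟩

lemma mem_star_iff (h : IsRadicalPlane (vecs X) (vecs Y) Ξ π) {a : V} (hξ : ξ ∈ Ξ)
    (hv : IsVTube (vecs X) ξ v) : tubePts X ξ ∈ star X Ξ v a ↔ a ∈ ξ := by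
  constructor
  · rintro ⟨ζ, hζ, -, ha, he⟩
    rwa [h.tubePts_injective hξ hζ he]
  · exact fun ha => ⟨ξ, hξ, hv, ha, rfl⟩

lemma star_eq (h : IsRadicalPlane (vecs X) (vecs Y) Ξ π) {a b : V}
    (hv : IsVTube (vecs X) ξ v) (hb : b ∈ vecs X) (hba : b ∈ Submodule.span K {a, v}) :
    star X Ξ v b = star X Ξ v a := by
  have hab : a ∈ Submodule.span K {b, v} :=
    pair_exchange hba (hv.notMem_single h.sys.coneX hb)
  ext E
  constructor
  · rintro ⟨ζ, hζ, tζ, hbζ, rfl⟩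
    exact ⟨ζ, hζ, tζ, pair_le hbζ tζ.mem hab, rfl⟩
  · rintro ⟨ζ, hζ, tζ, haζ, rfl⟩
    exact ⟨ζ, hζ, tζ, pair_le haζ tζ.mem hba, rfl⟩

/-- The tubes with a common vertex `v`, together with their generators, form an affine plane, in
which generators are parallel when they belong to the same class. -/
lemma isAffinePlane_pencil (h : IsRadicalPlane (vecs X) (vecs Y) Ξ π) (hv : v ∈ π)
    (hv0 : v ≠ 0) :
    IsAffinePlane {C | C ∈ tubes X Ξ ∧ C ⊆ h.radLine ⁻¹' pencil π v}
      {l | ∃ C D, (C ∈ tubes X Ξ ∧ C ⊆ h.radLine ⁻¹' pencil π v) ∧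
        (D ∈ tubes X Ξ ∧ D ⊆ h.radLine ⁻¹' pencil π v) ∧ C ≠ D ∧
        l = {E | (E ∈ tubes X Ξ ∧ E ⊆ h.radLine ⁻¹' pencil π v) ∧ C ∩ D ⊆ E}} := by
  have := h.sys.finite
  have hP : ∀ ξ ∈ Ξ, (tubePts X ξ ∈ tubes X Ξ ∧ tubePts X ξ ⊆ h.radLine ⁻¹' pencil π v) ↔
      IsVTube (vecs X) ξ v := fun ξ hξ =>
    (and_iff_right ⟨ξ, hξ, rfl⟩).trans (h.subset_preimage_iff hv hv0 hξ)
  refine ⟨?_, ?_, ?_, ?_⟩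
  · rintro l ⟨C, D, -, -, -, rfl⟩ E hE
    exact hE.1
  · rintro _ ⟨⟨ξ, hξ, rfl⟩, hC⟩ _ ⟨⟨ζ, hζ, rfl⟩, hD⟩ hne
    have hvξ := (h.subset_preimage_iff hv hv0 hξ).1 hC
    have hvζ := (h.subset_preimage_iff hv hv0 hζ).1 hD
    obtain ⟨a, ha, haξ, haζ⟩ := h.exists_mem_mem hξ hζ
    refine ⟨star X Ξ v a, ⟨(h.mem_pencil_lines hv hv0).2
      ⟨a, ha, h.sys.vertex_mem_rad hξ hvξ ha haξ, rfl⟩, (h.mem_star_iff hξ hvξ).2 haξ,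
      (h.mem_star_iff hζ hvζ).2 haζ⟩, ?_⟩
    rintro l ⟨hl, hξl, hζl⟩
    obtain ⟨b, hb, hvb, rfl⟩ := (h.mem_pencil_lines hv hv0).1 hl
    exact h.star_eq hvξ hb (h.sys.mem_pair_of_mem_two hξ hζ (fun he => hne (by rw [he]))
      hvξ ha haξ haζ ((h.mem_star_iff hξ hvξ).1 hξl) ((h.mem_star_iff hζ hvζ).1 hζl))
  · rintro l hl _ ⟨⟨ξ, hξ, rfl⟩, hC⟩ hξl
    have hvξ := (h.subset_preimage_iff hv hv0 hξ).1 hC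
    obtain ⟨a, ha, hva, rfl⟩ := (h.mem_pencil_lines hv hv0).1 hl
    have haξ : a ∉ ξ := fun hc => hξl ((h.mem_star_iff hξ hvξ).2 hc)
    -- the parallel is the generator of the tube in the class of `a`
    obtain ⟨b, hb, hbξ, hba⟩ := h.sys.exists_mem_sing_of_vertex h.thick hξ hvξ ha hva
    refine ⟨star X Ξ v b, ⟨(h.mem_pencil_lines hv hv0).2
      ⟨b, hb, h.sys.vertex_mem_rad hξ hvξ hb hbξ, rfl⟩, (h.mem_star_iff hξ hvξ).2 hbξ, ?_⟩, ?_⟩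
    · rw [Set.disjoint_left]
      rintro _ ⟨ζ, hζ, hvζ, hbζ, rfl⟩ hm
      have haζ := (h.mem_star_iff hζ hvζ).1 hm
      exact haξ (pair_le hbξ hvξ.mem (h.sys.mem_pair_of_sing hζ hvζ hb hbζ haζ
        (h.sys.mem_sing_symm ha hb hba)))
    · rintro m ⟨hm, hξm, hdis⟩
      obtain ⟨c, hc, hvc, rfl⟩ := (h.mem_pencil_lines hv hv0).1 hm
      have hcξ := (h.mem_star_iff hξ hvξ).1 hξm
      have hca : c ∈ sing (K := K) (vecs X) (vecs Y) a := by
        by_contra hca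
        obtain ⟨ζ, hζ, haζ, hcζ, hvζ⟩ := h.sys.exists_join_of_rads ha hc hca hva hvc hv0
        exact Set.disjoint_left.1 hdis ((h.mem_star_iff hζ hvζ).2 hcζ)
          ((h.mem_star_iff hζ hvζ).2 haζ)
      exact h.star_eq hvξ hc (h.sys.mem_pair_of_sing hξ hvξ hb hbξ hcξ
        (by rw [h.sys.sing_eq ha hb hba]; exact hca))
  · obtain ⟨ξ, hξ, hvξ⟩ := h.sys.vertex v (h.mem_Y hv hv0)
    obtain ⟨a, ha, haξ⟩ := hvξ.nonempty
    obtain ⟨b, hb, hbξ, hba⟩ := hvξ.exists_notMem ha haξ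
    have hba' := h.sys.notMem_sing_of_notMem_pair hξ hvξ ha haξ hbξ hba
    obtain ⟨ζ, hζ, hvζ, haζ, hne⟩ := h.exists_tube_ne hξ hvξ ha haξ
    obtain ⟨η, hη, hvη, hbη, haη⟩ := h.exists_tube_notMem hξ hvξ ha haξ hb hbξ hba'
    refine ⟨_, (hP ξ hξ).2 hvξ, _, (hP ζ hζ).2 hvζ, _, (hP η hη).2 hvη,
      fun he => hne (h.tubePts_injective hξ hζ he).symm, ?_⟩
    rintro ⟨l, hl, hξl, hζl, hηl⟩
    obtain ⟨c, hc, hvc, rfl⟩ := (h.mem_pencil_lines hv hv0).1 hl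
    have hca := h.sys.mem_pair_of_mem_two hξ hζ hne.symm hvξ ha haξ haζ
      ((h.mem_star_iff hξ hvξ).1 hξl) ((h.mem_star_iff hζ hvζ).1 hζl)
    exact haη (pair_le ((h.mem_star_iff hη hvη).1 hηl) hvη.mem
      (pair_exchange hca (hvξ.notMem_single h.sys.coneX hc)))

lemma isHjelmslevEpi (h : IsRadicalPlane (vecs X) (vecs Y) Ξ π) :
    IsHjelmslevEpi (tubes X Ξ) (dualLines π) h.radLine where
  epi := h.isGeomEpi
  Hj1_join p q _ := by
    obtain ⟨ξ, hξ, hp, hq⟩ := h.sys.join _ (rep_mem p) _ (rep_mem q)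
    exact ⟨tubePts X ξ, ⟨ξ, hξ, rfl⟩, mem_tubePts.2 hp, mem_tubePts.2 hq⟩
  Hj1_unique p q hpq := h.unique_join_iff hpq
  Hj2_meet := by
    rintro _ ⟨ξ, hξ, rfl⟩ _ ⟨ζ, hζ, rfl⟩ -
    exact h.tubePts_inter_nonempty hξ hζ
  Hj2_unique := by
    rintro _ ⟨ξ, hξ, rfl⟩ _ ⟨ζ, hζ, rfl⟩ -
    exact h.unique_meet_iff hξ hζ
  Hj3 := h.isAffinePlane_class
  Hj4 m hm := by
    obtain ⟨v, hv, hv0, rfl⟩ := mem_dualLines.1 hm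
    exact h.isAffinePlane_pencil hv hv0

end IsHVSystem.IsRadicalPlane

end HjelmslevPlane

theorem mainTheorem6 {K V : Type*} [DivisionRing K] [AddCommGroup V] [Module K V]
    (hK : 2 < ENat.card K)
    (X : Set (Projectivization K V)) (Ξ : Set (Submodule K V))
    (hX : IsHjelmslevianVeronesean X Ξ)
    (hcone : ¬ IsVeroneseCone X (vertexSet X Ξ)) :
    ∃ πY : Submodule K V, finrank K πY = 3 ∧ pts πY = vertexSet X Ξ ∧
      (∀ x ∈ X, ∃! π : Submodule K V,
        x ∈ pts π ∧ ∃ L, IsSingularPlane X (vertexSet X Ξ) π L) ∧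
      ∃ χ : X → DualPoint πY,
        (∀ x : X, ∃ π : Submodule K V,
          (x : Projectivization K V) ∈ pts π ∧
            IsSingularPlane X (vertexSet X Ξ) π (χ x).1) ∧
        IsHjelmslevEpi (tubes X Ξ) (dualLines πY) χ := by
  have hsys := hX.isHVSystem hK
  have hthick : IsHVSystem.Thick (K := K) (vecs X) (vecs (vertexSet X Ξ)) := by
    intro x hx
    by_contra! hlt
    obtain ⟨t, ht, hrad⟩ := hsys.rad_eq_single hx (by omega)
    exact hcone (isVeroneseCone_of_rad_eq hsys ht hrad)
  obtain ⟨π, hπ, hle⟩ := hsys.exists_plane hthick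
  have h : IsHVSystem.IsRadicalPlane (vecs X) (vecs (vertexSet X Ξ)) Ξ π :=
    ⟨hsys, hthick, hπ, hle⟩
  refine ⟨π, hπ, h.pts_plane, fun x hx => ?_, h.radLine, fun x => ?_, h.isHjelmslevEpi⟩
  · exact ⟨_, ⟨rep_mem_iff.1 (IsHVSystem.self_mem_sing _), _, h.isSingularPlane ⟨x, hx⟩⟩,
      fun σ ⟨hxσ, L, hσ⟩ => h.singularPlane_unique ⟨x, hx⟩ (rep_mem_iff.2 hxσ) hσ⟩
  · exact ⟨_, rep_mem_iff.1 (IsHVSystem.self_mem_sing _), h.isSingularPlane x⟩
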